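/- Let $m\ge 0$ and let $\boldsymbol n=(n_1,\dots,n_m)$ be a tuple of nonnegative integers, $n=n_1+\cdots+n_m$. Split $[n]=\{1,\dots,n\}$ into the consecutive boxes $S_j=\{n_1+\cdots+n_{j-1}+1,\dots,n_1+\cdots+n_j\}$, and let $\mathcal D(\boldsymbol n)$ be the set of inhomogeneous derangements, i.e. the permutations $\sigma$ of $[n]$ with $\sigma(S_j)\cap S_j=\emptyset$ for all $j$. Put $\mathrm{exc}(\sigma)=\#\{i: i<\sigma(i)\}$, $$\mathrm{cr}(\sigma)=\sum_{i=1}^n\#\{j: j<i\le\sigma(j)<\sigma(i)\}+\sum_{i=1}^n\#\{j: j>i>\sigma(j)>\sigma(i)\},\qquad I(\boldsymbol n|q)=\sum_{\sigma\in\mathcal D(\boldsymbol n)}y^{\mathrm{exc}(\sigma)}q^{\mathrm{cr}(\sigma)} .$$ With $[k]_q=1+q+\cdots+q^{k-1}$, let the $q$-Laguerre polynomials $L_k(x|q)$ be defined by $L_{-1}=0$, $L_0=1$ and $$L_{k+1}(x|q)=(x-y[k+1]_q-[k]_q)L_k(x|q)-y[k]_q^2L_{k-1}(x|q)\qquad(k\ge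 0).$$ (a) Let $y,q$ be real with $-1<q<1$, $y\ge 1$ and $yq^2\le 1$. With $(q;q)_\infty=\prod_{k\ge 0}(1-q^{k+1})$, put $$u_2(x)=\frac{(1-q)^2}{2y}x^2-\frac{(1-q)(1+y)}{y}x+\frac{y^2+1}{2y},\qquad v_2(x)=\frac{(q-1)x+y+1}{2\sqrt y},\qquad B_\pm=\frac{(1\pm\sqrt y)^2}{1-q},$$ and, for a polynomial $f$, $$\mathcal L_2(f)=\frac{(q;q)_\infty^2}{2\pi}\,\frac{1-q}{2\sqrt y}\int_{B_-}^{B_+}\Bigg(\prod_{k=0}^\infty\frac{1-2u_2(x)q^k+q^{2k}}{[1-2v_2(x)q^k/\sqrt y+q^{2k}/y]\,[1-2v_2(x)q^{k+1}\sqrt y+q^{2k+2}y]}\Bigg)\frac{f(x)\,dx}{\sqrt{1-v_2(x)^2}} .$$ Then for $f=L_{n_1}(x|q)\cdots L_{n_m}(x|q)$ the integrand is integrable on $[B_-,B_+]$ and $$I(\boldsymbol n|q)=\mathcal L_2\big(L_{n_1}(x|q)\cdots L_{n_m}(x|q)\big).$$ (b) Let $y,q$ be arbitrary elements of a commutative ring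 $R$ (for instance, indeterminates), and let $\Lambda:R[x]\to R$ be an $R$-linear functional with $\Lambda(1)=1$ and $\Lambda(L_k(x|q)L_l(x|q))=0$ for all $k\ne l$. Then $$I(\boldsymbol n|q)=\Lambda\big(L_{n_1}(x|q)\cdots L_{n_m}(x|q)\big).$$ -/

import Mathlib

open Polynomial

namespace QLaguerre

/-! ### Combinatorics: boxes, inhomogeneous derangements, excedances, crossings -/

/-- The box `S_j`: the `j`-th of the consecutive intervals, of lengths `n 0, n 1, …`, that make up
the ground set `{0, …, N - 1}`, `N = ∑ i, n i`. -/
def box {m : ℕ} (n : Fin m → ℕ) (j : Fin m) : Finset (Fin (∑ i, n i)) :=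
  Finset.univ.filter fun k =>
    ∑ i ∈ Finset.Iio j, n i ≤ (k : ℕ) ∧ (k : ℕ) < ∑ i ∈ Finset.Iic j, n i

/-- The set `D(n)` of inhomogeneous derangements: permutations `σ` with `σ(S_j) ∩ S_j = ∅` for
every box `S_j`. -/
def inhomDerangements {m : ℕ} (n : Fin m → ℕ) : Finset (Equiv.Perm (Fin (∑ i, n i))) :=
  Finset.univ.filter fun σ => ∀ j, (box n j).image σ ∩ box n j = ∅

/-- Number of excedances of a permutation. -/
def exc {N : ℕ} (σ : Equiv.Perm (Fin N)) : ℕ :=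
  (Finset.univ.filter fun i => i < σ i).card

/-- Number of crossings of a permutation. -/
def cr {N : ℕ} (σ : Equiv.Perm (Fin N)) : ℕ :=
  ∑ i, (Finset.univ.filter fun j => j < i ∧ i ≤ σ j ∧ σ j < σ i).card +
    ∑ i, (Finset.univ.filter fun j => j > i ∧ i > σ j ∧ σ j > σ i).card

/-- The enumerative polynomial `I(n; y | q)` of inhomogeneous derangements. -/
def derangementSum {R : Type*} [CommRing R] (y q : R) {m : ℕ} (n : Fin m → ℕ) : R :=
  ∑ σ ∈ inhomDerangements n, y ^ exc σ * q ^ cr σ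

/-! ### The `q`-Laguerre polynomials -/

/-- The `q`-integer `[n]_q = 1 + q + ⋯ + q ^ (n - 1)`. -/
def qInt {R : Type*} [CommRing R] (q : R) (n : ℕ) : R :=
  ∑ i ∈ Finset.range n, q ^ i

/-- The `q`-Laguerre polynomials `L_n(x | q)`, given by their three-term recurrence
`L_{n+1} = (x - y [n+1]_q - [n]_q) L_n - y [n]_q ^ 2 L_{n-1}`, `L_{-1} = 0`, `L_0 = 1`. -/
noncomputable def qLaguerre {R : Type*} [CommRing R] (y q : R) : ℕ → R[X]
  | 0 => 1
  | 1 => X - C (y * qInt q 1 + qInt q 0)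
  | n + 2 => (X - C (y * qInt q (n + 2) + qInt q (n + 1))) * qLaguerre y q (n + 1) -
      C (y * qInt q (n + 1) ^ 2) * qLaguerre y q n

/-- A normalized linear functional with respect to which the `q`-Laguerre polynomials are
orthogonal. -/
def IsOrthogonalityFunctional {R : Type*} [CommRing R] (y q : R) (Λ : R[X] →ₗ[R] R) : Prop :=
  Λ 1 = 1 ∧ ∀ k l : ℕ, k ≠ l → Λ (qLaguerre y q k * qLaguerre y q l) = 0

/-! ### The explicit moment functional -/

/-- The infinite `q`-shifted factorial `(a; q)_∞`. -/
noncomputable def qPochInf (a q : ℝ) : ℝ :=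
  ∏' k : ℕ, (1 - a * q ^ k)

noncomputable def u₂ (y q x : ℝ) : ℝ :=
  (1 - q) ^ 2 / (2 * y) * x ^ 2 - (1 - q) * (1 + y) / y * x + (y ^ 2 + 1) / (2 * y)

noncomputable def v₂ (y q x : ℝ) : ℝ :=
  (q - 1) / (2 * √y) * x + (y + 1) / (2 * √y)

/-- The density, up to the constant factor, of the orthogonality measure. -/
noncomputable def weight (y q x : ℝ) : ℝ :=
  (∏' k : ℕ, (1 - 2 * u₂ y q x * q ^ k + q ^ (2 * k)) /
    ((1 - 2 * v₂ y q x * q ^ k / √y + q ^ (2 * k) / y) *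
      (1 - 2 * v₂ y q x * q ^ (k + 1) * √y + q ^ (2 * k + 2) * y))) /
    √(1 - v₂ y q x ^ 2)

/-- The left end point `B_-` of the support. -/
noncomputable def Bminus (y q : ℝ) : ℝ := (1 - √y) ^ 2 / (1 - q)

/-- The right end point `B_+` of the support. -/
noncomputable def Bplus (y q : ℝ) : ℝ := (1 + √y) ^ 2 / (1 - q)

/-- The moment functional `𝓛₂`, as an explicit integral over `[B_-, B_+]`. -/
noncomputable def momentFunctional (y q : ℝ) (f : ℝ[X]) : ℝ :=
  qPochInf q q * qPochInf q q / (2 * Real.pi) * ((1 - q) / (2 * √y)) *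
    ∫ x in (Bminus y q)..(Bplus y q), weight y q x * f.eval x

end QLaguerre

/-! Both parts rest on one purely algebraic identity: with `N` the size of the ground set, `L_{n_1}
⋯ L_{n_m}` is the sum over rook placements `M`, on the board of cells joining different boxes, of
`rookWeight M * L_{N - |M|}` (`sum_rooks_board_eq_prod`). A functional with `Λ 1 = 1` that kills
every `L_k` with `k > 0` keeps only the placements with `N` rooks. These are the graphs of the
inhomogeneous derangements, and on them the weight is `y ^ exc * q ^ cr`. This is
`derangementSum_eq_of_vanishing`; orthogonality to `L_0 = 1` gives part (b) at once.

The identity is proved box by box. The product `L_k L_h` expands into the `L_{h+k-r-s}` with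
coefficients `linWeight q h y k r s` (`qLaguerre_mul`), because both sides obey the same recurrence
in `k` under multiplication by `L_1`. On the board, a placement leaving `h` rows and `h` columns
free among the old elements can be extended by a box of size `k` using `r` new columns and `s` new
rows, and the total weight of these extensions is the same `linWeight` (`sum_rooks_board_block`).
The two sides meet in `sum_linWeight_succ`: raising `k` by one is the operator that adds one row and
then one column.

For part (a) it remains to show that the integral functional is normalized and kills `L_k` for `k >
0`. The substitution `x = (y + 1 - 2√y cos θ) / (1 - q)` turns `L_k` into a multiple of the
Al-Salam–Chihara polynomial with `a = 1/√y`, `b = q√y`, and the density into its weight. The total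
mass comes from the continuous `q`-Hermite polynomials: their orthogonality follows from the Fourier
coefficients of `(e^{2iθ}; q)_∞ (e^{-2iθ}; q)_∞`, their generating function is the reciprocal
product occurring in the weight, and so the mass is a multiple of Euler's series at `ab`, first for
`|a|, |b| < 1` and then by a limit when one parameter has absolute value 1. Replacing `a` by `aq`
multiplies the weight by a polynomial linear in `cos θ`; with the matching contiguous relation
(`factor_mul_ascPoly`) this shows by induction on the degree that all polynomials of positive degree
integrate to zero (`integral_ascPoly`). -/

namespace QLaguerre

/-! ### Triangular numbers and `q`-integers -/

/-- The triangular number `d (d + 1) / 2` of an integer. -/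
def tri (d : ℤ) : ℕ := (d * (d + 1) / 2).toNat

theorem tri_cast (d : ℤ) : (2 * tri d : ℤ) = d * (d + 1) := by
  have h0 : 0 ≤ d * (d + 1) := by
    rcases le_or_gt 0 d with h | h
    · positivity
    · exact mul_nonneg_of_nonpos_of_nonpos h.le (by omega)
  have h1 : Even (d * (d + 1)) := Int.even_mul_succ_self d
  unfold tri
  rw [Int.toNat_of_nonneg (by omega)]
  exact Int.mul_ediv_cancel' h1.two_dvd

theorem tri_succ (d : ℤ) : (tri (d + 1) : ℤ) = tri d + (d + 1) := by
  have h1 := tri_cast d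
  have h2 := tri_cast (d + 1)
  linarith

@[simp] theorem tri_zero : tri 0 = 0 := rfl

section QInt

variable {R : Type*} [CommRing R] (q : R)

@[simp] theorem qInt_zero : qInt q 0 = 0 := by simp [qInt]

@[simp] theorem qInt_one : qInt q 1 = 1 := by simp [qInt]

theorem qInt_succ (n : ℕ) : qInt q (n + 1) = q * qInt q n + 1 := by
  unfold qInt
  rw [Finset.sum_range_succ', Finset.mul_sum]
  simp [pow_succ']

theorem qInt_add (m n : ℕ) : qInt q (m + n) = qInt q m + q ^ m * qInt q n := by
  unfold qInt
  rw [Finset.sum_range_add, Finset.mul_sum]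
  simp [pow_add]

theorem qInt_eq_add_sub {m n k : ℕ} (h : k = m + n) :
    qInt q k = qInt q m + q ^ m * qInt q n := by rw [h, qInt_add]

end QInt

/-! ### Linearization coefficients -/

section Linearization

variable {R : Type*} [CommRing R] (q : R) (h : ℕ)

/-- The product of the `q`-falling factorial `[h][h-1]⋯[h-r+1]` with the Gaussian binomial
coefficient `[k choose r]`, defined through the `q`-Pascal recurrence. -/
def linCoeff : ℕ → ℕ → R
  | _, 0 => 1
  | 0, _ + 1 => 0
  | k + 1, r + 1 => linCoeff k (r + 1) + q ^ (k - r) * qInt q (h - r) * linCoeff k r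

@[simp] theorem linCoeff_zero_right (k : ℕ) : linCoeff q h k 0 = 1 := by
  cases k <;> simp [linCoeff]

theorem linCoeff_succ_succ (k r : ℕ) : linCoeff q h (k + 1) (r + 1) =
    linCoeff q h k (r + 1) + q ^ (k - r) * qInt q (h - r) * linCoeff q h k r := by
  simp [linCoeff]

theorem linCoeff_eq_zero_of_lt {k r : ℕ} (hr : k < r) : linCoeff q h k r = 0 := by
  induction k generalizing r with
  | zero => obtain ⟨r, rfl⟩ := Nat.exists_eq_succ_of_ne_zero hr.ne'; simp [linCoeff]
  | succ k ih =>
    obtain ⟨r, rfl⟩ := Nat.exists_eq_succ_of_ne_zero (by omega : r ≠ 0)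
    rw [Nat.succ_eq_add_one, linCoeff_succ_succ, ih (by omega), ih (by omega)]; simp

theorem linCoeff_eq_zero_of_gt {k r : ℕ} (hr : h < r) : linCoeff q h k r = 0 := by
  induction k generalizing r with
  | zero => obtain ⟨r, rfl⟩ := Nat.exists_eq_succ_of_ne_zero (by omega : r ≠ 0); simp [linCoeff]
  | succ k ih =>
    obtain ⟨r, rfl⟩ := Nat.exists_eq_succ_of_ne_zero (by omega : r ≠ 0)
    rw [Nat.succ_eq_add_one, linCoeff_succ_succ, ih (by omega),
      show h - r = 0 by omega]; simp

/-- Absorption for the Gaussian binomial in `k`. It is conditional on the ratio identity at level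
`k` because the two are proved in alternation: the induction step of the next lemma calls it. -/
theorem qInt_mul_linCoeff_aux (k : ℕ)
    (ih : ∀ s, qInt q (s + 1) * linCoeff q h k (s + 1) =
      qInt q (h - s) * qInt q (k - s) * linCoeff q h k s) (s : ℕ) :
    qInt q (k + 1) * linCoeff q h k s = qInt q (k + 1 - s) * linCoeff q h (k + 1) s := by
  rcases lt_or_ge k s with hs | hs
  · rw [linCoeff_eq_zero_of_lt q h hs, show k + 1 - s = 0 by omega]; simp
  · cases s with
    | zero => simp
    | succ s =>
      rw [linCoeff_succ_succ, qInt_eq_add_sub q (show k + 1 = (k - s) + (s + 1) by omega),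
        show k + 1 - (s + 1) = k - s by omega]
      linear_combination q ^ (k - s) * ih s

/-- Passing from `s` to `s + 1` multiplies the falling factorial by `[h-s]` and the binomial by
`[k-s]/[s+1]`. The relation is kept free of division since `R` is an arbitrary commutative ring. -/
theorem qInt_succ_mul_linCoeff_succ (k s : ℕ) : qInt q (s + 1) * linCoeff q h k (s + 1) =
    qInt q (h - s) * qInt q (k - s) * linCoeff q h k s := by
  induction k generalizing s with
  | zero => simp [linCoeff_eq_zero_of_lt]
  | succ k ih =>
    have h2 := qInt_mul_linCoeff_aux q h k ih s
    rw [linCoeff_succ_succ]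
    rcases lt_or_ge k s with hs | hs
    · rw [linCoeff_eq_zero_of_lt q h (show k < s + 1 by omega), linCoeff_eq_zero_of_lt q h hs,
        show k + 1 - s = 0 by omega]; simp
    · have h3 := qInt_eq_add_sub q (show k + 1 = (k - s) + (s + 1) by omega)
      linear_combination ih s + qInt q (h - s) * h2 - qInt q (h - s) * linCoeff q h k s * h3

theorem qInt_succ_mul_linCoeff (k s : ℕ) :
    qInt q (k + 1) * linCoeff q h k s = qInt q (k + 1 - s) * linCoeff q h (k + 1) s :=
  qInt_mul_linCoeff_aux q h k (qInt_succ_mul_linCoeff_succ q h k) s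

/-- The `q`-Pascal rule read as an operator on the test function `F`, the form in which it can be
compared with adding a row or a column to a board. -/
theorem sum_linCoeff_succ (k : ℕ) (F : ℕ → R) :
    ∑ r ∈ Finset.range (k + 2), linCoeff q h (k + 1) r * F r =
      ∑ r ∈ Finset.range (k + 1),
        linCoeff q h k r * (F r + q ^ (k - r) * qInt q (h - r) * F (r + 1)) := by
  have e1 : ∑ r ∈ Finset.range (k + 1), linCoeff q h k r * F r =
      ∑ r ∈ Finset.range (k + 1), linCoeff q h k (r + 1) * F (r + 1) + F 0 := by
    have := Finset.sum_range_succ' (fun r => linCoeff q h k r * F r) (k + 1)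
    rw [Finset.sum_range_succ, linCoeff_eq_zero_of_lt q h (Nat.lt_succ_self k)] at this
    simpa using this
  rw [Finset.sum_range_succ']
  simp only [linCoeff_succ_succ, mul_add, add_mul, Finset.sum_add_distrib, e1]
  simp only [linCoeff_zero_right, one_mul]
  rw [add_right_comm]
  congr 1
  exact Finset.sum_congr rfl fun r _ => by ring

/-- The coefficient of `L_{h+k-r-s}` in the expansion of `L_k L_h`. -/
def linWeight (y : R) (k r s : ℕ) : R :=
  y ^ r * q ^ tri ((r : ℤ) - s) * linCoeff q h k r * linCoeff q h k s

theorem linWeight_eq_zero (y : R) {k r s : ℕ} (hrs : h < r ∨ h < s) :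
    linWeight q h y k r s = 0 := by
  unfold linWeight
  rcases hrs with hr | hr <;> simp [linCoeff_eq_zero_of_gt q h hr]

/-- The factor `q ^ tri (r - s)` is there to exchange the two indices in the Pascal exponents: since
`tri (d + 1) = tri d + d + 1`, the `k - r` produced by raising `r` becomes `k + 1 - s`, which is the
number of rows of the growing box still free. -/
theorem pow_tri_left {r s k : ℕ} (hr : r ≤ k) (hs : s ≤ k) :
    q ^ tri (((r + 1 : ℕ) : ℤ) - s) * q ^ (k - r) = q ^ tri ((r : ℤ) - s) * q ^ (k + 1 - s) := by
  rw [← pow_add, ← pow_add]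
  congr 1
  have := tri_succ ((r : ℤ) - s)
  rw [show ((r + 1 : ℕ) : ℤ) - s = (r : ℤ) - s + 1 by push_cast; ring]
  omega

theorem pow_tri_right {r s k : ℕ} (hr : r ≤ k) (hs : s ≤ k) :
    q ^ tri ((r : ℤ) - (s + 1 : ℕ)) * q ^ (k - s) = q ^ tri ((r : ℤ) - s) * q ^ (k - r) := by
  rw [← pow_add, ← pow_add]
  congr 1
  have := tri_succ ((r : ℤ) - (s + 1 : ℕ))
  rw [show (r : ℤ) - (s + 1 : ℕ) + 1 = (r : ℤ) - s by push_cast; ring] at this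
  omega

/-- The right side is a composite of two optional moves: first `s` may grow, with weight `q^(k-r)
[h-s]`, then `r` may grow, with weight `y q^(k+1-s) [h-r]` for the updated `s`. The same composite
appears in `sum_rooks_board_succ`. -/
theorem sum_linWeight_succ (y : R) (k : ℕ) (Φ : ℕ → ℕ → R) :
    ∑ r ∈ Finset.range (k + 2), ∑ s ∈ Finset.range (k + 2), linWeight q h y (k + 1) r s * Φ r s =
      ∑ r ∈ Finset.range (k + 1), ∑ s ∈ Finset.range (k + 1), linWeight q h y k r s *
        ((Φ r s + y * q ^ (k + 1 - s) * qInt q (h - r) * Φ (r + 1) s) +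
          q ^ (k - r) * qInt q (h - s) *
            (Φ r (s + 1) + y * q ^ (k - s) * qInt q (h - r) * Φ (r + 1) (s + 1))) := by
  have e : ∀ k, ∑ r ∈ Finset.range (k + 1), ∑ s ∈ Finset.range (k + 1),
      linWeight q h y k r s * Φ r s =
      ∑ r ∈ Finset.range (k + 1), linCoeff q h k r *
        (∑ s ∈ Finset.range (k + 1), linCoeff q h k s *
          (y ^ r * q ^ tri ((r : ℤ) - s) * Φ r s)) := fun k => by
    refine Finset.sum_congr rfl fun r _ => ?_
    rw [Finset.mul_sum]
    exact Finset.sum_congr rfl fun s _ => by unfold linWeight; ring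
  rw [e (k + 1), sum_linCoeff_succ]
  refine Finset.sum_congr rfl fun r hr => ?_
  rw [sum_linCoeff_succ, sum_linCoeff_succ, Finset.mul_sum, ← Finset.sum_add_distrib,
    Finset.mul_sum]
  refine Finset.sum_congr rfl fun s hs => ?_
  have hr' : r ≤ k := by simpa [Nat.lt_succ_iff] using hr
  have hs' : s ≤ k := by simpa [Nat.lt_succ_iff] using hs
  have h1 := pow_tri_left q hr' hs'
  have h2 := pow_tri_right q hr' hs'
  have h3 : tri (((r + 1 : ℕ) : ℤ) - (s + 1 : ℕ)) = tri ((r : ℤ) - s) := by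
    congr 1; push_cast; ring
  rw [h3, linWeight, pow_succ y r]
  linear_combination (linCoeff q h k r * linCoeff q h k s * y ^ r) *
    (y * qInt q (h - r) * Φ (r + 1) s * h1 + qInt q (h - s) * Φ r (s + 1) * h2)

end Linearization

/-! ### The three-term recurrence for the linearization expansion. -/

section Recurrence

variable {R : Type*} [CommRing R] (y q : R)

theorem qLaguerre_zero : qLaguerre y q 0 = 1 := by rw [qLaguerre]

theorem qLaguerre_one : qLaguerre y q 1 = X - C y := by rw [qLaguerre]; simp

/-- With `X = L_1 + y` the middle coefficient becomes `y[n+1] + [n] - y = (yq + 1)[n]`. At `n = 0`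
the truncated index `n - 1` is harmless, as `[0] = 0`. -/
theorem qLaguerre_one_mul (n : ℕ) : qLaguerre y q 1 * qLaguerre y q n =
    qLaguerre y q (n + 1) + (C y * C q + 1) * qInt (C q) n * qLaguerre y q n +
      C y * qInt (C q) n ^ 2 * qLaguerre y q (n - 1) := by
  have hC : ∀ n, C (qInt q n) = qInt (C q) n := fun n => by simp [qInt]
  cases n with
  | zero => simp [qLaguerre_zero]
  | succ n =>
    rw [show n + 1 + 1 = n + 2 from rfl, qLaguerre.eq_3, qLaguerre_one]
    simp only [C_add, C_mul, C_pow, hC, add_tsub_cancel_right]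
    rw [qInt_succ _ (n + 1)]
    ring

theorem sum_range_shift {k : ℕ} {F G : ℕ → R} (h0 : F 0 = 0) (hk : F (k + 1) = 0)
    (hs : ∀ s ∈ Finset.range (k + 1), F (s + 1) = G s) :
    ∑ s ∈ Finset.range (k + 1), F s = ∑ s ∈ Finset.range (k + 1), G s := by
  rw [← Finset.sum_congr rfl hs]
  have := Finset.sum_range_succ' F (k + 1)
  rw [Finset.sum_range_succ, hk, h0] at this
  simpa using this

variable (ℓ : ℕ → R) (h : ℕ)

/-- The expansion of the product of the `h`-th and the `k`-th member of a family `ℓ`, according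
to the linearization coefficients. -/
def linProduct (k : ℕ) : R :=
  ∑ r ∈ Finset.range (k + 1), ∑ s ∈ Finset.range (k + 1),
    linWeight q h y k r s * ℓ (h + k - r - s)

/-- Reindexing `s ↦ s + 1`: the factor `[s]` kills the first term, and the ratio of consecutive
coefficients trades `[s]` for `[h-s][k-s]` while the index of `ℓ` drops by one. The companion lemma
does this for `r`. -/
theorem sum_linWeight_shift_right (k : ℕ) :
    ∑ r ∈ Finset.range (k + 1), ∑ s ∈ Finset.range (k + 1),
      linWeight q h y k r s * (qInt q s * q ^ (k + 1 - s) * ℓ (h + k - r - s)) =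
    ∑ r ∈ Finset.range (k + 1), ∑ s ∈ Finset.range (k + 1),
      linWeight q h y k r s *
        (q ^ (k - r) * qInt q (h - s) * qInt q (k - s) * ℓ (h + k - r - s - 1)) := by
  refine Finset.sum_congr rfl fun r hr => sum_range_shift (by simp) ?_ fun s hs => ?_
  · simp [linWeight, linCoeff_eq_zero_of_lt q h (Nat.lt_succ_self k)]
  · have h1 := pow_tri_right q (Nat.lt_succ_iff.1 (Finset.mem_range.1 hr))
      (Nat.lt_succ_iff.1 (Finset.mem_range.1 hs))
    have h2 := qInt_succ_mul_linCoeff_succ q h k s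
    rw [linWeight, linWeight, show k + 1 - (s + 1) = k - s by omega,
      show h + k - r - (s + 1) = h + k - r - s - 1 by omega]
    linear_combination (y ^ r * linCoeff q h k r * ℓ (h + k - r - s - 1)) *
      (qInt q (s + 1) * linCoeff q h k (s + 1) * h1 +
        q ^ tri ((r : ℤ) - s) * q ^ (k - r) * h2)

theorem sum_linWeight_shift_left (k : ℕ) :
    ∑ r ∈ Finset.range (k + 1), ∑ s ∈ Finset.range (k + 1),
      linWeight q h y k r s * (qInt q r * q ^ (k - r) * ℓ (h + k - r - s)) =
    ∑ r ∈ Finset.range (k + 1), ∑ s ∈ Finset.range (k + 1),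
      linWeight q h y k r s *
        (y * q ^ (k - s) * qInt q (h - r) * qInt q (k - r) * ℓ (h + k - r - s - 1)) := by
  rw [Finset.sum_comm]
  conv_rhs => rw [Finset.sum_comm]
  refine Finset.sum_congr rfl fun s hs => sum_range_shift (by simp) ?_ fun r hr => ?_
  · simp [linWeight, linCoeff_eq_zero_of_lt q h (Nat.lt_succ_self k)]
  · have hs' := Nat.lt_succ_iff.1 (Finset.mem_range.1 hs)
    have hr' := Nat.lt_succ_iff.1 (Finset.mem_range.1 hr)
    have h2 := qInt_succ_mul_linCoeff_succ q h k r
    rw [linWeight, linWeight, show h + k - (r + 1) - s = h + k - r - s - 1 by omega, pow_succ y r]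
    rcases hr'.eq_or_lt with rfl | hlt
    · simp [linCoeff_eq_zero_of_lt]
    · have h1 : q ^ tri (((r + 1 : ℕ) : ℤ) - s) * q ^ (k - (r + 1)) =
          q ^ tri ((r : ℤ) - s) * q ^ (k - s) := by
        rw [← pow_add, ← pow_add]
        congr 1
        have := tri_succ ((r : ℤ) - s)
        rw [show ((r + 1 : ℕ) : ℤ) - s = (r : ℤ) - s + 1 by push_cast; ring]
        omega
      linear_combination (y ^ r * y * linCoeff q h k s * ℓ (h + k - r - s - 1)) *
        (qInt q (r + 1) * linCoeff q h k (r + 1) * h1 +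
          q ^ tri ((r : ℤ) - s) * q ^ (k - s) * h2)

theorem qInt_sq_mul_linProduct_pred (k : ℕ) :
    qInt q k ^ 2 * linProduct y q ℓ h (k - 1) =
    ∑ r ∈ Finset.range (k + 1), ∑ s ∈ Finset.range (k + 1),
      linWeight q h y k r s *
        (qInt q (k - r) * qInt q (k - s) * ℓ (h + k - r - s - 1)) := by
  cases k with
  | zero => simp
  | succ k =>
    -- The extra terms `r = k + 1` and `s = k + 1` of the larger range vanish with `[k+1-r]` and
    -- `[k+1-s]`.
    rw [Finset.sum_range_succ]
    simp only [tsub_self, qInt_zero, zero_mul, mul_zero, Finset.sum_const_zero, add_zero]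
    rw [linProduct, Finset.mul_sum]
    refine Finset.sum_congr rfl fun r hr => ?_
    rw [Finset.sum_range_succ _ (k + 1)]
    simp only [tsub_self, qInt_zero, zero_mul, mul_zero, add_zero, add_tsub_cancel_right]
    rw [Finset.mul_sum]
    refine Finset.sum_congr rfl fun s hs => ?_
    simp only [Finset.mem_range] at hr hs
    have h1 := qInt_succ_mul_linCoeff q h k r
    have h2 := qInt_succ_mul_linCoeff q h k s
    rw [linWeight, linWeight, show h + (k + 1) - r - s - 1 = h + k - r - s by omega]
    linear_combination (y ^ r * q ^ tri ((r : ℤ) - s) * ℓ (h + k - r - s)) *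
      (qInt q (k + 1) * linCoeff q h k s * h1 +
        qInt q (k + 1 - r) * linCoeff q h (k + 1) r * h2)

/-- With `N = h + k - r - s`, split `[N]` both as `[k-s] + q^(k-s)[h-r]` and as `[k-r] +
q^(k-r)[h-s]`. In `[N]^2`, the product of the two splittings, the extreme terms belong to
`linProduct` at `k - 1` and `k + 1`. The two mixed terms match what the shift lemmas produce from
the discrepancies `q^(k-s)[s]` and `q^(k-r)[r]` between `[k]` and `[k-s]`, `[k-r]`. -/
theorem mul_linProduct
    (hℓ : ∀ n, ℓ 1 * ℓ n = ℓ (n + 1) + (y * q + 1) * qInt q n * ℓ n +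
      y * qInt q n ^ 2 * ℓ (n - 1)) (k : ℕ) :
    ℓ 1 * linProduct y q ℓ h k = linProduct y q ℓ h (k + 1) +
      (y * q + 1) * qInt q k * linProduct y q ℓ h k +
        y * qInt q k ^ 2 * linProduct y q ℓ h (k - 1) := by
  rw [mul_assoc y, qInt_sq_mul_linProduct_pred]
  have e2 := sum_linWeight_succ q h y k (fun r s => ℓ (h + (k + 1) - r - s))
  rw [show linProduct y q ℓ h (k + 1) = _ from e2]
  have e3 := sum_linWeight_shift_right y q ℓ h k
  have e4 := sum_linWeight_shift_left y q ℓ h k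
  have aux : ∀ {a b c d x : R}, a = b → c = d → x + ((a - b) + y * (c - d)) = 0 → x = 0 := by
    rintro a b c d x rfl rfl H
    simpa using H
  -- Inserting the two shift identities as null terms makes the difference vanish summand by summand
  -- in `(r, s)`.
  refine sub_eq_zero.1 (aux e4 e3 ?_)
  rw [linProduct]
  simp only [Finset.mul_sum, ← Finset.sum_add_distrib, ← Finset.sum_sub_distrib]
  refine Finset.sum_eq_zero fun r hr => Finset.sum_eq_zero fun s hs => ?_
  simp only [Finset.mem_range] at hr hs
  by_cases hrs : h < r ∨ h < s
  -- Outside `r, s ≤ h` the truncated subtractions break the splittings of `[N]`, but the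
  -- coefficient is zero there.
  · simp [linWeight_eq_zero q h y hrs]
  · push Not at hrs
    rw [mul_left_comm, hℓ]
    have h1 : qInt q (h + k - r - s) = _ :=
      qInt_eq_add_sub q (show h + k - r - s = (k - s) + (h - r) by omega)
    have h2 : qInt q (h + k - r - s) = _ :=
      qInt_eq_add_sub q (show h + k - r - s = (k - r) + (h - s) by omega)
    have h3 := qInt_eq_add_sub q (show k = (k - s) + s by omega)
    have h4 := qInt_eq_add_sub q (show k = (k - r) + r by omega)
    have h5 : q ^ (k + 1 - s) = q * q ^ (k - s) := by
      rw [← pow_succ']; congr 1; omega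
    rw [show h + (k + 1) - r - s = h + k - r - s + 1 by omega,
      show h + (k + 1) - (r + 1) - s = h + k - r - s by omega,
      show h + (k + 1) - r - (s + 1) = h + k - r - s by omega,
      show h + (k + 1) - (r + 1) - (s + 1) = h + k - r - s - 1 by omega, h5]
    generalize h + k - r - s = N at *
    generalize qInt q (h - r) = hr at *
    generalize qInt q (h - s) = hs at *
    generalize qInt q (k - s) = ks at *
    generalize qInt q (k - r) = kr at *
    generalize ℓ (N - 1) = l0 at *
    generalize ℓ (N + 1) = l2 at *
    linear_combination (exp := 1) linWeight q h y k r s *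
      (y * q * ℓ N * (h1 - h3) + ℓ N * (h2 - h4) +
        y * l0 * (qInt q N * h1 + (ks + q ^ (k - s) * hr) * h2))

end Recurrence

/-- As functions of `k`, both sides satisfy the recurrence given by multiplication by `L_1`, and
they agree at `k = 0`. The recurrence has order two, so the induction carries `k` and `k + 1`
together. -/
theorem qLaguerre_mul {R : Type*} [CommRing R] (y q : R) (k h : ℕ) :
    qLaguerre y q k * qLaguerre y q h =
      linProduct (C y) (C q) (qLaguerre y q) h k := by
  have key := mul_linProduct (C y) (C q) (qLaguerre y q) h (qLaguerre_one_mul y q)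
  have h0 : qLaguerre y q 0 * qLaguerre y q h = linProduct (C y) (C q) (qLaguerre y q) h 0 := by
    simp [linProduct, qLaguerre_zero, linWeight]
  have : ∀ k, qLaguerre y q k * qLaguerre y q h = linProduct (C y) (C q) (qLaguerre y q) h k ∧
      qLaguerre y q (k + 1) * qLaguerre y q h =
        linProduct (C y) (C q) (qLaguerre y q) h (k + 1) := by
    intro k
    induction k with
    | zero =>
      refine ⟨h0, ?_⟩
      have := key 0
      rw [← h0] at this
      simpa [qLaguerre_zero] using this
    | succ k ih =>
      refine ⟨ih.2, ?_⟩
      have h1 := key (k + 1)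
      rw [Nat.add_sub_cancel, ← ih.1, ← ih.2] at h1
      have h2 := qLaguerre_one_mul y q (k + 1)
      rw [Nat.add_sub_cancel] at h2
      linear_combination h1 - qLaguerre y q h * h2
  exact (this k).1

/-! ### Rook placements -/

/-- A set of cells is a rook placement if no two of its cells share a row or a column. -/
def IsRook (M : Finset (ℕ × ℕ)) : Prop :=
  ∀ x ∈ M, ∀ z ∈ M, x.1 = z.1 ∨ x.2 = z.2 → x = z

/-- The cell `t` shares no row or column with a cell of `M`. -/
def IsFree (M : Finset (ℕ × ℕ)) (t : ℕ × ℕ) : Prop :=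
  ∀ x ∈ M, x.1 ≠ t.1 ∧ x.2 ≠ t.2

open Classical in
/-- The rook placements on a board. -/
noncomputable def rooks (S : Finset (ℕ × ℕ)) : Finset (Finset (ℕ × ℕ)) :=
  S.powerset.filter IsRook

theorem mem_rooks {S M : Finset (ℕ × ℕ)} : M ∈ rooks S ↔ M ⊆ S ∧ IsRook M := by
  simp [rooks]

theorem isRook_insert {M : Finset (ℕ × ℕ)} {t : ℕ × ℕ} (ht : t ∉ M) :
    IsRook (insert t M) ↔ IsRook M ∧ IsFree M t := by
  constructor
  · intro h
    refine ⟨fun x hx z hz => h x (Finset.mem_insert_of_mem hx) z (Finset.mem_insert_of_mem hz),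
      fun x hx => ?_⟩
    have := h x (Finset.mem_insert_of_mem hx) t (Finset.mem_insert_self _ _)
    have hne : x ≠ t := fun e => ht (e ▸ hx)
    tauto
  · rintro ⟨h1, h2⟩ x hx z hz hxz
    rcases Finset.mem_insert.1 hx with rfl | hx <;> rcases Finset.mem_insert.1 hz with rfl | hz
    · rfl
    · have := h2 z hz; tauto
    · rename_i h3; have := h2 x h3; tauto
    · exact h1 x hx z hz hxz

/-! ### Sums over placements when the board grows. -/

section Sums

variable {A : Type*} [CommRing A]

open Classical in
theorem sum_rooks_insert {S : Finset (ℕ × ℕ)} {t : ℕ × ℕ} (ht : t ∉ S)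
    (f : Finset (ℕ × ℕ) → A) :
    ∑ M ∈ rooks (insert t S), f M =
      ∑ M ∈ rooks S, f M + ∑ M ∈ (rooks S).filter (IsFree · t), f (insert t M) := by
  unfold rooks
  rw [Finset.filter_filter, Finset.sum_filter, Finset.sum_powerset_insert ht, Finset.sum_filter,
    Finset.sum_filter]
  congr 1
  refine Finset.sum_congr rfl fun M hM => ?_
  have : t ∉ M := fun h => ht (Finset.mem_powerset.1 hM h)
  simp only [isRook_insert this]

open Classical in
-- The cells of `T` attack each other pairwise, so a placement contains at most one of them.
theorem sum_rooks_union {S T : Finset (ℕ × ℕ)} (hST : Disjoint S T)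
    (hT : ∀ x ∈ T, ∀ z ∈ T, x.1 = z.1 ∨ x.2 = z.2) (f : Finset (ℕ × ℕ) → A) :
    ∑ M ∈ rooks (S ∪ T), f M =
      ∑ M ∈ rooks S, (f M + ∑ t ∈ T.filter (IsFree M), f (insert t M)) := by
  induction T using Finset.induction_on with
  | empty => simp
  | insert t T ht ih =>
    have htS : t ∉ S := fun h => Finset.disjoint_left.1 hST h (Finset.mem_insert_self _ _)
    rw [Finset.union_insert, sum_rooks_insert (by simp [ht, htS]),
      ih (Finset.disjoint_of_subset_right (Finset.subset_insert _ _) hST)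
        fun x hx z hz => hT x (Finset.mem_insert_of_mem hx) z (Finset.mem_insert_of_mem hz)]
    have e : (rooks (S ∪ T)).filter (IsFree · t) = (rooks S).filter (IsFree · t) := by
      ext M
      simp only [Finset.mem_filter, mem_rooks]
      constructor
      · rintro ⟨⟨h1, h2⟩, h3⟩
        refine ⟨⟨fun x hx => ?_, h2⟩, h3⟩
        rcases Finset.mem_union.1 (h1 hx) with h | h
        · exact h
        · have := h3 x hx
          have := hT x (Finset.mem_insert_of_mem h) t (Finset.mem_insert_self _ _)
          tauto
      · rintro ⟨⟨h1, h2⟩, h3⟩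
        exact ⟨⟨h1.trans Finset.subset_union_left, h2⟩, h3⟩
    rw [e, Finset.sum_filter, ← Finset.sum_add_distrib]
    refine Finset.sum_congr rfl fun M _ => ?_
    rw [Finset.filter_insert]
    split_ifs with h
    · rw [Finset.sum_insert (by simp [ht])]; ring
    · ring

/-- The elements of `U` have `0, 1, …, |U| - 1` elements of `U` above them. This is how a choice of
a free row or column yields a `q`-integer. -/
theorem sum_pow_card_filter_lt (q : A) (U : Finset ℕ) :
    ∑ v ∈ U, q ^ (U.filter (v < ·)).card = qInt q U.card := by
  induction U using Finset.induction_on_max with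
  | empty => simp
  | insert a U ha ih =>
    have haU : a ∉ U := fun h => lt_irrefl _ (ha a h)
    rw [Finset.sum_insert haU, Finset.card_insert_of_notMem haU, qInt_succ, ← ih, Finset.mul_sum,
      add_comm]
    congr 1
    · refine Finset.sum_congr rfl fun v hv => ?_
      rw [Finset.filter_insert, if_pos (ha v hv), Finset.card_insert_of_notMem (by simp [haU]),
        pow_succ']
    · rw [Finset.filter_eq_empty_iff.2]
      · simp
      · intro x hx
        rcases Finset.mem_insert.1 hx with rfl | hx
        · simp
        · exact (ha x hx).not_gt

end Sums

/-! ### The board of a block decomposition -/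

/-- Cells joining two different blocks, when `bs v` is the first element of the block of `v`. -/
def Admissible (bs : ℕ → ℕ) (x : ℕ × ℕ) : Prop := x.1 < bs x.2 ∨ x.2 < bs x.1

instance (bs : ℕ → ℕ) : DecidablePred (Admissible bs) :=
  fun _ => inferInstanceAs (Decidable (_ ∨ _))

/-- The board of admissible cells with `a` rows and `b` columns. -/
def board (bs : ℕ → ℕ) (a b : ℕ) : Finset (ℕ × ℕ) :=
  (Finset.range a ×ˢ Finset.range b).filter (Admissible bs)

theorem mem_board {bs : ℕ → ℕ} {a b : ℕ} {x : ℕ × ℕ} :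
    x ∈ board bs a b ↔ x.1 < a ∧ x.2 < b ∧ Admissible bs x := by
  simp [board, and_assoc]

/-- In the new row only the second alternative of `Admissible` can occur: a column `v < b ≤ a + 1`
has `bs v ≤ v ≤ a`. -/
theorem board_succ_left {bs : ℕ → ℕ} (hbs : ∀ v, bs v ≤ v) {a b : ℕ} (hb : b ≤ a + 1)
    (hab : bs a ≤ b) :
    board bs (a + 1) b =
      board bs a b ∪ (Finset.range (bs a)).map (Function.Embedding.sectR a ℕ) := by
  ext ⟨i, j⟩
  simp only [mem_board, Finset.mem_union, Finset.mem_map, Finset.mem_range,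
    Function.Embedding.sectR_apply, Prod.mk.injEq, Admissible]
  have := hbs j
  constructor
  · rintro ⟨h1, h2, h3⟩
    rcases Nat.lt_succ_iff_lt_or_eq.1 h1 with h | rfl
    · exact Or.inl ⟨h, h2, h3⟩
    · exact Or.inr ⟨j, by omega, rfl, rfl⟩
  · rintro (⟨h1, h2, h3⟩ | ⟨v, hv, rfl, rfl⟩)
    · exact ⟨by omega, h2, h3⟩
    · exact ⟨by omega, by omega, Or.inr hv⟩

theorem board_succ_right {bs : ℕ → ℕ} (hbs : ∀ v, bs v ≤ v) {a b : ℕ} (hb : a ≤ b + 1)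
    (hab : bs b ≤ a) :
    board bs a (b + 1) =
      board bs a b ∪ (Finset.range (bs b)).map (Function.Embedding.sectL ℕ b) := by
  ext ⟨i, j⟩
  simp only [mem_board, Finset.mem_union, Finset.mem_map, Finset.mem_range,
    Function.Embedding.sectL_apply, Prod.mk.injEq, Admissible]
  have := hbs i
  constructor
  · rintro ⟨h1, h2, h3⟩
    rcases Nat.lt_succ_iff_lt_or_eq.1 h2 with h | rfl
    · exact Or.inl ⟨h1, h, h3⟩
    · exact Or.inr ⟨i, by omega, rfl, rfl⟩
  · rintro (⟨h1, h2, h3⟩ | ⟨v, hv, rfl, rfl⟩)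
    · exact ⟨h1, by omega, h3⟩
    · exact ⟨by omega, by omega, Or.inl hv⟩

section BoardSums

variable {A : Type*} [CommRing A]

theorem sum_rooks_board_succ_left {bs : ℕ → ℕ} (hbs : ∀ v, bs v ≤ v) {a b : ℕ} (hb : b ≤ a + 1)
    (hab : bs a ≤ b) (f : Finset (ℕ × ℕ) → A) :
    ∑ M ∈ rooks (board bs (a + 1) b), f M =
      ∑ M ∈ rooks (board bs a b), (f M +
        ∑ v ∈ Finset.range (bs a) \ M.image Prod.snd, f (insert (a, v) M)) := by
  classical
  rw [board_succ_left hbs hb hab, sum_rooks_union]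
  · refine Finset.sum_congr rfl fun M hM => ?_
    rw [Finset.filter_map, Finset.sum_map]
    congr 1
    refine Finset.sum_congr ?_ fun _ _ => rfl
    ext v
    simp only [Finset.mem_filter, Finset.mem_range, Function.comp, IsFree, Finset.mem_sdiff,
      Finset.mem_image, not_exists, not_and, Function.Embedding.sectR_apply]
    refine and_congr_right fun _ => forall₂_congr fun x hx => ?_
    have := (mem_board.1 ((mem_rooks.1 hM).1 hx)).1
    simp only [ne_eq, and_iff_right_iff_imp]
    omega
  · rw [Finset.disjoint_left]
    intro x hx hx'
    have := (mem_board.1 hx).1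
    obtain ⟨v, -, rfl⟩ := Finset.mem_map.1 hx'
    exact lt_irrefl _ this
  · intro x hx z hz
    obtain ⟨v, -, rfl⟩ := Finset.mem_map.1 hx
    obtain ⟨v, -, rfl⟩ := Finset.mem_map.1 hz
    exact Or.inl rfl

theorem sum_rooks_board_succ_right {bs : ℕ → ℕ} (hbs : ∀ v, bs v ≤ v) {a b : ℕ} (hb : a ≤ b + 1)
    (hab : bs b ≤ a) (f : Finset (ℕ × ℕ) → A) :
    ∑ M ∈ rooks (board bs a (b + 1)), f M =
      ∑ M ∈ rooks (board bs a b), (f M +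
        ∑ v ∈ Finset.range (bs b) \ M.image Prod.fst, f (insert (v, b) M)) := by
  classical
  rw [board_succ_right hbs hb hab, sum_rooks_union]
  · refine Finset.sum_congr rfl fun M hM => ?_
    rw [Finset.filter_map, Finset.sum_map]
    congr 1
    refine Finset.sum_congr ?_ fun _ _ => rfl
    ext v
    simp only [Finset.mem_filter, Finset.mem_range, Function.comp, IsFree, Finset.mem_sdiff,
      Finset.mem_image, not_exists, not_and, Function.Embedding.sectL_apply]
    refine and_congr_right fun _ => forall₂_congr fun x hx => ?_
    have := (mem_board.1 ((mem_rooks.1 hM).1 hx)).2.1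
    simp only [ne_eq, and_iff_left_iff_imp]
    omega
  · rw [Finset.disjoint_left]
    intro x hx hx'
    have := (mem_board.1 hx).2.1
    obtain ⟨v, -, rfl⟩ := Finset.mem_map.1 hx'
    exact lt_irrefl _ this
  · intro x hx z hz
    obtain ⟨v, -, rfl⟩ := Finset.mem_map.1 hx
    obtain ⟨v, -, rfl⟩ := Finset.mem_map.1 hz
    exact Or.inr rfl

/-! ### The weight of a placement -/

/-- The contribution of the cell `x` to the weight of the placement `M`: an arc counts the arcs
that it crosses and that are closed after it. -/
def cellWeight (y q : A) (M : Finset (ℕ × ℕ)) (x : ℕ × ℕ) : A :=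
  if x.1 < x.2 then
    y * q ^ ((Finset.Ioc x.1 x.2).filter fun o => ∀ z ∈ M, z.1 = o → x.2 < z.2).card
  else q ^ ((Finset.Ioo x.2 x.1).filter fun v => ∀ z ∈ M, z.2 = v → x.1 < z.1).card

/-- The weight of a placement. -/
def rookWeight (y q : A) (M : Finset (ℕ × ℕ)) : A := ∏ x ∈ M, cellWeight y q M x

variable (y q : A)

/-- `cellWeight` already counts an empty row or column as one to be closed later, so a rook placed
in a new last row leaves all old exponents unchanged. Its own exponent is the number of columns
strictly between `v` and `b` that are still empty. -/
theorem rookWeight_insert_row {M : Finset (ℕ × ℕ)} {b v : ℕ}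
    (hM : ∀ x ∈ M, x.1 < b ∧ x.2 < b) (hv : v < b) :
    rookWeight y q (insert (b, v) M) = rookWeight y q M *
      q ^ ((Finset.Ioo v b \ M.image Prod.snd).card) := by
  have hbM : (b, v) ∉ M := fun h => lt_irrefl _ (hM _ h).1
  rw [rookWeight, Finset.prod_insert hbM, mul_comm]
  congr 1
  · refine Finset.prod_congr rfl fun x hx => ?_
    have := hM x hx
    unfold cellWeight
    split_ifs with h
    · congr 3
      refine Finset.filter_congr fun o ho => ?_
      simp only [Finset.mem_insert, forall_eq_or_imp, Finset.mem_Ioc] at ho ⊢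
      refine and_iff_right fun e => ?_
      omega
    · congr 2
      refine Finset.filter_congr fun o ho => ?_
      simp only [Finset.mem_insert, forall_eq_or_imp]
      exact and_iff_right fun e => this.1
  · unfold cellWeight
    rw [if_neg (by simpa using hv.le)]
    congr 2
    ext o
    simp only [Finset.mem_insert, forall_eq_or_imp, Finset.mem_filter, Finset.mem_Ioo,
      Finset.mem_sdiff, Finset.mem_image, not_exists, not_and]
    refine and_congr_right fun ho => ⟨fun h z hz e => ?_,
      fun h => ⟨fun e => by omega, fun z hz e => absurd e (h z hz)⟩⟩
    have := h.2 z hz e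
    have := hM z hz
    omega

/-- Here row `b` may already be occupied, and it is counted when empty: the interval is `Ioc`,
reflecting the weak inequality in the first sum of `cr`. This is why row `b` is added before column
`b`. -/
theorem rookWeight_insert_col {M : Finset (ℕ × ℕ)} {b o : ℕ}
    (hM : ∀ x ∈ M, x.1 ≤ b ∧ x.2 < b) (hv : o < b) :
    rookWeight y q (insert (o, b) M) = rookWeight y q M *
      (y * q ^ ((Finset.Ioc o b \ M.image Prod.fst).card)) := by
  have hbM : (o, b) ∉ M := fun h => lt_irrefl _ (hM _ h).2
  rw [rookWeight, Finset.prod_insert hbM, mul_comm]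
  congr 1
  · refine Finset.prod_congr rfl fun x hx => ?_
    have := hM x hx
    unfold cellWeight
    split_ifs with h
    · congr 3
      refine Finset.filter_congr fun o ho => ?_
      simp only [Finset.mem_insert, forall_eq_or_imp]
      exact and_iff_right fun e => this.2
    · congr 2
      refine Finset.filter_congr fun o ho => ?_
      simp only [Finset.mem_insert, forall_eq_or_imp, Finset.mem_Ioo] at ho ⊢
      refine and_iff_right fun e => ?_
      omega
  · unfold cellWeight
    rw [if_pos hv]
    congr 3
    ext p
    simp only [Finset.mem_insert, forall_eq_or_imp, Finset.mem_filter, Finset.mem_Ioc,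
      Finset.mem_sdiff, Finset.mem_image, not_exists, not_and]
    refine and_congr_right fun ho => ⟨fun h z hz e => ?_,
      fun h => ⟨fun e => by omega, fun z hz e => absurd e (h z hz)⟩⟩
    have := h.2 z hz e
    have := hM z hz
    omega

end BoardSums
-- Transfer of one box, element by element.
section Block

variable {A : Type*} [CommRing A] (y q : A)

/-- The number of cells of `M` with both coordinates below `c`. -/
def lowCount (c : ℕ) (M : Finset (ℕ × ℕ)) : ℕ := (M.filter fun x => x.1 < c ∧ x.2 < c).card

/-- The number of cells of `M` in a column at or after `c`. -/
def colCount (c : ℕ) (M : Finset (ℕ × ℕ)) : ℕ := (M.filter fun x => c ≤ x.2).card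

/-- The number of cells of `M` in a row at or after `c`. -/
def rowCount (c : ℕ) (M : Finset (ℕ × ℕ)) : ℕ := (M.filter fun x => c ≤ x.1).card

theorem card_filter_snd_lt {c : ℕ} {M : Finset (ℕ × ℕ)} (hM : ∀ x ∈ M, x.1 < c ∨ x.2 < c) :
    (M.filter fun x => x.2 < c).card = lowCount c M + rowCount c M := by
  unfold lowCount rowCount
  rw [← Finset.card_union_of_disjoint]
  · congr 1
    ext x
    simp only [Finset.mem_filter, Finset.mem_union]
    have := hM x
    constructor
    · rintro ⟨h1, h2⟩
      rcases lt_or_ge x.1 c with h | h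
      · exact Or.inl ⟨h1, h, h2⟩
      · exact Or.inr ⟨h1, h⟩
    · rintro (⟨h1, h2, h3⟩ | ⟨h1, h2⟩)
      · exact ⟨h1, h3⟩
      · exact ⟨h1, by have := this h1; omega⟩
  · rw [Finset.disjoint_left]
    intro x hx hx'
    simp only [Finset.mem_filter] at hx hx'
    omega

theorem card_filter_fst_lt {c : ℕ} {M : Finset (ℕ × ℕ)} (hM : ∀ x ∈ M, x.1 < c ∨ x.2 < c) :
    (M.filter fun x => x.1 < c).card = lowCount c M + colCount c M := by
  unfold lowCount colCount
  rw [← Finset.card_union_of_disjoint]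
  · congr 1
    ext x
    simp only [Finset.mem_filter, Finset.mem_union]
    have := hM x
    constructor
    · rintro ⟨h1, h2⟩
      rcases lt_or_ge x.2 c with h | h
      · exact Or.inl ⟨h1, h2, h⟩
      · exact Or.inr ⟨h1, h⟩
    · rintro (⟨h1, h2, h3⟩ | ⟨h1, h2⟩)
      · exact ⟨h1, h2⟩
      · exact ⟨h1, by have := this h1; omega⟩
  · rw [Finset.disjoint_left]
    intro x hx hx'
    simp only [Finset.mem_filter] at hx hx'
    omega

theorem card_eq_lowCount_add {c : ℕ} {M : Finset (ℕ × ℕ)} (hM : ∀ x ∈ M, x.1 < c ∨ x.2 < c) :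
    M.card = lowCount c M + colCount c M + rowCount c M := by
  rw [← card_filter_fst_lt hM, rowCount,
    ← Finset.card_filter_add_card_filter_not (s := M) (fun x => x.1 < c)]
  simp only [not_lt]

theorem card_Ico_sdiff_image {M : Finset (ℕ × ℕ)} (f : ℕ × ℕ → ℕ) (hf : Set.InjOn f M) (a b : ℕ)
    : (Finset.Ico a b \ M.image f).card = (b - a) - (M.filter fun x => a ≤ f x ∧ f x < b).card := by
  rw [Finset.card_sdiff, Nat.card_Ico]
  congr 1
  rw [← Finset.card_image_of_injOn (hf.mono (Finset.coe_subset.2 (Finset.filter_subset _ M)))]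
  congr 1
  ext v
  simp only [Finset.mem_inter, Finset.mem_image, Finset.mem_Ico, Finset.mem_filter]
  constructor
  · rintro ⟨⟨x, hx, rfl⟩, h⟩
    exact ⟨x, ⟨hx, h⟩, rfl⟩
  · rintro ⟨x, ⟨hx, h⟩, rfl⟩
    exact ⟨⟨x, hx, rfl⟩, h⟩

theorem IsRook.injOn_fst {M : Finset (ℕ × ℕ)} (h : IsRook M) :
    Set.InjOn Prod.fst (M : Set (ℕ × ℕ)) :=
  fun x hx z hz e => h x hx z hz (Or.inl e)

theorem IsRook.injOn_snd {M : Finset (ℕ × ℕ)} (h : IsRook M) :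
    Set.InjOn Prod.snd (M : Set (ℕ × ℕ)) :=
  fun x hx z hz e => h x hx z hz (Or.inr e)

/-- The free positions in `[c, b)` lie above every choice `v < c` and contribute a constant power;
those below `c` contribute a `q`-integer. -/
theorem sum_pow_card_sdiff (I : Finset ℕ) {c b : ℕ} (hcb : c ≤ b) :
    ∑ v ∈ Finset.range c \ I, q ^ (Finset.Ico (v + 1) b \ I).card =
      q ^ (Finset.Ico c b \ I).card * qInt q (Finset.Ico 0 c \ I).card := by
  rw [← Finset.range_eq_Ico, ← sum_pow_card_filter_lt, Finset.mul_sum]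
  refine Finset.sum_congr rfl fun v hv => ?_
  rw [← pow_add, ← Finset.card_union_of_disjoint]
  · congr 2
    ext w
    simp only [Finset.mem_sdiff, Finset.mem_Ico, Finset.mem_union, Finset.mem_filter,
      Finset.mem_range] at hv ⊢
    by_cases w ∈ I <;> simp [*]
    omega
  · rw [Finset.disjoint_left]
    intro x hx hx'
    simp only [Finset.mem_filter, Finset.mem_sdiff, Finset.mem_Ico, Finset.mem_range] at hx hx'
    omega

variable {bs : ℕ → ℕ} {c b : ℕ}

theorem fst_lt_or_snd_lt (hc : ∀ v, c ≤ v → v ≤ b → bs v = c) {x : ℕ × ℕ} (hx1 : x.1 ≤ b)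
    (hx2 : x.2 ≤ b) (hx : Admissible bs x) : x.1 < c ∨ x.2 < c := by
  by_contra! h
  have h1 := hc _ h.1 hx1
  have h2 := hc _ h.2 hx2
  unfold Admissible at hx
  omega

/-- With `k = b - c` and `h = c - lowCount`, the new row multiplies the weight by `q^(k-r) [h-s]`:
there are `k - r` free columns inside the box and `h - s` free columns before it, where `r` and `s`
are the column and row counts. -/
theorem sum_insert_row (hcb : c ≤ b) (hc : ∀ v, c ≤ v → v ≤ b → bs v = c)
    {M : Finset (ℕ × ℕ)} (hM : M ∈ rooks (board bs b b)) (Φ : ℕ → ℕ → ℕ → A) :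
    ∑ v ∈ Finset.range c \ M.image Prod.snd, rookWeight y q (insert (b, v) M) *
        Φ (lowCount c (insert (b, v) M)) (colCount c (insert (b, v) M))
          (rowCount c (insert (b, v) M)) =
      rookWeight y q M * (q ^ (b - c - colCount c M) *
        qInt q (c - lowCount c M - rowCount c M) *
          Φ (lowCount c M) (colCount c M) (rowCount c M + 1)) := by
  obtain ⟨hMS, hR⟩ := mem_rooks.1 hM
  have hlt : ∀ x ∈ M, x.1 < b ∧ x.2 < b := fun x hx => by
    have := mem_board.1 (hMS hx); exact ⟨this.1, this.2.1⟩
  have hlow : ∀ x ∈ M, x.1 < c ∨ x.2 < c := fun x hx =>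
    fst_lt_or_snd_lt hc (hlt x hx).1.le (hlt x hx).2.le (mem_board.1 (hMS hx)).2.2
  have e1 : (Finset.Ico c b \ M.image Prod.snd).card = b - c - colCount c M := by
    rw [card_Ico_sdiff_image _ hR.injOn_snd, colCount]
    congr 2
    exact Finset.filter_congr fun x hx => and_iff_left (hlt x hx).2
  have e2 : (Finset.Ico 0 c \ M.image Prod.snd).card = c - lowCount c M - rowCount c M := by
    rw [card_Ico_sdiff_image _ hR.injOn_snd, Nat.sub_zero, Nat.sub_sub,
      ← card_filter_snd_lt hlow]
    simp
  rw [← e1, ← e2, ← sum_pow_card_sdiff q _ hcb, Finset.sum_mul, Finset.mul_sum]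
  refine Finset.sum_congr rfl fun v hv => ?_
  have hvc : v < c := Finset.mem_range.1 (Finset.mem_sdiff.1 hv).1
  have hnM : (b, v) ∉ M := fun h => lt_irrefl _ (hlt _ h).1
  rw [rookWeight_insert_row y q hlt (by omega)]
  have e3 : lowCount c (insert (b, v) M) = lowCount c M := by
    unfold lowCount; rw [Finset.filter_insert, if_neg (by simp; omega)]
  have e4 : colCount c (insert (b, v) M) = colCount c M := by
    unfold colCount; rw [Finset.filter_insert, if_neg (by simp; omega)]
  have e5 : rowCount c (insert (b, v) M) = rowCount c M + 1 := by
    unfold rowCount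
    rw [Finset.filter_insert, if_pos hcb, Finset.card_insert_of_notMem (by simp [hnM])]
  rw [e3, e4, e5, show Finset.Ioo v b = Finset.Ico (v + 1) b by ext; simp]
  ring

/-- The exponent is `k + 1 - s` rather than `k - s` since the box already has its new row `b`. -/
theorem sum_insert_col (hcb : c ≤ b) (hc : ∀ v, c ≤ v → v ≤ b → bs v = c)
    {M : Finset (ℕ × ℕ)} (hM : M ∈ rooks (board bs (b + 1) b)) (Φ : ℕ → ℕ → ℕ → A) :
    ∑ v ∈ Finset.range c \ M.image Prod.fst, rookWeight y q (insert (v, b) M) *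
        Φ (lowCount c (insert (v, b) M)) (colCount c (insert (v, b) M))
          (rowCount c (insert (v, b) M)) =
      rookWeight y q M * (y * q ^ (b + 1 - c - rowCount c M) *
        qInt q (c - lowCount c M - colCount c M) *
          Φ (lowCount c M) (colCount c M + 1) (rowCount c M)) := by
  obtain ⟨hMS, hR⟩ := mem_rooks.1 hM
  have hlt : ∀ x ∈ M, x.1 ≤ b ∧ x.2 < b := fun x hx => by
    have := mem_board.1 (hMS hx); exact ⟨by omega, this.2.1⟩
  have hlow : ∀ x ∈ M, x.1 < c ∨ x.2 < c := fun x hx =>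
    fst_lt_or_snd_lt hc (hlt x hx).1 (hlt x hx).2.le (mem_board.1 (hMS hx)).2.2
  have e1 : (Finset.Ico c (b + 1) \ M.image Prod.fst).card = b + 1 - c - rowCount c M := by
    rw [card_Ico_sdiff_image _ hR.injOn_fst, rowCount]
    congr 2
    exact Finset.filter_congr fun x hx => and_iff_left (Nat.lt_succ_of_le (hlt x hx).1)
  have e2 : (Finset.Ico 0 c \ M.image Prod.fst).card = c - lowCount c M - colCount c M := by
    rw [card_Ico_sdiff_image _ hR.injOn_fst, Nat.sub_zero, Nat.sub_sub,
      ← card_filter_fst_lt hlow]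
    simp
  rw [← e1, ← e2, mul_assoc y, ← sum_pow_card_sdiff q _ (by omega), Finset.mul_sum, Finset.sum_mul,
    Finset.mul_sum]
  refine Finset.sum_congr rfl fun v hv => ?_
  have hvc : v < c := Finset.mem_range.1 (Finset.mem_sdiff.1 hv).1
  have hnM : (v, b) ∉ M := fun h => lt_irrefl _ (hlt _ h).2
  rw [rookWeight_insert_col y q hlt (by omega)]
  have e3 : lowCount c (insert (v, b) M) = lowCount c M := by
    unfold lowCount; rw [Finset.filter_insert, if_neg (by simp; omega)]
  have e4 : rowCount c (insert (v, b) M) = rowCount c M := by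
    unfold rowCount; rw [Finset.filter_insert, if_neg (by simp; omega)]
  have e5 : colCount c (insert (v, b) M) = colCount c M + 1 := by
    unfold colCount
    rw [Finset.filter_insert, if_pos hcb, Finset.card_insert_of_notMem (by simp [hnM])]
  rw [e3, e4, e5, show Finset.Ioc v b = Finset.Ico (v + 1) (b + 1) by ext; simp]
  ring

/-- Adding a single element to a block. -/
theorem sum_rooks_board_succ (hbs : ∀ v, bs v ≤ v) (hcb : c ≤ b)
    (hc : ∀ v, c ≤ v → v ≤ b → bs v = c) (Φ : ℕ → ℕ → ℕ → A) :
    ∑ M ∈ rooks (board bs (b + 1) (b + 1)), rookWeight y q M *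
        Φ (lowCount c M) (colCount c M) (rowCount c M) =
      ∑ M ∈ rooks (board bs b b), rookWeight y q M *
        (fun l r s => (Φ l r s + y * q ^ (b + 1 - c - s) * qInt q (c - l - r) * Φ l (r + 1) s) +
          q ^ (b - c - r) * qInt q (c - l - s) * (Φ l r (s + 1) +
            y * q ^ (b + 1 - c - (s + 1)) * qInt q (c - l - r) * Φ l (r + 1) (s + 1)))
        (lowCount c M) (colCount c M) (rowCount c M) := by
  have hb : bs b = c := hc b hcb le_rfl
  rw [sum_rooks_board_succ_right hbs (by omega) (by omega), hb]
  have step : ∀ M ∈ rooks (board bs (b + 1) b), rookWeight y q M *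
      Φ (lowCount c M) (colCount c M) (rowCount c M) +
      ∑ v ∈ Finset.range c \ M.image Prod.fst, rookWeight y q (insert (v, b) M) *
        Φ (lowCount c (insert (v, b) M)) (colCount c (insert (v, b) M))
          (rowCount c (insert (v, b) M)) =
      rookWeight y q M * (fun l r s => Φ l r s + y * q ^ (b + 1 - c - s) *
        qInt q (c - l - r) * Φ l (r + 1) s) (lowCount c M) (colCount c M) (rowCount c M) :=
    fun M hM => by rw [sum_insert_col y q hcb hc hM]; ring
  rw [Finset.sum_congr rfl step, sum_rooks_board_succ_left hbs (by omega) (by omega), hb]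
  refine Finset.sum_congr rfl fun M hM => ?_
  rw [sum_insert_row y q hcb hc hM (fun l r s => Φ l r s + y * q ^ (b + 1 - c - s) *
        qInt q (c - l - r) * Φ l (r + 1) s)]
  ring

/-- The transfer of a whole block. -/
theorem sum_rooks_board_block (hbs : ∀ v, bs v ≤ v) (k : ℕ)
    (hc : ∀ v, c ≤ v → v < c + k → bs v = c) (Φ : ℕ → ℕ → ℕ → A) :
    ∑ M ∈ rooks (board bs (c + k) (c + k)), rookWeight y q M *
        Φ (lowCount c M) (colCount c M) (rowCount c M) =
      ∑ M ∈ rooks (board bs c c), rookWeight y q M *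
        ∑ r ∈ Finset.range (k + 1), ∑ s ∈ Finset.range (k + 1),
          linWeight q (c - M.card) y k r s * Φ M.card r s := by
  induction k generalizing Φ with
  | zero =>
    -- Before the box is opened every cell is low, so the counts start at `r = s = 0`.
    refine Finset.sum_congr rfl fun M hM => ?_
    have hlt : ∀ x ∈ M, x.1 < c ∧ x.2 < c := fun x hx => by
      have := mem_board.1 ((mem_rooks.1 hM).1 hx); exact ⟨this.1, this.2.1⟩
    have e1 : lowCount c M = M.card := by
      unfold lowCount; rw [Finset.filter_true_of_mem hlt]
    have e2 : colCount c M = 0 := by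
      unfold colCount
      rw [Finset.filter_false_of_mem fun x hx => (hlt x hx).2.not_ge, Finset.card_empty]
    have e3 : rowCount c M = 0 := by
      unfold rowCount
      rw [Finset.filter_false_of_mem fun x hx => (hlt x hx).1.not_ge, Finset.card_empty]
    simp [e1, e2, e3, linWeight]
  | succ k ih =>
    rw [← add_assoc, sum_rooks_board_succ y q hbs (by omega) (fun v h1 h2 => hc v h1 (by omega))]
    refine (ih (fun v h1 h2 => hc v h1 (by omega)) fun l r s =>
      (Φ l r s + y * q ^ (c + k + 1 - c - s) * qInt q (c - l - r) * Φ l (r + 1) s) +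
        q ^ (c + k - c - r) * qInt q (c - l - s) * (Φ l r (s + 1) +
          y * q ^ (c + k + 1 - c - (s + 1)) * qInt q (c - l - r) * Φ l (r + 1) (s + 1))).trans ?_
    refine Finset.sum_congr rfl fun M _ => ?_
    -- Adding an element and raising `k` are the same operator, with `h = c - |M|` the number of
    -- rows, and of columns, that `M` leaves free below `c`.
    rw [sum_linWeight_succ]
    congr 1
    refine Finset.sum_congr rfl fun r _ => Finset.sum_congr rfl fun s _ => ?_
    rw [show c + k + 1 - c - s = k + 1 - s by omega, show c + k - c - r = k - r by omega,
      show c + k + 1 - c - (s + 1) = k - s by omega]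

end Block

/-! ### Products of `q`-Laguerre polynomials as sums over placements -/

/-- Induction on the number of boxes. Extending placements by a box of size `k` and multiplying
`L_{c-|M|}` by `L_k` are governed by the same coefficients. -/
theorem sum_rooks_board_eq_prod {R : Type*} [CommRing R] (y q : R) {bs : ℕ → ℕ}
    (hbs : ∀ v, bs v ≤ v) (n : ℕ → ℕ) (m : ℕ)
    (hn : ∀ i < m, ∀ v, ∑ j ∈ Finset.range i, n j ≤ v → v < ∑ j ∈ Finset.range (i + 1), n j →
      bs v = ∑ j ∈ Finset.range i, n j) :
    ∑ M ∈ rooks (board bs (∑ j ∈ Finset.range m, n j) (∑ j ∈ Finset.range m, n j)),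
        rookWeight (C y) (C q) M * qLaguerre y q ((∑ j ∈ Finset.range m, n j) - M.card) =
      ∏ j ∈ Finset.range m, qLaguerre y q (n j) := by
  induction m with
  | zero =>
    have : rooks (board bs 0 0) = {∅} := by
      ext M
      simp only [mem_rooks, board, Finset.range_zero, Finset.empty_product, Finset.filter_empty,
        Finset.subset_empty, Finset.mem_singleton, and_iff_left_iff_imp]
      rintro rfl
      intro x hx
      simp at hx
    simp [this, rookWeight, qLaguerre_zero]
  | succ m ih =>
    have hm := hn m (Nat.lt_succ_self m)
    rw [Finset.prod_range_succ, ← ih fun i hi => hn i (by omega), Finset.sum_mul]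
    simp only [Finset.sum_range_succ _ m] at hm ⊢
    generalize hcdef : ∑ j ∈ Finset.range m, n j = c at *
    have key := sum_rooks_board_block (C y) (C q) hbs (n m) hm
      (fun l r s => qLaguerre y q (c - l + n m - r - s))
    have e : ∀ M ∈ rooks (board bs (c + n m) (c + n m)),
        rookWeight (C y) (C q) M * qLaguerre y q (c + n m - M.card) =
        rookWeight (C y) (C q) M * qLaguerre y q
          (c - lowCount c M + n m - colCount c M - rowCount c M) := fun M hM => by
      have hlow : ∀ x ∈ M, x.1 < c ∨ x.2 < c := fun x hx => by
        have hx' := mem_board.1 ((mem_rooks.1 hM).1 hx)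
        exact fst_lt_or_snd_lt (b := c + n m - 1) (fun v h1 h2 => hm v h1 (by omega)) (by omega)
          (by omega) hx'.2.2
      have h1 := card_eq_lowCount_add hlow
      -- Needed to regroup the truncated subtractions in the index of `qLaguerre`.
      have h2 : lowCount c M ≤ c := by
        have := Finset.card_le_card_of_injOn (s := M.filter fun x => x.1 < c ∧ x.2 < c)
          (t := Finset.range c) Prod.fst (fun x hx => by
            simp only [Finset.coe_filter, Set.mem_ofPred_eq] at hx
            simpa using hx.2.1)
          ((mem_rooks.1 hM).2.injOn_fst.mono (Finset.coe_subset.2 (Finset.filter_subset _ M)))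
        simpa [lowCount] using this
      rw [h1, show c + n m - (lowCount c M + colCount c M + rowCount c M) =
        c - lowCount c M + n m - colCount c M - rowCount c M by omega]
    rw [Finset.sum_congr rfl e, key]
    refine Finset.sum_congr rfl fun M _ => ?_
    rw [mul_assoc, mul_comm (qLaguerre y q (c - M.card)), qLaguerre_mul]
    rfl

/-! ### Derangements as full placements -/

section Derangements

variable {m : ℕ} (n : Fin m → ℕ)

/-- The sizes of the boxes, extended by zero. -/
def boxSize (j : ℕ) : ℕ := if h : j < m then n ⟨j, h⟩ else 0

/-- The first element of the box with a given index. -/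
def boxStart (i : ℕ) : ℕ := ∑ j ∈ Finset.range i, boxSize n j

/-- The first element of the box of `v`. -/
def startOf (v : ℕ) : ℕ :=
  ((Finset.range (m + 1)).filter fun i => boxStart n i ≤ v).sup (boxStart n)

theorem boxSize_val (j : Fin m) : boxSize n j = n j := by simp [boxSize]

theorem boxStart_mono : Monotone (boxStart n) := fun i j h =>
  Finset.sum_le_sum_of_subset (by simpa using h)

theorem boxStart_eq_sum : boxStart n m = ∑ i, n i := by
  rw [boxStart, Finset.sum_range]
  simp [boxSize_val]

theorem sum_Iio_eq (j : Fin m) : ∑ i ∈ Finset.Iio j, n i = boxStart n j := by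
  rw [boxStart, ← Nat.Iio_eq_range, ← Fin.map_valEmbedding_Iio, Finset.sum_map]
  simp [boxSize_val]

theorem sum_Iic_eq (j : Fin m) : ∑ i ∈ Finset.Iic j, n i = boxStart n (j + 1) := by
  rw [boxStart, show Finset.range ((j : ℕ) + 1) = Finset.Iic (j : ℕ) by ext; simp,
    ← Fin.map_valEmbedding_Iic, Finset.sum_map]
  simp [boxSize_val]

theorem startOf_le (v : ℕ) : startOf n v ≤ v :=
  Finset.sup_le fun _ hi => (Finset.mem_filter.1 hi).2

/-- The bound `i = m` is allowed so that the end of the last box can be treated as a start. Empty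
boxes share a start with a neighbour and cause no ambiguity, since only the value of the start is
recorded. -/
theorem le_startOf {i v : ℕ} (hi : i ≤ m) (h : boxStart n i ≤ v) : boxStart n i ≤ startOf n v :=
  Finset.le_sup (f := boxStart n) (by simp [h, hi])

theorem startOf_eq {i v : ℕ} (hi : i < m) (h1 : boxStart n i ≤ v) (h2 : v < boxStart n (i + 1)) :
    startOf n v = boxStart n i := by
  refine le_antisymm (Finset.sup_le fun j hj => ?_) (le_startOf n hi.le h1)
  have hj' := (Finset.mem_filter.1 hj).2
  refine boxStart_mono n ?_
  by_contra! h
  have := boxStart_mono n (Nat.succ_le_of_lt h)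
  simp only [Nat.succ_eq_add_one] at this
  omega

theorem exists_box {v : ℕ} (hv : v < boxStart n m) :
    ∃ i, i < m ∧ boxStart n i ≤ v ∧ v < boxStart n (i + 1) := by
  have : ∀ k, v < boxStart n k → ∃ i, i < k ∧ boxStart n i ≤ v ∧ v < boxStart n (i + 1) := by
    intro k
    induction k with
    | zero => simp [boxStart]
    | succ k ih =>
      intro h
      rcases lt_or_ge v (boxStart n k) with h' | h'
      · obtain ⟨i, h1, h2⟩ := ih h'
        exact ⟨i, by omega, h2⟩
      · exact ⟨k, by omega, h', h⟩
  exact this m hv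

theorem mem_box {j : Fin m} {k : Fin (∑ i, n i)} :
    k ∈ box n j ↔ boxStart n j ≤ k ∧ (k : ℕ) < boxStart n (j + 1) := by
  simp [box, sum_Iio_eq, sum_Iic_eq]

/-- Leaving the box of `k` means landing before its start, or at or after the start of the next box;
in the latter case `k` lies before the start of the box of `σ k`. -/
theorem mem_inhomDerangements {σ : Equiv.Perm (Fin (∑ i, n i))} :
    σ ∈ inhomDerangements n ↔
      ∀ k : Fin (∑ i, n i), Admissible (startOf n) ((k : ℕ), (σ k : ℕ)) := by
  simp only [inhomDerangements, Finset.mem_filter, Finset.mem_univ, true_and,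
    ← Finset.disjoint_iff_inter_eq_empty, Finset.disjoint_left, Finset.mem_image,
    forall_exists_index, and_imp, forall_apply_eq_imp_iff₂]
  constructor
  · intro h k
    obtain ⟨i, hi, h1, h2⟩ := exists_box n (v := k) (by rw [boxStart_eq_sum]; exact k.2)
    have h3 := h ⟨i, hi⟩ k ((mem_box n).2 ⟨h1, h2⟩)
    rw [mem_box] at h3
    push Not at h3
    unfold Admissible
    rcases lt_or_ge (σ k : ℕ) (boxStart n i) with h4 | h4
    · right
      simpa [startOf_eq n hi h1 h2] using h4
    · left
      exact lt_of_lt_of_le h2 (le_startOf n hi (h3 h4))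
  · intro h j k hk hk'
    rw [mem_box] at hk hk'
    have := h k
    unfold Admissible at this
    rw [startOf_eq n j.2 hk.1 hk.2, startOf_eq n j.2 hk'.1 hk'.2] at this
    omega

end Derangements

/-! ### Permutations as rook placements with a rook in every row. -/

section Graph

variable {N : ℕ}

/-- The graph of a permutation, as a set of cells. -/
def graph (σ : Equiv.Perm (Fin N)) : Finset (ℕ × ℕ) :=
  Finset.univ.image fun i : Fin N => ((i : ℕ), (σ i : ℕ))

theorem mem_graph {σ : Equiv.Perm (Fin N)} {x : ℕ × ℕ} :
    x ∈ graph σ ↔ ∃ i : Fin N, ((i : ℕ), (σ i : ℕ)) = x := by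
  simp [graph]

theorem graph_injective : Function.Injective (graph (N := N)) := by
  intro σ τ h
  ext i
  have : ((i : ℕ), (σ i : ℕ)) ∈ graph τ := h ▸ mem_graph.2 ⟨i, rfl⟩
  obtain ⟨j, hj⟩ := mem_graph.1 this
  rw [Prod.mk.injEq] at hj
  obtain rfl : j = i := Fin.ext hj.1
  exact hj.2.symm

theorem card_graph (σ : Equiv.Perm (Fin N)) : (graph σ).card = N := by
  rw [graph, Finset.card_image_of_injective, Finset.card_univ, Fintype.card_fin]
  intro i j h
  exact Fin.ext (Prod.mk.inj h).1

theorem isRook_graph (σ : Equiv.Perm (Fin N)) : IsRook (graph σ) := by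
  intro x hx z hz h
  obtain ⟨i, rfl⟩ := mem_graph.1 hx
  obtain ⟨j, rfl⟩ := mem_graph.1 hz
  have : i = j := by
    rcases h with h | h
    · exact Fin.ext h
    · exact σ.injective (Fin.ext h)
  rw [this]

/-- Having `N` rooks in distinct rows forces every row to be used, which defines a function;
distinct columns make it injective, hence bijective. -/
theorem exists_graph_eq {M : Finset (ℕ × ℕ)} (hM : IsRook M) (hlt : ∀ x ∈ M, x.1 < N ∧ x.2 < N)
    (hcard : M.card = N) : ∃ σ : Equiv.Perm (Fin N), graph σ = M := by
  have himg : M.image Prod.fst = Finset.range N := by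
    refine Finset.eq_of_subset_of_card_le (fun v hv => ?_) ?_
    · obtain ⟨x, hx, rfl⟩ := Finset.mem_image.1 hv
      exact Finset.mem_range.2 (hlt x hx).1
    · rw [Finset.card_image_of_injOn hM.injOn_fst, hcard, Finset.card_range]
  have hex : ∀ i : Fin N, ∃ j : Fin N, ((i : ℕ), (j : ℕ)) ∈ M := fun i => by
    have : (i : ℕ) ∈ M.image Prod.fst := by rw [himg]; simp
    obtain ⟨x, hx, hxi⟩ := Finset.mem_image.1 this
    exact ⟨⟨x.2, (hlt x hx).2⟩, by rw [← hxi]; exact hx⟩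
  choose f hf using hex
  have hinj : Function.Injective f := fun i j h => by
    have := hM _ (hf i) _ (hf j) (Or.inr (by simp [h]))
    exact Fin.ext (Prod.mk.inj this).1
  refine ⟨Equiv.ofBijective f (Finite.injective_iff_bijective.1 hinj), ?_⟩
  refine Finset.eq_of_subset_of_card_le (fun x hx => ?_) (by rw [card_graph, hcard])
  obtain ⟨i, rfl⟩ := mem_graph.1 hx
  exact hf i

theorem rookWeight_graph {A : Type*} [CommRing A] (y q : A) (σ : Equiv.Perm (Fin N))
    (hσ : ∀ i, σ i ≠ i) : rookWeight y q (graph σ) = y ^ exc σ * q ^ cr σ := by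
  have hinj : Function.Injective fun i : Fin N => ((i : ℕ), (σ i : ℕ)) :=
    fun i j h => Fin.ext (Prod.mk.inj h).1
  have hcell : ∀ i : Fin N, cellWeight y q (graph σ) ((i : ℕ), (σ i : ℕ)) =
      (if i < σ i then y else 1) *
        q ^ ((Finset.univ.filter fun j => i < j ∧ j ≤ σ i ∧ σ i < σ j).card +
          (Finset.univ.filter fun j => j > i ∧ i > σ j ∧ σ j > σ i).card) := fun i => by
    unfold cellWeight
    simp only [Fin.val_fin_lt]
    split_ifs with h
    · have e : (Finset.univ.filter fun j => j > i ∧ i > σ j ∧ σ j > σ i) = ∅ := by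
        refine Finset.filter_eq_empty_iff.2 fun j _ hj => ?_
        exact absurd (hj.2.2.trans hj.2.1) h.not_gt
      rw [e, Finset.card_empty, add_zero]
      congr 2
      refine (Finset.card_bij (fun (j : Fin N) _ => (j : ℕ)) ?_
        (fun _ _ _ _ h => Fin.ext h) ?_).symm
      · intro j hj
        simp only [Finset.mem_filter, Finset.mem_univ, true_and] at hj
        simp only [Finset.mem_filter, Finset.mem_Ioc, mem_graph, forall_exists_index]
        refine ⟨⟨hj.1, hj.2.1⟩, ?_⟩
        rintro z k rfl hk
        obtain rfl : k = j := Fin.ext hk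
        exact hj.2.2
      · intro o ho
        simp only [Finset.mem_filter, Finset.mem_Ioc] at ho
        have hoN : o < N := lt_of_le_of_lt ho.1.2 (σ i).2
        refine ⟨⟨o, hoN⟩, ?_, rfl⟩
        simp only [Finset.mem_filter, Finset.mem_univ, true_and]
        exact ⟨ho.1.1, ho.1.2, ho.2 _ (mem_graph.2 ⟨⟨o, hoN⟩, rfl⟩) rfl⟩
    · have hlt : σ i < i := lt_of_le_of_ne (not_lt.1 h) (hσ i)
      have e : (Finset.univ.filter fun j => i < j ∧ j ≤ σ i ∧ σ i < σ j) = ∅ := by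
        refine Finset.filter_eq_empty_iff.2 fun j _ hj => ?_
        exact h (lt_of_lt_of_le hj.1 hj.2.1)
      rw [e, Finset.card_empty, zero_add, one_mul]
      congr 1
      refine (Finset.card_bij (fun j _ => (σ j : ℕ)) ?_
        (fun _ _ _ _ h => σ.injective (Fin.ext h)) ?_).symm
      · intro j hj
        simp only [Finset.mem_filter, Finset.mem_univ, true_and] at hj
        simp only [Finset.mem_filter, Finset.mem_Ioo, mem_graph, forall_exists_index]
        refine ⟨⟨hj.2.2, hj.2.1⟩, ?_⟩
        rintro z k rfl hk
        obtain rfl : k = j := σ.injective (Fin.ext hk)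
        exact hj.1
      · intro o ho
        simp only [Finset.mem_filter, Finset.mem_Ioo] at ho
        have hoN : o < N := ho.1.2.trans i.2
        refine ⟨σ.symm ⟨o, hoN⟩, ?_, by simp⟩
        simp only [Finset.mem_filter, Finset.mem_univ, true_and, Equiv.apply_symm_apply]
        exact ⟨ho.2 (_, (σ (σ.symm ⟨o, hoN⟩) : ℕ)) (mem_graph.2 ⟨σ.symm ⟨o, hoN⟩, rfl⟩) (by simp),
          ho.1.2, ho.1.1⟩
  rw [rookWeight, graph, Finset.prod_image hinj.injOn]
  rw [← graph, Finset.prod_congr rfl fun i _ => hcell i, Finset.prod_mul_distrib,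
    Finset.prod_pow_eq_pow_sum, Finset.sum_add_distrib]
  congr 1
  · rw [Finset.prod_ite, Finset.prod_const, Finset.prod_const_one, mul_one, exc]
  · congr 1
    rw [cr]
    congr 1
    simp only [Finset.card_filter]
    -- `cellWeight` records a crossing of upper arcs at the arc closed first, `cr` at the other one,
    -- so the double sum is exchanged. The lower crossings agree term by term.
    rw [Finset.sum_comm]

end Graph

/-! ### Applying a functional to the expansion over placements. -/

theorem derangementSum_eq_sum_rooks {R : Type*} [CommRing R] (y q : R) {m : ℕ} (n : Fin m → ℕ) :
    derangementSum y q n =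
      ∑ M ∈ (rooks (board (startOf n) (∑ i, n i) (∑ i, n i))).filter (·.card = ∑ i, n i),
        rookWeight y q M := by
  rw [derangementSum]
  refine Finset.sum_bij (fun σ _ => graph σ) (fun σ hσ => ?_) (fun _ _ _ _ h => graph_injective h)
    (fun M hM => ?_) fun σ hσ => ?_
  · rw [mem_inhomDerangements] at hσ
    refine Finset.mem_filter.2 ⟨mem_rooks.2 ⟨fun x hx => ?_, isRook_graph σ⟩, card_graph σ⟩
    obtain ⟨i, rfl⟩ := mem_graph.1 hx
    exact mem_board.2 ⟨i.2, (σ i).2, hσ i⟩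
  · obtain ⟨hM, hcard⟩ := Finset.mem_filter.1 hM
    obtain ⟨hM, hR⟩ := mem_rooks.1 hM
    obtain ⟨σ, rfl⟩ := exists_graph_eq hR (fun x hx => by
      have := mem_board.1 (hM hx); exact ⟨this.1, this.2.1⟩) hcard
    exact ⟨σ, (mem_inhomDerangements n).2 fun k =>
      (mem_board.1 (hM (mem_graph.2 ⟨k, rfl⟩))).2.2, rfl⟩
  · rw [rookWeight_graph y q σ fun i hi => ?_]
    have := (mem_inhomDerangements n).1 hσ i
    have h2 := startOf_le n i
    unfold Admissible at this
    simp only [hi] at this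
    omega

theorem map_rookWeight {R S : Type*} [CommRing R] [CommRing S] (f : R →+* S) (y q : R)
    (M : Finset (ℕ × ℕ)) : f (rookWeight y q M) = rookWeight (f y) (f q) M := by
  simp only [rookWeight, map_prod, cellWeight]
  refine Finset.prod_congr rfl fun x _ => ?_
  split_ifs <;> simp

/-- Vanishing on the single polynomials `L_k`, `k ≠ 0`, is enough in place of full orthogonality;
part (a) verifies only this for the integral functional. -/
theorem derangementSum_eq_of_vanishing {R : Type*} [CommRing R] (y q : R) (Λ : R[X] →ₗ[R] R)
    (h1 : Λ 1 = 1) (h0 : ∀ k, k ≠ 0 → Λ (qLaguerre y q k) = 0) {m : ℕ} (n : Fin m → ℕ) :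
    derangementSum y q n = Λ (∏ j, qLaguerre y q (n j)) := by
  have key := sum_rooks_board_eq_prod y q (startOf_le n) (boxSize n) m
    fun i hi v hv1 hv2 => startOf_eq n hi hv1 hv2
  rw [show ∑ j ∈ Finset.range m, boxSize n j = ∑ i, n i from boxStart_eq_sum n,
    Finset.prod_range] at key
  simp only [boxSize_val] at key
  rw [← key, map_sum, derangementSum_eq_sum_rooks, Finset.sum_filter]
  refine Finset.sum_congr rfl fun M hM => ?_
  obtain ⟨hM, hR⟩ := mem_rooks.1 hM
  have hcard : M.card ≤ ∑ i, n i := by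
    have := Finset.card_le_card_of_injOn (s := M) (t := Finset.range (∑ i, n i)) Prod.fst
      (fun x hx => by simpa using (mem_board.1 (hM hx)).1) hR.injOn_fst
    simpa using this
  rw [← map_rookWeight C, ← smul_eq_C_mul, map_smul, smul_eq_mul]
  split_ifs with h
  · rw [h, Nat.sub_self, qLaguerre_zero, h1, mul_one]
  · rw [h0 _ (by omega), mul_zero]

theorem derangementSum_eq_of_isOrthogonalityFunctional {R : Type*} [CommRing R] (y q : R)
    (Λ : R[X] →ₗ[R] R) (hΛ : IsOrthogonalityFunctional y q Λ) {m : ℕ} (n : Fin m → ℕ) :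
    derangementSum y q n = Λ (∏ j, qLaguerre y q (n j)) :=
  derangementSum_eq_of_vanishing y q Λ hΛ.1 (fun k hk => by
    simpa [qLaguerre_zero] using hΛ.2 k 0 hk) n

/-! ### Reciprocals of `q`-factorials -/

section QFactorial

variable {q : ℝ}

/-- The finite `q`-shifted factorial `(q; q)_n`. -/
noncomputable def qFact (q : ℝ) (n : ℕ) : ℝ := ∏ i ∈ Finset.range n, (1 - q ^ (i + 1))

/-- The reciprocal `1 / (q; q)_n`. -/
noncomputable def rho (q : ℝ) (n : ℕ) : ℝ := (qFact q n)⁻¹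

/-- The reciprocal `1 / (q; q)_m`, extended by zero to the negative integers. -/
noncomputable def rhoInt (q : ℝ) (m : ℤ) : ℝ := if 0 ≤ m then rho q m.toNat else 0

theorem one_sub_pow_pos (hq : |q| < 1) {n : ℕ} (hn : n ≠ 0) : 0 < 1 - q ^ n := by
  have h1 : |q ^ n| < 1 := by rw [abs_pow]; exact pow_lt_one₀ (abs_nonneg q) hq hn
  have := le_abs_self (q ^ n)
  linarith

theorem qFact_pos (hq : |q| < 1) (n : ℕ) : 0 < qFact q n :=
  Finset.prod_pos fun i _ => one_sub_pow_pos hq (Nat.succ_ne_zero i)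

theorem qFact_succ (q : ℝ) (n : ℕ) : qFact q (n + 1) = qFact q n * (1 - q ^ (n + 1)) :=
  Finset.prod_range_succ _ _

@[simp] theorem qFact_zero (q : ℝ) : qFact q 0 = 1 := rfl

@[simp] theorem rho_zero (q : ℝ) : rho q 0 = 1 := by simp [rho]

theorem rho_pos (hq : |q| < 1) (n : ℕ) : 0 < rho q n := inv_pos.2 (qFact_pos hq n)

theorem rho_succ (hq : |q| < 1) (n : ℕ) : (1 - q ^ (n + 1)) * rho q (n + 1) = rho q n := by
  have h1 := (one_sub_pow_pos hq (Nat.succ_ne_zero n)).ne'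
  have h2 := (qFact_pos hq n).ne'
  rw [rho, rho, qFact_succ]
  simp only [Nat.succ_eq_add_one] at h1
  field_simp

theorem rhoInt_natCast (q : ℝ) (n : ℕ) : rhoInt q n = rho q n := by simp [rhoInt]

theorem rhoInt_of_neg (q : ℝ) {m : ℤ} (hm : m < 0) : rhoInt q m = 0 := by
  simp [rhoInt, hm]

theorem sum_antidiagonal_left (hq : |q| < 1) (n : ℕ) (F : ℕ → ℕ → ℝ) :
    ∑ x ∈ Finset.HasAntidiagonal.antidiagonal (n + 1), (1 - q ^ x.1) * rho q x.1 * F x.1 x.2 =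
      ∑ x ∈ Finset.HasAntidiagonal.antidiagonal n, rho q x.1 * F (x.1 + 1) x.2 := by
  rw [Finset.Nat.sum_antidiagonal_succ]
  simp [rho_succ hq]

theorem sum_antidiagonal_right (hq : |q| < 1) (n : ℕ) (F : ℕ → ℕ → ℝ) :
    ∑ x ∈ Finset.HasAntidiagonal.antidiagonal (n + 1), (1 - q ^ x.2) * rho q x.2 * F x.1 x.2 =
      ∑ x ∈ Finset.HasAntidiagonal.antidiagonal n, rho q x.2 * F x.1 (x.2 + 1) := by
  rw [Finset.Nat.sum_antidiagonal_succ']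
  simp [rho_succ hq]

/-- An alternating sum of Gaussian binomial coefficients, divided by `(q; q)_n`. -/
noncomputable def altSum (q : ℝ) (n p : ℕ) : ℝ :=
  ∑ x ∈ Finset.HasAntidiagonal.antidiagonal n,
    (-1) ^ x.1 * q ^ tri ((x.1 : ℤ) - p - 1) * rho q x.1 * rho q x.2

/-- For `i + j = n + 1` write `1 - q^(n+1) = (1 - q^j) + q^j (1 - q^i)`. Each part cancels a factor
of a reciprocal factorial and shifts an index, giving `altSum q n p` with factors `1` and
`-q^(n-p)`. -/
theorem altSum_succ (hq : |q| < 1) {n p : ℕ} (hp : p ≤ n) :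
    (1 - q ^ (n + 1)) * altSum q (n + 1) p = (1 - q ^ (n - p)) * altSum q n p := by
  have e1 := sum_antidiagonal_right hq n
    (fun i _ => (-1) ^ i * q ^ tri ((i : ℤ) - p - 1) * rho q i)
  have e2 := sum_antidiagonal_left hq n
    (fun i j => (-1) ^ i * q ^ tri ((i : ℤ) - p - 1) * rho q j * q ^ j)
  have e3 : ∑ x ∈ Finset.HasAntidiagonal.antidiagonal n,
      rho q x.1 * ((-1) ^ (x.1 + 1) * q ^ tri (((x.1 + 1 : ℕ) : ℤ) - p - 1) * rho q x.2 * q ^ x.2) =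
      -(q ^ (n - p) * altSum q n p) := by
    rw [altSum, Finset.mul_sum, ← Finset.sum_neg_distrib]
    refine Finset.sum_congr rfl fun x hx => ?_
    rw [Finset.HasAntidiagonal.mem_antidiagonal] at hx
    have : q ^ tri (((x.1 + 1 : ℕ) : ℤ) - p - 1) * q ^ x.2 =
        q ^ (n - p) * q ^ tri ((x.1 : ℤ) - p - 1) := by
      rw [← pow_add, ← pow_add]
      congr 1
      have := tri_succ ((x.1 : ℤ) - p - 1)
      rw [show ((x.1 + 1 : ℕ) : ℤ) - p - 1 = (x.1 : ℤ) - p - 1 + 1 by push_cast; ring]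
      omega
    linear_combination (rho q x.1 * (-1) ^ (x.1 + 1) * rho q x.2) * this
  rw [e3] at e2
  have e4 : (1 - q ^ (n + 1)) * altSum q (n + 1) p =
      ∑ x ∈ Finset.HasAntidiagonal.antidiagonal (n + 1), (1 - q ^ x.2) * rho q x.2 *
        ((-1) ^ x.1 * q ^ tri ((x.1 : ℤ) - p - 1) * rho q x.1) +
      ∑ x ∈ Finset.HasAntidiagonal.antidiagonal (n + 1), (1 - q ^ x.1) * rho q x.1 *
        ((-1) ^ x.1 * q ^ tri ((x.1 : ℤ) - p - 1) * rho q x.2 * q ^ x.2) := by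
    rw [altSum, Finset.mul_sum, ← Finset.sum_add_distrib]
    refine Finset.sum_congr rfl fun x hx => ?_
    rw [Finset.HasAntidiagonal.mem_antidiagonal] at hx
    rw [← hx, pow_add]
    ring
  rw [e4, e1, e2, altSum]
  have e5 : ∀ S T : ℝ, S = T → S + -(q ^ (n - p) * T) = (1 - q ^ (n - p)) * T := by
    rintro S T rfl; ring
  refine e5 _ _ (Finset.sum_congr rfl fun x _ => by ring)

/-- The recurrence has factor zero at `n = p` and propagates the zero upwards. For `q ≠ 0` this is
the `q`-binomial theorem at `q^(-p)`; the recurrence also covers `q = 0`. -/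
theorem altSum_eq_zero (hq : |q| < 1) {n p : ℕ} (hp : p < n) : altSum q n p = 0 := by
  induction n, hp using Nat.le_induction with
  | base =>
    have := altSum_succ hq (le_refl p)
    rw [Nat.sub_self, pow_zero, sub_self, zero_mul] at this
    exact (mul_eq_zero.1 this).resolve_left (one_sub_pow_pos hq (Nat.succ_ne_zero p)).ne'
  | succ n hn ih =>
    have := altSum_succ hq (show p ≤ n by omega)
    rw [ih, mul_zero] at this
    exact (mul_eq_zero.1 this).resolve_left (one_sub_pow_pos hq (Nat.succ_ne_zero n)).ne'

/-! ### Continuous `q`-Hermite polynomials -/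

/-- The continuous `q`-Hermite polynomial `H_n(cos θ | q)`, divided by `(q; q)_n`. -/
noncomputable def hermite (q θ : ℝ) (n : ℕ) : ℝ :=
  ∑ x ∈ Finset.HasAntidiagonal.antidiagonal n,
    rho q x.1 * rho q x.2 * Real.cos (((x.1 : ℝ) - x.2) * θ)

theorem hermite_zero (q θ : ℝ) : hermite q θ 0 = 1 := by simp [hermite]

theorem hermite_one (hq : |q| < 1) (θ : ℝ) :
    (1 - q) * hermite q θ 1 = 2 * Real.cos θ := by
  have h := rho_succ hq 0
  simp only [zero_add, pow_one, rho_zero] at h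
  simp only [hermite, Finset.Nat.sum_antidiagonal_succ, Finset.Nat.antidiagonal_zero,
    Finset.sum_singleton, rho_zero]
  norm_num
  linear_combination 2 * Real.cos θ * h

/-- The splitting `1 - q^(i+j) = (1 - q^i) + q^i (1 - q^j)` leaves `cos((i-j+1)θ) + q^i
cos((i-j-1)θ)`, which is `2 cos θ cos((i-j)θ)` minus a term `(1 - q^i) cos((i-j-1)θ)` that resums to
`hermite q θ n`. -/
theorem hermite_succ_succ (hq : |q| < 1) (θ : ℝ) (n : ℕ) :
    (1 - q ^ (n + 2)) * hermite q θ (n + 2) =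
      2 * Real.cos θ * hermite q θ (n + 1) - hermite q θ n := by
  have e1 := sum_antidiagonal_left hq (n + 1)
    (fun i j => rho q j * Real.cos (((i : ℝ) - j) * θ))
  have e2 := sum_antidiagonal_right hq (n + 1)
    (fun i j => q ^ i * rho q i * Real.cos (((i : ℝ) - j) * θ))
  have e3 := sum_antidiagonal_left hq n
    (fun i j => rho q j * Real.cos (((i : ℝ) - j - 1) * θ))
  have e4 : (1 - q ^ (n + 2)) * hermite q θ (n + 2) =
      ∑ x ∈ Finset.HasAntidiagonal.antidiagonal (n + 2), (1 - q ^ x.1) * rho q x.1 *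
        (rho q x.2 * Real.cos (((x.1 : ℝ) - x.2) * θ)) +
      ∑ x ∈ Finset.HasAntidiagonal.antidiagonal (n + 2), (1 - q ^ x.2) * rho q x.2 *
        (q ^ x.1 * rho q x.1 * Real.cos (((x.1 : ℝ) - x.2) * θ)) := by
    rw [hermite, Finset.mul_sum, ← Finset.sum_add_distrib]
    refine Finset.sum_congr rfl fun x hx => ?_
    rw [Finset.HasAntidiagonal.mem_antidiagonal] at hx
    rw [← hx, pow_add]
    ring
  have e5 : hermite q θ n = ∑ x ∈ Finset.HasAntidiagonal.antidiagonal n,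
      rho q x.1 * (rho q x.2 * Real.cos ((((x.1 + 1 : ℕ) : ℝ) - x.2 - 1) * θ)) :=
    Finset.sum_congr rfl fun x _ => by
      push_cast
      rw [show (x.1 : ℝ) + 1 - x.2 - 1 = (x.1 : ℝ) - x.2 by ring, mul_assoc]
  rw [e4, e1, e2, e5, ← e3, hermite, Finset.mul_sum, ← Finset.sum_sub_distrib,
    ← Finset.sum_add_distrib]
  refine Finset.sum_congr rfl fun x _ => ?_
  push_cast
  rw [show ((x.1 : ℝ) + 1 - x.2) * θ = ((x.1 : ℝ) - x.2) * θ + θ by ring,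
    show ((x.1 : ℝ) - (x.2 + 1)) * θ = ((x.1 : ℝ) - x.2) * θ - θ by ring,
    show ((x.1 : ℝ) - x.2 - 1) * θ = ((x.1 : ℝ) - x.2) * θ - θ by ring, Real.cos_add, Real.cos_sub]
  ring

end QFactorial

/-! ### Fourier coefficients of finite products -/

section FiniteProduct

variable {q : ℝ}

/-- The Fourier coefficients of `(e^{2 i θ}; q)_N (e^{-2 i θ}; q)_N`, up to sign and normalization. -/
noncomputable def fourierCoeffAux (q : ℝ) (N : ℕ) (j : ℤ) : ℝ :=
  (q ^ tri (j - 1) + q ^ tri j) * rhoInt q (N + j) * rhoInt q (N - j)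

theorem tri_neg (j : ℤ) : tri (-j) = tri (j - 1) := by
  unfold tri; congr 2; ring

theorem fourierCoeffAux_neg (q : ℝ) (N : ℕ) (j : ℤ) :
    fourierCoeffAux q N (-j) = fourierCoeffAux q N j := by
  unfold fourierCoeffAux
  rw [tri_neg, show -j - 1 = -(j + 1) by ring, tri_neg, add_sub_cancel_right, sub_neg_eq_add,
    ← sub_eq_add_neg]
  ring

theorem fourierCoeffAux_of_lt (q : ℝ) {N : ℕ} {j : ℤ} (h : (N : ℤ) < j) :
    fourierCoeffAux q N j = 0 := by
  rw [fourierCoeffAux, rhoInt_of_neg q (by omega : (N : ℤ) - j < 0), mul_zero]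

theorem rhoInt_sub_one (hq : |q| < 1) (n : ℕ) :
    rhoInt q ((n : ℤ) - 1) = (1 - q ^ n) * rho q n := by
  cases n with
  | zero => simp [rhoInt]
  | succ n =>
    rw [rho_succ hq, Nat.cast_succ, add_sub_cancel_right, rhoInt_natCast]

/-- The relation mirrors multiplication of the finite product by its next factor `1 - 2 q^N cos 2θ +
q^(2N)`; the sign `(-1)^j` is stripped off. For `1 ≤ j ≤ N + 1` all terms are reduced to the
reciprocal factorials of `N + 1 + j` and `N + 1 - j`. -/
theorem fourierCoeffAux_succ_natCast (hq : |q| < 1) (N j : ℕ) :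
    (1 - q ^ (2 * N + 1)) * (1 - q ^ (N + 1)) * (1 + q ^ N) * fourierCoeffAux q (N + 1) j =
      (1 + q ^ (2 * N)) * fourierCoeffAux q N j +
        q ^ N * (fourierCoeffAux q N (j + 1) + fourierCoeffAux q N (j - 1)) := by
  rcases lt_or_ge (N + 1) j with h | h
  · rw [fourierCoeffAux_of_lt q (by push_cast; omega), fourierCoeffAux_of_lt q (by omega),
      fourierCoeffAux_of_lt q (by omega), fourierCoeffAux_of_lt q (by omega)]
    ring
  obtain ⟨d, hd⟩ := Nat.exists_eq_add_of_le h
  rcases Nat.eq_zero_or_pos j with rfl | hj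
  · have := fourierCoeffAux_neg q N 1
    simp only [Nat.cast_zero, zero_add, zero_sub, this]
    have t1 : tri (-1) = 0 := rfl
    have t2 : tri 1 = 1 := rfl
    have r1 : rhoInt q ((N : ℤ) - 1) = _ := rhoInt_sub_one hq N
    have r2 := rho_succ hq N
    unfold fourierCoeffAux
    simp only [zero_sub, t1, tri_zero, sub_self, t2, add_zero, sub_zero, rhoInt_natCast,
      show (N : ℤ) + 1 = ((N + 1 : ℕ) : ℤ) by push_cast; ring, r1, ← r2]
    ring
  · obtain ⟨i, rfl⟩ := Nat.exists_eq_add_of_lt hj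
    rw [zero_add] at *
    obtain rfl : N = i + d := by omega
    have t0 : (tri (i : ℤ) : ℤ) = tri ((i : ℤ) - 1) + i := by
      have := tri_succ ((i : ℤ) - 1); rw [sub_add_cancel] at this; exact this
    have t1 : (tri ((i : ℤ) + 1) : ℤ) = tri (i : ℤ) + (i + 1) := tri_succ i
    have t2 : (tri ((i : ℤ) + 1 + 1) : ℤ) = tri ((i : ℤ) + 1) + (i + 1 + 1) := tri_succ (i + 1)
    have t0' : tri (i : ℤ) = tri ((i : ℤ) - 1) + i := by omega
    have t1' : tri ((i : ℤ) + 1) = tri (i : ℤ) + (i + 1) := by omega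
    have t2' : tri ((i : ℤ) + 1 + 1) = tri ((i : ℤ) + 1) + (i + 1 + 1) := by omega
    unfold fourierCoeffAux
    push_cast
    rw [show (i : ℤ) + 1 - 1 = i by ring, show (i : ℤ) + 1 + 1 - 1 = i + 1 by ring,
      show (i : ℤ) + d + 1 + (i + 1) = ((2 * i + d + 2 : ℕ) : ℤ) by push_cast; ring,
      show (i : ℤ) + d + 1 - (i + 1) = (d : ℤ) by ring,
      show (i : ℤ) + d + (i + 1) = ((2 * i + d + 1 : ℕ) : ℤ) by push_cast; ring,
      show (i : ℤ) + d - (i + 1) = (d : ℤ) - 1 by ring,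
      show (i : ℤ) + d + (i + 1 + 1) = ((2 * i + d + 2 : ℕ) : ℤ) by push_cast; ring,
      show (i : ℤ) + d - (i + 1 + 1) = (d : ℤ) - 1 - 1 by ring,
      show (i : ℤ) + d + i = ((2 * i + d : ℕ) : ℤ) by push_cast; ring,
      show (i : ℤ) + d - i = (d : ℤ) by ring]
    simp only [rhoInt_natCast, rhoInt_sub_one hq]
    have r1 := rho_succ hq (2 * i + d + 1)
    have r2 := rho_succ hq (2 * i + d)
    rw [← r2, ← r1, t2', t1', t0']
    -- The spare factor `q` turns `1 - q^(d-1)` into `q - q^d`, so no negative power arises and `d =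
    -- 0` is included.
    have r3 : q * rhoInt q ((d : ℤ) - 1 - 1) = (q - q ^ d) * ((1 - q ^ d) * rho q d) := by
      cases d with
      | zero => simp [rhoInt]
      | succ d =>
        rw [rho_succ hq, Nat.cast_succ, add_sub_cancel_right, rhoInt_sub_one hq]
        ring
    have r4 : q ^ (tri ((i : ℤ) - 1) + i + (i + 1) + (i + 1 + 1)) * rhoInt q ((d : ℤ) - 1 - 1) =
        q ^ (tri ((i : ℤ) - 1) + i + (i + 1) + i + 1) *
          ((q - q ^ d) * ((1 - q ^ d) * rho q d)) := by
      rw [← r3]; ring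
    have r5 : q ^ (tri ((i : ℤ) - 1) + i + (i + 1)) * rhoInt q ((d : ℤ) - 1 - 1) =
        q ^ (tri ((i : ℤ) - 1) + i + i) * ((q - q ^ d) * ((1 - q ^ d) * rho q d)) := by
      rw [← r3]; ring
    generalize rhoInt q ((d : ℤ) - 1 - 1) = z at *
    linear_combination (exp := 1) -(q ^ (i + d) * rho q (2 * i + d + 2)) * (r4 + r5)

theorem fourierCoeffAux_succ (hq : |q| < 1) (N : ℕ) (j : ℤ) :
    (1 - q ^ (2 * N + 1)) * (1 - q ^ (N + 1)) * (1 + q ^ N) * fourierCoeffAux q (N + 1) j =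
      (1 + q ^ (2 * N)) * fourierCoeffAux q N j +
        q ^ N * (fourierCoeffAux q N (j + 1) + fourierCoeffAux q N (j - 1)) := by
  obtain ⟨k, rfl | rfl⟩ := Int.eq_nat_or_neg j
  · exact fourierCoeffAux_succ_natCast hq N k
  · have := fourierCoeffAux_succ_natCast hq N k
    rw [fourierCoeffAux_neg, fourierCoeffAux_neg, show -(k : ℤ) + 1 = -(k - 1) by ring,
      fourierCoeffAux_neg, show -(k : ℤ) - 1 = -(k + 1) by ring, fourierCoeffAux_neg, this]
    ring

end FiniteProduct

open MeasureTheory Filter Topology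

/-! ### Infinite products -/

section InfiniteProduct

variable {q c s : ℝ}

/-- The infinite product `(s z; q)_∞ (s / z; q)_∞`, where `c = (z + 1 / z) / 2`. -/
noncomputable def qProd (q c s : ℝ) : ℝ := ∏' k : ℕ, (1 - 2 * c * (s * q ^ k) + (s * q ^ k) ^ 2)

/-- The partial products of `qProd`. -/
noncomputable def qProdFin (q c s : ℝ) (N : ℕ) : ℝ :=
  ∏ k ∈ Finset.range N, (1 - 2 * c * (s * q ^ k) + (s * q ^ k) ^ 2)

theorem factor_nonneg (hc : |c| ≤ 1) (t : ℝ) : 0 ≤ 1 - 2 * c * t + t ^ 2 := by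
  have := sq_le_one_iff_abs_le_one c |>.2 hc
  nlinarith [sq_nonneg (t - c)]

theorem abs_factor_sub_one_le (hc : |c| ≤ 1) {t : ℝ} (ht : |t| ≤ 1) :
    |-(2 * c * t) + t ^ 2| ≤ 3 * |t| := by
  calc |-(2 * c * t) + t ^ 2| ≤ |-(2 * c * t)| + |t ^ 2| := abs_add_le _ _
    _ = 2 * |c| * |t| + |t| * |t| := by rw [abs_neg, abs_mul, abs_mul, abs_two, abs_pow, sq]
    _ ≤ 2 * 1 * |t| + 1 * |t| := by gcongr
    _ = 3 * |t| := by ring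

theorem abs_mul_pow_le (hs : |s| ≤ 1) (k : ℕ) : |s * q ^ k| ≤ |q| ^ k := by
  rw [abs_mul, abs_pow]
  exact mul_le_of_le_one_left (by positivity) hs

theorem abs_mul_pow_le_one (hq : |q| < 1) (hs : |s| ≤ 1) (k : ℕ) : |s * q ^ k| ≤ 1 :=
  (abs_mul_pow_le hs k).trans (pow_le_one₀ (abs_nonneg q) hq.le)

theorem summable_abs_factor (hq : |q| < 1) (hc : |c| ≤ 1) (hs : |s| ≤ 1) :
    Summable fun k : ℕ => ‖-(2 * c * (s * q ^ k)) + (s * q ^ k) ^ 2‖ := by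
  refine Summable.of_nonneg_of_le (fun _ => norm_nonneg _) (fun k => ?_)
    ((summable_geometric_of_lt_one (abs_nonneg q) hq).mul_left 3)
  exact (abs_factor_sub_one_le hc (abs_mul_pow_le_one hq hs k)).trans
    (by gcongr; exact abs_mul_pow_le hs k)

theorem hasProd_qProd (hq : |q| < 1) (hc : |c| ≤ 1) (hs : |s| ≤ 1) :
    HasProd (fun k : ℕ => 1 - 2 * c * (s * q ^ k) + (s * q ^ k) ^ 2) (qProd q c s) := by
  have := multipliable_one_add_of_summable (summable_abs_factor hq hc hs)
  have e : (fun k : ℕ => 1 - 2 * c * (s * q ^ k) + (s * q ^ k) ^ 2) =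
      fun k : ℕ => 1 + (-(2 * c * (s * q ^ k)) + (s * q ^ k) ^ 2) := by
    ext k; ring
  rw [← e] at this
  exact this.hasProd

theorem tendsto_qProdFin (hq : |q| < 1) (hc : |c| ≤ 1) (hs : |s| ≤ 1) :
    Tendsto (qProdFin q c s) atTop (𝓝 (qProd q c s)) :=
  (hasProd_qProd hq hc hs).tendsto_prod_nat

theorem qProdFin_nonneg (hc : |c| ≤ 1) (s : ℝ) (N : ℕ) : 0 ≤ qProdFin q c s N :=
  Finset.prod_nonneg fun _ _ => factor_nonneg hc _

theorem qProdFin_le (hq : |q| < 1) (hc : |c| ≤ 1) (hs : |s| ≤ 1) (N : ℕ) :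
    qProdFin q c s N ≤ Real.exp (3 * (1 - |q|)⁻¹) := by
  calc qProdFin q c s N ≤ ∏ k ∈ Finset.range N, Real.exp (3 * |q| ^ k) := by
        refine Finset.prod_le_prod (fun _ _ => factor_nonneg hc _) fun k _ => ?_
        have h1 := le_of_abs_le (abs_factor_sub_one_le hc (abs_mul_pow_le_one hq hs k))
        have h2 := abs_mul_pow_le (q := q) hs k
        have h3 := Real.add_one_le_exp (3 * |q| ^ k)
        linarith
    _ = Real.exp (3 * ∑ k ∈ Finset.range N, |q| ^ k) := by
        rw [← Real.exp_sum, Finset.mul_sum]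
    _ ≤ Real.exp (3 * (1 - |q|)⁻¹) := by
        gcongr
        rw [← tsum_geometric_of_lt_one (abs_nonneg q) hq]
        exact (summable_geometric_of_lt_one (abs_nonneg q) hq).sum_le_tsum _
          fun _ _ => by positivity

theorem qProd_nonneg (hq : |q| < 1) (hc : |c| ≤ 1) (hs : |s| ≤ 1) : 0 ≤ qProd q c s :=
  ge_of_tendsto' (tendsto_qProdFin hq hc hs) fun N => qProdFin_nonneg hc s N

theorem qProd_le (hq : |q| < 1) (hc : |c| ≤ 1) (hs : |s| ≤ 1) :
    qProd q c s ≤ Real.exp (3 * (1 - |q|)⁻¹) :=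
  le_of_tendsto' (tendsto_qProdFin hq hc hs) fun N => qProdFin_le hq hc hs N

theorem qProdFin_succ' (q c s : ℝ) (N : ℕ) :
    qProdFin q c s (N + 1) = (1 - 2 * c * s + s ^ 2) * qProdFin q c (s * q) N := by
  rw [qProdFin, Finset.prod_range_succ', mul_comm]
  simp only [pow_zero, mul_one]
  congr 1
  exact Finset.prod_congr rfl fun k _ => by ring

theorem abs_mul_le_one (hq : |q| < 1) (hs : |s| ≤ 1) : |s * q| ≤ 1 := by
  simpa using abs_mul_pow_le_one hq hs 1

theorem qProd_eq_mul (hq : |q| < 1) (hc : |c| ≤ 1) (hs : |s| ≤ 1) :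
    qProd q c s = (1 - 2 * c * s + s ^ 2) * qProd q c (s * q) := by
  have h1 := (tendsto_add_atTop_iff_nat 1).2 (tendsto_qProdFin hq hc hs)
  have h2 := (tendsto_qProdFin hq hc (abs_mul_le_one hq hs)).const_mul (1 - 2 * c * s + s ^ 2)
  simp only [qProdFin_succ'] at h1
  exact tendsto_nhds_unique h1 h2

end InfiniteProduct

/-! ### Limits of the `q`-factorials. -/

section Limits

variable {q : ℝ}

theorem tendsto_qFact (hq : |q| < 1) : Tendsto (qFact q) atTop (𝓝 (qPochInf q q)) := by
  have hs : Summable fun k : ℕ => ‖-(q * q ^ k)‖ := by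
    simp only [norm_neg, norm_mul, norm_pow, Real.norm_eq_abs]
    exact (summable_geometric_of_lt_one (abs_nonneg q) hq).mul_left _
  have := (multipliable_one_add_of_summable hs).hasProd.tendsto_prod_nat
  simp only [← sub_eq_add_neg] at this
  refine (this.congr fun N => ?_)
  exact Finset.prod_congr rfl fun k _ => by ring

theorem qPochInf_ne_zero (hq : |q| < 1) : qPochInf q q ≠ 0 := by
  have hs : Summable fun k : ℕ => ‖-(q * q ^ k)‖ := by
    simp only [norm_neg, norm_mul, norm_pow, Real.norm_eq_abs]
    exact (summable_geometric_of_lt_one (abs_nonneg q) hq).mul_left _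
  have := tprod_one_add_ne_zero_of_summable (f := fun k : ℕ => -(q * q ^ k)) (fun k => ?_) hs
  · simp only [← sub_eq_add_neg] at this
    exact this
  · rw [← sub_eq_add_neg, ← pow_succ']
    exact (one_sub_pow_pos hq (Nat.succ_ne_zero k)).ne'

theorem tendsto_rho (hq : |q| < 1) : Tendsto (rho q) atTop (𝓝 (qPochInf q q)⁻¹) :=
  (tendsto_qFact hq).inv₀ (qPochInf_ne_zero hq)

theorem exists_rho_le (hq : |q| < 1) : ∃ K, 0 < K ∧ ∀ n, rho q n ≤ K := by
  obtain ⟨K, hK⟩ := (tendsto_rho hq).bddAbove_range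
  exact ⟨max K 1, by positivity, fun n => (hK ⟨n, rfl⟩).trans (le_max_left _ _)⟩

end Limits

/-! ### Integration over the half circle -/

/-- Lebesgue measure on the interval `(0, π)`. -/
noncomputable def arc : Measure ℝ := volume.restrict (Set.Ioo 0 Real.pi)

instance : IsFiniteMeasure arc := ⟨by simp [arc]⟩

theorem integrable_arc_of_continuous {f : ℝ → ℝ} (hf : Continuous f) : Integrable f arc :=
  (hf.integrableOn_Icc).mono_set Set.Ioo_subset_Icc_self

theorem integral_arc (f : ℝ → ℝ) : ∫ θ, f θ ∂arc = ∫ θ in (0 : ℝ)..Real.pi, f θ := by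
  rw [intervalIntegral.integral_of_le Real.pi_pos.le, integral_Ioc_eq_integral_Ioo, arc]

theorem integral_arc_cos (l : ℤ) :
    ∫ θ, Real.cos (l * θ) ∂arc = if l = 0 then Real.pi else 0 := by
  rw [integral_arc]
  split_ifs with h
  · simp [h]
  · have : (l : ℝ) ≠ 0 := by exact_mod_cast h
    rw [intervalIntegral.integral_comp_mul_left _ this, integral_cos]
    simp [Real.sin_int_mul_pi]

/-! ### Fourier coefficients of the `q`-Hermite weight. -/

section FourierIntegrals

variable {q : ℝ}

theorem continuous_qProdFin (q s : ℝ) (N : ℕ) {g : ℝ → ℝ} (hg : Continuous g) :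
    Continuous fun θ => qProdFin q (g θ) s N := by
  unfold qProdFin; fun_prop

theorem integral_qProdFin_succ (q : ℝ) (N : ℕ) (l : ℤ) :
    ∫ θ, qProdFin q (Real.cos (2 * θ)) 1 (N + 1) * Real.cos (l * θ) ∂arc =
      (1 + q ^ (2 * N)) * ∫ θ, qProdFin q (Real.cos (2 * θ)) 1 N * Real.cos (l * θ) ∂arc -
        q ^ N * (∫ θ, qProdFin q (Real.cos (2 * θ)) 1 N * Real.cos ((l + 2 : ℤ) * θ) ∂arc +
          ∫ θ, qProdFin q (Real.cos (2 * θ)) 1 N * Real.cos ((l - 2 : ℤ) * θ) ∂arc) := by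
  have hi : ∀ m : ℤ, Integrable (fun θ => qProdFin q (Real.cos (2 * θ)) 1 N *
      Real.cos (m * θ)) arc := fun m => integrable_arc_of_continuous
    ((continuous_qProdFin q 1 N (by fun_prop)).mul (by fun_prop))
  rw [← integral_add (hi _) (hi _), ← integral_const_mul, ← integral_const_mul,
    ← integral_sub ((hi _).const_mul _) (((hi _).fun_add (hi _)).const_mul _)]
  congr 1
  ext θ
  rw [qProdFin, Finset.prod_range_succ, ← qProdFin]
  push_cast
  rw [show ((l : ℝ) + 2) * θ = l * θ + 2 * θ by ring,
    show ((l : ℝ) - 2) * θ = l * θ - 2 * θ by ring,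
    Real.cos_add, Real.cos_sub]
  ring

/-- The normalization of the Fourier coefficients of the finite products. -/
noncomputable def fourierConst (q : ℝ) (N : ℕ) : ℝ := qFact q (2 * N) / (1 + q ^ N)

theorem one_add_pow_pos (hq : |q| < 1) (n : ℕ) : 0 < 1 + q ^ n := by
  rcases Nat.eq_zero_or_pos n with rfl | hn
  · norm_num
  · have h1 : |q ^ n| < 1 := by rw [abs_pow]; exact pow_lt_one₀ (abs_nonneg q) hq hn.ne'
    have := neg_abs_le (q ^ n)
    linarith

theorem fourierConst_succ (hq : |q| < 1) (N : ℕ) : fourierConst q (N + 1) =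
    fourierConst q N * ((1 - q ^ (2 * N + 1)) * (1 - q ^ (N + 1)) * (1 + q ^ N)) := by
  have h1 := (one_add_pow_pos hq N).ne'
  have h2 := (one_add_pow_pos hq (N + 1)).ne'
  rw [fourierConst, fourierConst, show 2 * (N + 1) = 2 * N + 1 + 1 by ring, qFact_succ, qFact_succ,
    div_eq_iff h2]
  field_simp
  ring

theorem integral_qProdFin_odd (q : ℝ) (N : ℕ) (j : ℤ) :
    ∫ θ, qProdFin q (Real.cos (2 * θ)) 1 N * Real.cos ((2 * j + 1 : ℤ) * θ) ∂arc = 0 := by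
  induction N generalizing j with
  | zero =>
    simp only [qProdFin, Finset.range_zero, Finset.prod_empty, one_mul]
    rw [integral_arc_cos, if_neg (by omega)]
  | succ N ih =>
    rw [integral_qProdFin_succ, ih, show 2 * j + 1 + 2 = 2 * (j + 1) + 1 by ring, ih,
      show 2 * j + 1 - 2 = 2 * (j - 1) + 1 by ring, ih]
    simp

theorem integral_qProdFin_even (hq : |q| < 1) (N : ℕ) (j : ℤ) :
    ∫ θ, qProdFin q (Real.cos (2 * θ)) 1 N * Real.cos ((2 * j : ℤ) * θ) ∂arc =
      Real.pi * (-1) ^ j * (fourierConst q N * fourierCoeffAux q N j) := by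
  induction N generalizing j with
  | zero =>
    simp only [qProdFin, Finset.range_zero, Finset.prod_empty, one_mul]
    rw [integral_arc_cos]
    split_ifs with h
    · obtain rfl : j = 0 := by omega
      have t1 : tri (-1) = 0 := rfl
      simp [fourierConst, fourierCoeffAux, rhoInt, t1]
    · have : rhoInt q (0 + j) * rhoInt q (0 - j) = 0 := by
        rcases lt_or_gt_of_ne (show j ≠ 0 by omega) with h | h
        · rw [rhoInt_of_neg q (by omega), zero_mul]
        · rw [rhoInt_of_neg q (m := 0 - j) (by omega), mul_zero]
      rw [fourierCoeffAux, mul_assoc (_ + _), Nat.cast_zero, this]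
      simp
  | succ N ih =>
    rw [integral_qProdFin_succ, ih, show 2 * j + 2 = 2 * (j + 1) by ring, ih,
      show 2 * j - 2 = 2 * (j - 1) by ring, ih, fourierConst_succ hq]
    have := fourierCoeffAux_succ hq N j
    rw [zpow_add_one₀ (by norm_num), zpow_sub_one₀ (by norm_num)]
    norm_num
    linear_combination -(Real.pi * (-1) ^ j * fourierConst q N) * this

/-- The weight function of the continuous `q`-Hermite polynomials. -/
noncomputable def hermiteWeight (q θ : ℝ) : ℝ := qProd q (Real.cos (2 * θ)) 1

theorem measurable_qProd (hq : |q| < 1) {s : ℝ} (hs : |s| ≤ 1) (k : ℝ) :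
    Measurable fun θ => qProd q (Real.cos (k * θ)) s := by
  refine measurable_of_tendsto_metrizable (f := fun N θ => qProdFin q (Real.cos (k * θ)) s N)
    (fun N => (continuous_qProdFin q s N (by fun_prop)).measurable) ?_
  rw [tendsto_pi_nhds]
  exact fun θ => tendsto_qProdFin hq (Real.abs_cos_le_one _) hs

theorem tendsto_integral_qProdFin (hq : |q| < 1) (l : ℤ) :
    Tendsto (fun N => ∫ θ, qProdFin q (Real.cos (2 * θ)) 1 N * Real.cos (l * θ) ∂arc) atTop
      (𝓝 (∫ θ, hermiteWeight q θ * Real.cos (l * θ) ∂arc)) := by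
  refine tendsto_integral_of_dominated_convergence (fun _ => Real.exp (3 * (1 - |q|)⁻¹))
    (fun N => ((continuous_qProdFin q 1 N (by fun_prop)).mul
      (by fun_prop)).aestronglyMeasurable) (integrable_const _) (fun N => ae_of_all _ fun θ => ?_)
    (ae_of_all _ fun θ => ?_)
  · rw [norm_mul, Real.norm_eq_abs, Real.norm_eq_abs,
      abs_of_nonneg (qProdFin_nonneg (Real.abs_cos_le_one _) _ _)]
    exact (mul_le_of_le_one_right (qProdFin_nonneg (Real.abs_cos_le_one _) _ _)
      (Real.abs_cos_le_one _)).trans (qProdFin_le hq (Real.abs_cos_le_one _) (by simp) N)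
  · exact (tendsto_qProdFin hq (Real.abs_cos_le_one _) (by simp)).mul_const _

theorem integral_hermiteWeight_odd (hq : |q| < 1) (j : ℤ) :
    ∫ θ, hermiteWeight q θ * Real.cos ((2 * j + 1 : ℤ) * θ) ∂arc = 0 := by
  have := tendsto_integral_qProdFin hq (2 * j + 1)
  simp only [integral_qProdFin_odd] at this
  exact (tendsto_nhds_unique this tendsto_const_nhds)

/-- Let `N → ∞` in the finite formula: both reciprocal factorials tend to `1/(q;q)_∞` and the
constant to `(q;q)_∞`. -/
theorem integral_hermiteWeight_even (hq : |q| < 1) (j : ℤ) :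
    ∫ θ, hermiteWeight q θ * Real.cos ((2 * j : ℤ) * θ) ∂arc =
      Real.pi / qPochInf q q * ((-1) ^ j * (q ^ tri (j - 1) + q ^ tri j)) := by
  have h1 := tendsto_integral_qProdFin hq (2 * j)
  simp only [integral_qProdFin_even hq] at h1
  refine tendsto_nhds_unique h1 ?_
  have ha : ∀ i : ℤ, Tendsto (fun N : ℕ => rhoInt q (N + i)) atTop (𝓝 (qPochInf q q)⁻¹) := by
    intro i
    have h2 : Tendsto (fun N : ℕ => ((N : ℤ) + i).toNat) atTop atTop := by
      rw [tendsto_atTop]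
      intro b
      filter_upwards [eventually_ge_atTop (b + i.natAbs)] with N hN
      omega
    refine ((tendsto_rho hq).comp h2).congr' ?_
    filter_upwards [eventually_ge_atTop i.natAbs] with N hN
    rw [rhoInt, if_pos (by omega)]
    rfl
  have hb : Tendsto (fourierConst q) atTop (𝓝 (qPochInf q q)) := by
    have h3 : Tendsto (fun N => qFact q (2 * N)) atTop (𝓝 (qPochInf q q)) :=
      (tendsto_qFact hq).comp (tendsto_id.const_mul_atTop' (by norm_num))
    have h4 : Tendsto (fun N => 1 + q ^ N) atTop (𝓝 (1 + 0)) :=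
      (tendsto_pow_atTop_nhds_zero_of_abs_lt_one hq).const_add 1
    have := h3.div h4 (by norm_num)
    rw [add_zero, div_one] at this
    exact this
  have h0 := qPochInf_ne_zero hq
  have hlim := ((hb.mul (((ha j).const_mul (q ^ tri (j - 1) + q ^ tri j)).mul (ha (-j)))).const_mul
    (Real.pi * (-1) ^ j))
  have e : Real.pi / qPochInf q q * ((-1) ^ j * (q ^ tri (j - 1) + q ^ tri j)) =
      Real.pi * (-1) ^ j * (qPochInf q q * ((q ^ tri (j - 1) + q ^ tri j) *
        (qPochInf q q)⁻¹ * (qPochInf q q)⁻¹)) := by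
    generalize (-1 : ℝ) ^ j = z
    field_simp
  rw [e]
  exact hlim

theorem aestronglyMeasurable_hermiteWeight (hq : |q| < 1) :
    AEStronglyMeasurable (hermiteWeight q) arc :=
  (measurable_qProd hq (by simp) 2).aestronglyMeasurable

theorem abs_hermiteWeight_le (hq : |q| < 1) (θ : ℝ) :
    |hermiteWeight q θ| ≤ Real.exp (3 * (1 - |q|)⁻¹) := by
  rw [hermiteWeight, abs_of_nonneg (qProd_nonneg hq (Real.abs_cos_le_one _) (by simp))]
  exact qProd_le hq (Real.abs_cos_le_one _) (by simp)

theorem integrable_hermiteWeight_mul (hq : |q| < 1) {f : ℝ → ℝ} (hf : Continuous f) :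
    Integrable (fun θ => hermiteWeight q θ * f θ) arc :=
  (integrable_arc_of_continuous hf).bdd_mul (aestronglyMeasurable_hermiteWeight hq)
    (ae_of_all _ fun θ => abs_hermiteWeight_le hq θ)

theorem continuous_hermite (q : ℝ) (n : ℕ) : Continuous fun θ => hermite q θ n := by
  unfold hermite; fun_prop

/-- The total mass of the weight of the continuous `q`-Hermite polynomials. -/
theorem integral_hermiteWeight (hq : |q| < 1) :
    ∫ θ, hermiteWeight q θ ∂arc = 2 * Real.pi / qPochInf q q := by
  have := integral_hermiteWeight_even hq 0
  have t1 : tri (-1) = 0 := rfl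
  simp [t1] at this
  rw [this]; ring

/-- For odd `n` only odd frequencies occur. For `n = 2p` the Fourier coefficients turn the integral
into a multiple of `altSum q (2p) p + altSum q (2p) (p-1)`, and both summands vanish. -/
theorem integral_hermiteWeight_mul_hermite (hq : |q| < 1) {n : ℕ} (hn : n ≠ 0) :
    ∫ θ, hermiteWeight q θ * hermite q θ n ∂arc = 0 := by
  have e : ∫ θ, hermiteWeight q θ * hermite q θ n ∂arc =
      ∑ x ∈ Finset.HasAntidiagonal.antidiagonal n, rho q x.1 * rho q x.2 *
        ∫ θ, hermiteWeight q θ * Real.cos (((x.1 : ℤ) - x.2 : ℤ) * θ) ∂arc := by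
    simp only [← integral_const_mul]
    rw [← integral_finsetSum]
    · congr 1
      ext θ
      rw [hermite, Finset.mul_sum]
      refine Finset.sum_congr rfl fun x _ => ?_
      push_cast
      ring
    · exact fun x _ => (integrable_hermiteWeight_mul hq (by fun_prop)).const_mul _
  rw [e]
  obtain ⟨p, rfl | rfl⟩ := Nat.even_or_odd' n
  · have hp : p ≠ 0 := by omega
    obtain ⟨r, rfl⟩ := Nat.exists_eq_succ_of_ne_zero hp
    have h1 := altSum_eq_zero hq (show r + 1 < 2 * (r + 1) by omega)
    have h2 := altSum_eq_zero hq (show r < 2 * (r + 1) by omega)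
    have : (Real.pi / qPochInf q q * (-1) ^ (r + 1)) * (altSum q (2 * (r + 1)) (r + 1) +
        altSum q (2 * (r + 1)) r) = 0 := by rw [h1, h2]; ring
    rw [← this, altSum, altSum, ← Finset.sum_add_distrib, Finset.mul_sum]
    refine Finset.sum_congr rfl fun x hx => ?_
    rw [Finset.HasAntidiagonal.mem_antidiagonal] at hx
    have hx' : (x.1 : ℤ) - x.2 = 2 * ((x.1 : ℤ) - (r + 1)) := by omega
    rw [hx', integral_hermiteWeight_even hq]
    have hs : (-1 : ℝ) ^ ((x.1 : ℤ) - (r + 1)) = (-1) ^ (r + 1) * (-1) ^ x.1 := by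
      rw [zpow_sub₀ (by norm_num), div_eq_mul_inv, ← inv_zpow, mul_comm]
      norm_num
      norm_cast
    rw [hs, show (x.1 : ℤ) - (r + 1) = (x.1 : ℤ) - r - 1 by ring,
      show (x.1 : ℤ) - ((r + 1 : ℕ) : ℤ) - 1 = (x.1 : ℤ) - r - 1 - 1 by push_cast; ring]
    ring
  · refine Finset.sum_eq_zero fun x hx => ?_
    rw [Finset.HasAntidiagonal.mem_antidiagonal] at hx
    rw [show (x.1 : ℤ) - x.2 = 2 * (x.1 - p - 1) + 1 by omega, integral_hermiteWeight_odd hq,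
      mul_zero]

end FourierIntegrals

/-! ### Orthogonality and generating function of the `q`-Hermite polynomials. -/

section GeneratingFunction

variable {q : ℝ}

/-- The predecessor in the sequence `hermite`, starting with zero. -/
noncomputable def hermitePred (q θ : ℝ) : ℕ → ℝ
  | 0 => 0
  | n + 1 => hermite q θ n

theorem two_cos_mul_hermite (hq : |q| < 1) (θ : ℝ) (n : ℕ) :
    2 * Real.cos θ * hermite q θ n =
      (1 - q ^ (n + 1)) * hermite q θ (n + 1) + hermitePred q θ n := by
  cases n with
  | zero => simpa [hermitePred, hermite_zero] using (hermite_one hq θ).symm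
  | succ n => rw [hermite_succ_succ hq, hermitePred]; ring

theorem continuous_hermitePred (q : ℝ) (n : ℕ) : Continuous fun θ => hermitePred q θ n := by
  cases n with
  | zero => exact continuous_const
  | succ n => exact continuous_hermite q n

/-- Multiplication by `2 cos θ` is symmetric for the weight; expand it on either factor by the
three-term recurrence. -/
theorem integral_hermite_exchange (hq : |q| < 1) (m n : ℕ) :
    (1 - q ^ (m + 1)) * ∫ θ, hermiteWeight q θ * (hermite q θ (m + 1) * hermite q θ n) ∂arc +
        ∫ θ, hermiteWeight q θ * (hermitePred q θ m * hermite q θ n) ∂arc =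
      (1 - q ^ (n + 1)) * ∫ θ, hermiteWeight q θ * (hermite q θ m * hermite q θ (n + 1)) ∂arc +
        ∫ θ, hermiteWeight q θ * (hermite q θ m * hermitePred q θ n) ∂arc := by
  have hc := continuous_hermite q
  have hc' := continuous_hermitePred q
  have hi : ∀ {f g : ℝ → ℝ}, Continuous f → Continuous g →
      Integrable (fun θ => hermiteWeight q θ * (f θ * g θ)) arc := fun hf hg =>
    integrable_hermiteWeight_mul hq (hf.mul hg)
  rw [← integral_const_mul, ← integral_const_mul,
    ← integral_add ((hi (hc _) (hc _)).const_mul _) (hi (hc' _) (hc _)),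
    ← integral_add ((hi (hc _) (hc _)).const_mul _) (hi (hc _) (hc' _))]
  congr 1
  ext θ
  have h1 := two_cos_mul_hermite hq θ m
  have h2 := two_cos_mul_hermite hq θ n
  linear_combination hermiteWeight q θ * (hermite q θ m * h2 - hermite q θ n * h1)

/-- Orthogonality of the continuous `q`-Hermite polynomials. -/
theorem integral_hermite_mul_hermite (hq : |q| < 1) (m n : ℕ) :
    ∫ θ, hermiteWeight q θ * (hermite q θ m * hermite q θ n) ∂arc =
      if m = n then 2 * Real.pi / qPochInf q q * rho q n else 0 := by
  -- The exchange relation determines row `m + 1` from rows `m` and `m - 1`; the second conjunct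
  -- carries row `m - 1`.
  have main : ∀ m, (∀ n, ∫ θ, hermiteWeight q θ * (hermite q θ m * hermite q θ n) ∂arc =
      if m = n then 2 * Real.pi / qPochInf q q * rho q n else 0) ∧
      (∀ n, ∫ θ, hermiteWeight q θ * (hermitePred q θ m * hermite q θ n) ∂arc =
      if m = n + 1 then 2 * Real.pi / qPochInf q q * rho q n else 0) := by
    intro m
    induction m with
    | zero =>
      refine ⟨fun n => ?_, fun n => by simp [hermitePred]⟩
      simp only [hermite_zero, one_mul]
      split_ifs with h
      · subst h
        simp [hermite_zero, integral_hermiteWeight hq]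
      · exact integral_hermiteWeight_mul_hermite hq (Ne.symm h)
    | succ m ih =>
      refine ⟨fun n => ?_, fun n => by simpa [hermitePred] using ih.1 n⟩
      have key := integral_hermite_exchange hq m n
      have hlast : ∫ θ, hermiteWeight q θ * (hermite q θ m * hermitePred q θ n) ∂arc =
          if m + 1 = n then 2 * Real.pi / qPochInf q q * rho q m else 0 := by
        cases n with
        | zero => simp [hermitePred]
        | succ n =>
          simp only [hermitePred, ih.1 n, Nat.add_right_cancel_iff]
          split_ifs with h
          · rw [h]
          · rfl
      rw [ih.2, ih.1, hlast] at key
      have hpos := (one_sub_pow_pos hq (Nat.succ_ne_zero m)).ne'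
      simp only [Nat.succ_eq_add_one] at hpos
      refine mul_left_cancel₀ hpos ?_
      by_cases h1 : m = n + 1
      · subst h1
        have := rho_succ hq n
        rw [if_pos rfl, if_pos rfl, if_neg (by omega)] at key
        rw [if_neg (by omega)]
        linear_combination key + 2 * Real.pi / qPochInf q q * this
      · rw [if_neg h1, if_neg h1] at key
        by_cases h2 : m + 1 = n
        · subst h2
          have := rho_succ hq m
          rw [if_pos rfl] at key
          rw [if_pos rfl]
          linear_combination key - 2 * Real.pi / qPochInf q q * this
        · rw [if_neg h2] at key
          rw [if_neg h2]
          linear_combination key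
  exact (main m).1 n

theorem exists_hermite_bound (hq : |q| < 1) :
    ∃ K, 0 < K ∧ ∀ θ n, |hermite q θ n| ≤ K * ((n : ℝ) + 1) := by
  obtain ⟨K, hK, h⟩ := exists_rho_le hq
  refine ⟨K ^ 2, by positivity, fun θ n => ?_⟩
  calc |hermite q θ n| ≤ ∑ x ∈ Finset.HasAntidiagonal.antidiagonal n,
        |rho q x.1 * rho q x.2 * Real.cos (((x.1 : ℝ) - x.2) * θ)| := Finset.abs_sum_le_sum_abs _ _
    _ ≤ ∑ x ∈ Finset.HasAntidiagonal.antidiagonal n, K ^ 2 := by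
        refine Finset.sum_le_sum fun x _ => ?_
        rw [abs_mul, abs_mul, abs_of_pos (rho_pos hq _), abs_of_pos (rho_pos hq _), sq]
        have h1 := (rho_pos hq x.1).le
        have h2 := (rho_pos hq x.2).le
        calc rho q x.1 * rho q x.2 * |Real.cos (((x.1 : ℝ) - x.2) * θ)|
            ≤ rho q x.1 * rho q x.2 * 1 := by gcongr; exact Real.abs_cos_le_one _
          _ ≤ K * K := by
            rw [mul_one]; gcongr
            · exact h _
            · exact h _
    _ = K ^ 2 * ((n : ℝ) + 1) := by
        rw [Finset.sum_const, Finset.Nat.card_antidiagonal, nsmul_eq_mul]; push_cast; ring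

theorem summable_succ_mul_pow {r : ℝ} (h0 : 0 ≤ r) (hr : r < 1) (K : ℝ) :
    Summable fun n : ℕ => K * ((n : ℝ) + 1) * r ^ n := by
  have hn : ‖r‖ < 1 := by rwa [Real.norm_eq_abs, abs_of_nonneg h0]
  have h1 := summable_pow_mul_geometric_of_norm_lt_one 1 hn
  have h2 := summable_geometric_of_norm_lt_one hn
  refine ((h1.add h2).mul_left K).congr fun n => ?_
  ring

/-- The generating function of the continuous `q`-Hermite polynomials. -/
noncomputable def hermiteGen (q θ s : ℝ) : ℝ := ∑' n, hermite q θ n * s ^ n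

theorem norm_hermite_mul_pow_le {K r s : ℝ} (hK : 0 < K)
    (h : ∀ θ n, |hermite q θ n| ≤ K * ((n : ℝ) + 1)) (hs : |s| ≤ r) (θ : ℝ) (n : ℕ) :
    ‖hermite q θ n * s ^ n‖ ≤ K * ((n : ℝ) + 1) * r ^ n := by
  rw [norm_mul, norm_pow, Real.norm_eq_abs, Real.norm_eq_abs]
  gcongr
  exact h θ n

theorem summable_hermite (hq : |q| < 1) (θ : ℝ) {s : ℝ} (hs : |s| < 1) :
    Summable fun n => hermite q θ n * s ^ n := by
  obtain ⟨K, hK, h⟩ := exists_hermite_bound hq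
  exact Summable.of_norm_bounded (summable_succ_mul_pow (abs_nonneg s) hs K)
    fun n => norm_hermite_mul_pow_le hK h le_rfl θ n

theorem exists_hermiteGen_bound (hq : |q| < 1) {r : ℝ} (h0 : 0 ≤ r) (hr : r < 1) :
    ∃ K, 0 < K ∧ ∀ θ s, |s| ≤ r → |hermiteGen q θ s| ≤ K := by
  obtain ⟨K, hK, h⟩ := exists_hermite_bound hq
  refine ⟨∑' n : ℕ, K * ((n : ℝ) + 1) * r ^ n + 1, ?_, fun θ s hs => ?_⟩
  · have : 0 ≤ ∑' n : ℕ, K * ((n : ℝ) + 1) * r ^ n := tsum_nonneg fun n => by positivity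
    linarith
  · have := tsum_of_norm_bounded (summable_succ_mul_pow h0 hr K).hasSum
      fun n => norm_hermite_mul_pow_le hK h hs θ n
    rw [Real.norm_eq_abs] at this
    rw [hermiteGen]
    linarith

theorem continuous_hermiteGen (hq : |q| < 1) {s : ℝ} (hs : |s| < 1) :
    Continuous fun θ => hermiteGen q θ s := by
  obtain ⟨K, hK, h⟩ := exists_hermite_bound hq
  exact continuous_tsum (fun n => (continuous_hermite q n).mul continuous_const)
    (summable_succ_mul_pow (abs_nonneg s) hs K) fun n θ => norm_hermite_mul_pow_le hK h le_rfl θ n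

theorem continuousOn_hermiteGen (hq : |q| < 1) (θ : ℝ) {r : ℝ} (h0 : 0 ≤ r) (hr : r < 1) :
    ContinuousOn (fun s => hermiteGen q θ s) {s | |s| ≤ r} := by
  obtain ⟨K, hK, h⟩ := exists_hermite_bound hq
  exact continuousOn_tsum (fun n => (continuous_const.mul (continuous_pow n)).continuousOn)
    (summable_succ_mul_pow h0 hr K) fun n s hs => norm_hermite_mul_pow_le hK h hs θ n

theorem hermiteGen_zero (q θ : ℝ) : hermiteGen q θ 0 = 1 := by
  rw [hermiteGen, tsum_eq_single 0 fun n hn => by simp [hn]]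
  simp [hermite_zero]

theorem abs_mul_lt_one (hq : |q| < 1) {s : ℝ} (hs : |s| ≤ 1) : |s * q| < 1 := by
  rw [abs_mul]
  exact (mul_le_of_le_one_left (abs_nonneg q) hs).trans_lt hq

theorem hermiteGen_mul (hq : |q| < 1) (θ : ℝ) {s : ℝ} (hs : |s| < 1) :
    (1 - 2 * Real.cos θ * s + s ^ 2) * hermiteGen q θ s = hermiteGen q θ (s * q) := by
  have hsum := summable_hermite hq θ hs
  have hsumq := summable_hermite hq θ (abs_mul_lt_one hq hs.le)
  have hpred : HasSum (fun n => hermitePred q θ n * s ^ n) (s * hermiteGen q θ s) := by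
    have h1 : HasSum (fun n => hermitePred q θ (n + 1) * s ^ (n + 1)) (s * hermiteGen q θ s) := by
      refine (hsum.hasSum.mul_left s).congr_fun fun n => ?_
      rw [hermitePred]; ring
    have := (hasSum_nat_add_iff (f := fun n => hermitePred q θ n * s ^ n) 1).1 h1
    simpa [hermitePred] using this
  have h2 : HasSum (fun n => (1 - q ^ n) * hermite q θ n * s ^ n)
      (hermiteGen q θ s - hermiteGen q θ (s * q)) := by
    refine (hsum.hasSum.sub hsumq.hasSum).congr_fun fun n => ?_
    rw [mul_pow]; ring
  have h3 : HasSum (fun n => (1 - q ^ (n + 1)) * hermite q θ (n + 1) * s ^ (n + 1))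
      (2 * Real.cos θ * s * hermiteGen q θ s - s * (s * hermiteGen q θ s)) := by
    refine ((hsum.hasSum.mul_left (2 * Real.cos θ * s)).sub (hpred.mul_left s)).congr_fun
      fun n => ?_
    have := two_cos_mul_hermite hq θ n
    rw [pow_succ]
    linear_combination -(s ^ n * s) * this
  have h4 := (hasSum_nat_add_iff (f := fun n => (1 - q ^ n) * hermite q θ n * s ^ n) 1).1 h3
  have h5 := h2.unique h4
  simp only [Finset.range_one, Finset.sum_singleton, pow_zero, sub_self, zero_mul, add_zero] at h5
  linear_combination h5

theorem qProdFin_mul_hermiteGen (hq : |q| < 1) (θ : ℝ) {s : ℝ} (hs : |s| < 1) (N : ℕ) :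
    qProdFin q (Real.cos θ) s N * hermiteGen q θ s = hermiteGen q θ (s * q ^ N) := by
  induction N generalizing s with
  | zero => simp [qProdFin]
  | succ N ih =>
    rw [qProdFin_succ', mul_right_comm, hermiteGen_mul hq θ hs, mul_comm,
      ih (abs_mul_lt_one hq hs.le), pow_succ']
    congr 1; ring

/-- Iterating the functional equation replaces `s` by `s q^N`, which tends to `0`, where the
generating function is continuous with value 1. -/
theorem qProd_mul_hermiteGen (hq : |q| < 1) (θ : ℝ) {s : ℝ} (hs : |s| < 1) :
    qProd q (Real.cos θ) s * hermiteGen q θ s = 1 := by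
  have h1 := (tendsto_qProdFin hq (Real.abs_cos_le_one θ) hs.le).mul_const (hermiteGen q θ s)
  simp only [qProdFin_mul_hermiteGen hq θ hs] at h1
  refine tendsto_nhds_unique h1 ?_
  rw [← hermiteGen_zero q θ]
  have hc := continuousOn_hermiteGen hq θ (abs_nonneg s) hs 0 (by simp)
  refine hc.tendsto.comp (tendsto_nhdsWithin_iff.2 ⟨?_, Eventually.of_forall fun N => ?_⟩)
  · simpa using (tendsto_pow_atTop_nhds_zero_of_abs_lt_one hq).const_mul s
  · change |s * q ^ N| ≤ |s|
    rw [abs_mul, abs_pow]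
    exact mul_le_of_le_one_right (abs_nonneg s) (pow_le_one₀ (abs_nonneg q) hq.le)

/-- Splitting off one factor moves the argument of the series to `s q`, inside the disc of
convergence even when `|s| = 1`. -/
theorem inv_qProd_eq (hq : |q| < 1) (θ : ℝ) {s : ℝ} (hs : |s| ≤ 1) :
    (qProd q (Real.cos θ) s)⁻¹ =
      hermiteGen q θ (s * q) / (1 - 2 * Real.cos θ * s + s ^ 2) := by
  rw [qProd_eq_mul hq (Real.abs_cos_le_one θ) hs, mul_inv, div_eq_inv_mul,
    eq_inv_of_mul_eq_one_right (qProd_mul_hermiteGen hq θ (abs_mul_lt_one hq hs))]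

theorem inv_qProd_eq_of_lt (hq : |q| < 1) (θ : ℝ) {s : ℝ} (hs : |s| < 1) :
    (qProd q (Real.cos θ) s)⁻¹ = hermiteGen q θ s :=
  (eq_inv_of_mul_eq_one_right (qProd_mul_hermiteGen hq θ hs)).symm

/-! ### The Euler series -/

/-- Euler's series `∑ x ^ n / (q; q)_n`. -/
noncomputable def eulerSeries (q x : ℝ) : ℝ := ∑' n, rho q n * x ^ n

theorem exists_norm_rho_mul_pow_le (hq : |q| < 1) {r : ℝ} (h0 : 0 ≤ r) (hr : r < 1) :
    ∃ u : ℕ → ℝ, Summable u ∧ ∀ x, |x| ≤ r → ∀ n, ‖rho q n * x ^ n‖ ≤ u n := by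
  obtain ⟨K, hK, h⟩ := exists_rho_le hq
  refine ⟨fun n => K * r ^ n, (summable_geometric_of_lt_one h0 hr).mul_left K, fun x hx n => ?_⟩
  rw [norm_mul, norm_pow, Real.norm_eq_abs, Real.norm_eq_abs, abs_of_pos (rho_pos hq n)]
  exact mul_le_mul (h n) (pow_le_pow_left₀ (abs_nonneg x) hx n) (by positivity) hK.le

theorem summable_rho (hq : |q| < 1) {x : ℝ} (hx : |x| < 1) : Summable fun n => rho q n * x ^ n := by
  obtain ⟨u, hu, h⟩ := exists_norm_rho_mul_pow_le hq (abs_nonneg x) hx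
  exact Summable.of_norm_bounded hu (h x le_rfl)

theorem continuousOn_eulerSeries (hq : |q| < 1) {r : ℝ} (h0 : 0 ≤ r) (hr : r < 1) :
    ContinuousOn (eulerSeries q) {x | |x| ≤ r} := by
  obtain ⟨u, hu, h⟩ := exists_norm_rho_mul_pow_le hq h0 hr
  exact continuousOn_tsum (fun n => (continuous_const.mul (continuous_pow n)).continuousOn) hu
    fun n x hx => h x hx n

theorem eulerSeries_mul (hq : |q| < 1) {x : ℝ} (hx : |x| < 1) :
    (1 - x) * eulerSeries q x = eulerSeries q (x * q) := by
  have hsum := summable_rho hq hx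
  have hsumq := summable_rho hq (abs_mul_lt_one hq hx.le)
  have h2 : HasSum (fun n => (1 - q ^ n) * rho q n * x ^ n)
      (eulerSeries q x - eulerSeries q (x * q)) := by
    refine (hsum.hasSum.sub hsumq.hasSum).congr_fun fun n => ?_
    rw [mul_pow]; ring
  have h3 : HasSum (fun n => (1 - q ^ (n + 1)) * rho q (n + 1) * x ^ (n + 1))
      (x * eulerSeries q x) := by
    refine (hsum.hasSum.mul_left x).congr_fun fun n => ?_
    rw [rho_succ hq, pow_succ]; ring
  have h4 := (hasSum_nat_add_iff (f := fun n => (1 - q ^ n) * rho q n * x ^ n) 1).1 h3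
  have h5 := h2.unique h4
  simp only [Finset.range_one, Finset.sum_singleton, pow_zero, sub_self, zero_mul, add_zero] at h5
  linear_combination h5

theorem eulerSeries_zero (q : ℝ) : eulerSeries q 0 = 1 := by
  rw [eulerSeries, tsum_eq_single 0 fun n hn => by simp [hn]]
  simp

theorem qFact_mul_eulerSeries (hq : |q| < 1) (N : ℕ) :
    qFact q N * eulerSeries q q = eulerSeries q (q ^ (N + 1)) := by
  induction N with
  | zero => simp
  | succ N ih =>
    have : |q ^ (N + 1)| < 1 := by
      rw [abs_pow]; exact pow_lt_one₀ (abs_nonneg q) hq (Nat.succ_ne_zero N)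
    rw [qFact_succ, mul_right_comm, ih, mul_comm, eulerSeries_mul hq this, ← pow_succ]

/-- This value is what normalizes the functional, since the parameters used later satisfy `ab = q`.
-/
theorem eulerSeries_self (hq : |q| < 1) : eulerSeries q q = (qPochInf q q)⁻¹ := by
  have h1 := (tendsto_qFact hq).mul_const (eulerSeries q q)
  simp only [qFact_mul_eulerSeries hq] at h1
  have hc := continuousOn_eulerSeries hq (abs_nonneg q) hq 0 (by simp)
  have h2 : Tendsto (fun N => eulerSeries q (q ^ (N + 1))) atTop (𝓝 (eulerSeries q 0)) := by
    refine hc.tendsto.comp (tendsto_nhdsWithin_iff.2 ⟨?_, Eventually.of_forall fun N => ?_⟩)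
    · exact (tendsto_add_atTop_iff_nat 1).2 (tendsto_pow_atTop_nhds_zero_of_abs_lt_one hq)
    · change |q ^ (N + 1)| ≤ |q|
      rw [abs_pow, pow_succ]
      exact mul_le_of_le_one_left (abs_nonneg q) (pow_le_one₀ (abs_nonneg q) hq.le)
  rw [eulerSeries_zero] at h2
  exact eq_inv_of_mul_eq_one_right (tendsto_nhds_unique h1 h2)

end GeneratingFunction

/-! ### The Al-Salam–Chihara weight and its total mass. -/

section AlSalamChihara

variable {q : ℝ}

/-- The weight function of the Al-Salam–Chihara polynomials with parameters `a` and `b`. -/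
noncomputable def ascWeight (q a b θ : ℝ) : ℝ :=
  hermiteWeight q θ * ((qProd q (Real.cos θ) a)⁻¹ * (qProd q (Real.cos θ) b)⁻¹)

theorem ascWeight_comm (q a b θ : ℝ) : ascWeight q a b θ = ascWeight q b a θ := by
  rw [ascWeight, ascWeight, mul_comm (_)⁻¹]

theorem sin_sq_le_factor (θ s : ℝ) : Real.sin θ ^ 2 ≤ 1 - 2 * Real.cos θ * s + s ^ 2 := by
  have := Real.sin_sq_add_cos_sq θ
  nlinarith [sq_nonneg (s - Real.cos θ)]

theorem sq_le_factor (θ : ℝ) {s β : ℝ} (hs : |s| ≤ β) (hβ : β ≤ 1) :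
    (1 - β) ^ 2 ≤ 1 - 2 * Real.cos θ * s + s ^ 2 := by
  have h1 : Real.cos θ * s ≤ |s| := by
    calc Real.cos θ * s ≤ |Real.cos θ * s| := le_abs_self _
      _ = |Real.cos θ| * |s| := abs_mul _ _
      _ ≤ 1 * |s| := by gcongr; exact Real.abs_cos_le_one θ
      _ = |s| := one_mul _
  have h2 := sq_abs s
  nlinarith [abs_nonneg s]

theorem factor_pos {θ : ℝ} (hθ : θ ∈ Set.Ioo 0 Real.pi) (s : ℝ) :
    0 < 1 - 2 * Real.cos θ * s + s ^ 2 :=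
  (pow_pos (Real.sin_pos_of_pos_of_lt_pi hθ.1 hθ.2) 2).trans_le (sin_sq_le_factor θ s)

theorem hermiteWeight_eq (hq : |q| < 1) (θ : ℝ) :
    hermiteWeight q θ = 4 * Real.sin θ ^ 2 * qProd q (Real.cos (2 * θ)) q := by
  rw [hermiteWeight, qProd_eq_mul hq (Real.abs_cos_le_one _) (by simp), one_mul, Real.cos_two_mul,
    Real.sin_sq]
  ring

/-- When `|a| = 1` the reciprocal product may be singular at an end of the arc; the factor `sin² θ`
of the Hermite weight compensates. The bound is uniform in `a` and `b`, as needed for dominated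
convergence in the parameters. -/
theorem exists_ascWeight_bound (hq : |q| < 1) {β : ℝ} (hβ : β < 1) :
    ∃ K, ∀ a b θ, |a| ≤ 1 → |b| ≤ β → θ ∈ Set.Ioo 0 Real.pi → |ascWeight q a b θ| ≤ K := by
  obtain ⟨K, hK, h⟩ := exists_hermiteGen_bound hq (abs_nonneg q) hq
  refine ⟨4 * Real.exp (3 * (1 - |q|)⁻¹) * (K * (K / (1 - β) ^ 2)), fun a b θ ha hb hθ => ?_⟩
  have hsin := Real.sin_pos_of_pos_of_lt_pi hθ.1 hθ.2
  have hle : ∀ s, |s| ≤ 1 → |s * q| ≤ |q| := fun s hs => by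
    rw [abs_mul]; exact mul_le_of_le_one_left (abs_nonneg q) hs
  have hb1 : |b| ≤ 1 := hb.trans hβ.le
  have hβ2 : 0 < (1 - β) ^ 2 := pow_pos (by linarith) 2
  rw [ascWeight, hermiteWeight_eq hq, inv_qProd_eq hq θ ha, inv_qProd_eq hq θ hb1]
  have e : 4 * Real.sin θ ^ 2 * qProd q (Real.cos (2 * θ)) q *
      (hermiteGen q θ (a * q) / (1 - 2 * Real.cos θ * a + a ^ 2) *
        (hermiteGen q θ (b * q) / (1 - 2 * Real.cos θ * b + b ^ 2))) =
      4 * qProd q (Real.cos (2 * θ)) q *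
      (Real.sin θ ^ 2 / (1 - 2 * Real.cos θ * a + a ^ 2) * hermiteGen q θ (a * q) *
        (hermiteGen q θ (b * q) / (1 - 2 * Real.cos θ * b + b ^ 2))) := by ring
  rw [e, abs_mul, abs_mul, abs_mul, abs_mul, abs_div, abs_div,
    abs_of_nonneg (qProd_nonneg hq (Real.abs_cos_le_one _) hq.le), abs_of_pos (factor_pos hθ a),
    abs_of_pos (factor_pos hθ b), abs_of_pos (pow_pos hsin 2), abs_of_pos (by norm_num : (0:ℝ) < 4)]
  have h1 : Real.sin θ ^ 2 / (1 - 2 * Real.cos θ * a + a ^ 2) ≤ 1 :=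
    (div_le_one (factor_pos hθ a)).2 (sin_sq_le_factor θ a)
  have h2 : Real.sin θ ^ 2 / (1 - 2 * Real.cos θ * a + a ^ 2) * |hermiteGen q θ (a * q)| ≤ K :=
    (mul_le_of_le_one_left (abs_nonneg _) h1).trans (h θ _ (hle a ha))
  have h3 : |hermiteGen q θ (b * q)| / (1 - 2 * Real.cos θ * b + b ^ 2) ≤ K / (1 - β) ^ 2 :=
    div_le_div₀ hK.le (h θ _ (hle b hb1)) hβ2 (sq_le_factor θ hb hβ.le)
  have h4 := qProd_le hq (Real.abs_cos_le_one (2 * θ)) hq.le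
  have h5 : 0 ≤ |hermiteGen q θ (b * q)| / (1 - 2 * Real.cos θ * b + b ^ 2) :=
    div_nonneg (abs_nonneg _) (factor_pos hθ b).le
  have h6 : 0 ≤ Real.sin θ ^ 2 / (1 - 2 * Real.cos θ * a + a ^ 2) * |hermiteGen q θ (a * q)| :=
    mul_nonneg (div_nonneg (by positivity) (factor_pos hθ a).le) (abs_nonneg _)
  gcongr

theorem measurable_ascWeight (hq : |q| < 1) {a b : ℝ} (ha : |a| ≤ 1) (hb : |b| ≤ 1) :
    Measurable (ascWeight q a b) := by
  have h1 : Measurable (hermiteWeight q) := measurable_qProd hq (by simp) 2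
  have h2 := measurable_qProd hq ha 1
  have h3 := measurable_qProd hq hb 1
  simp only [one_mul] at h2 h3
  exact h1.mul (h2.inv.mul h3.inv)

theorem ae_arc {p : ℝ → Prop} (h : ∀ θ ∈ Set.Ioo 0 Real.pi, p θ) : ∀ᵐ θ ∂arc, p θ :=
  (ae_restrict_iff' measurableSet_Ioo).2 (ae_of_all _ h)

theorem integrable_ascWeight_mul (hq : |q| < 1) {a b : ℝ} (ha : |a| ≤ 1) (hb : |b| ≤ 1)
    (hab : |a| < 1 ∨ |b| < 1) {f : ℝ → ℝ} (hf : Continuous f) :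
    Integrable (fun θ => ascWeight q a b θ * f θ) arc := by
  have : ∃ K, ∀ θ ∈ Set.Ioo 0 Real.pi, |ascWeight q a b θ| ≤ K := by
    rcases hab with h | h
    · obtain ⟨K, hK⟩ := exists_ascWeight_bound hq h
      exact ⟨K, fun θ hθ => ascWeight_comm q a b θ ▸ hK b a θ hb le_rfl hθ⟩
    · obtain ⟨K, hK⟩ := exists_ascWeight_bound hq h
      exact ⟨K, fun θ hθ => hK a b θ ha le_rfl hθ⟩
  obtain ⟨K, hK⟩ := this
  exact (integrable_arc_of_continuous hf).bdd_mul
    (measurable_ascWeight hq ha hb).aestronglyMeasurable (ae_arc hK)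

theorem hasSum_integral_hermiteGen (hq : |q| < 1) {s : ℝ} (hs : |s| < 1) {f : ℝ → ℝ}
    (hf : Continuous f) :
    HasSum (fun n => s ^ n * ∫ θ, hermiteWeight q θ * (f θ * hermite q θ n) ∂arc)
      (∫ θ, hermiteWeight q θ * (f θ * hermiteGen q θ s) ∂arc) := by
  obtain ⟨K, hK, h⟩ := exists_hermite_bound hq
  obtain ⟨F, hF⟩ := (isCompact_Icc (a := (0 : ℝ)) (b := Real.pi)).exists_bound_of_continuousOn
    hf.continuousOn
  have hF0 : 0 ≤ F := (norm_nonneg _).trans (hF 0 ⟨le_rfl, Real.pi_pos.le⟩)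
  simp only [← integral_const_mul]
  have hsum := summable_succ_mul_pow (abs_nonneg s) hs K
  refine hasSum_integral_of_dominated_convergence
    (fun n _ => Real.exp (3 * (1 - |q|)⁻¹) * F * (K * ((n : ℝ) + 1) * |s| ^ n))
    (fun n => ?_) (fun n => ae_arc fun θ hθ => ?_) (ae_of_all _ fun _ => hsum.mul_left _)
    (integrable_const _) (ae_of_all _ fun θ => ?_)
  · exact ((integrable_hermiteWeight_mul hq
      (hf.mul (continuous_hermite q n))).const_mul _).aestronglyMeasurable
  · have e : s ^ n * (hermiteWeight q θ * (f θ * hermite q θ n)) =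
        hermiteWeight q θ * f θ * (hermite q θ n * s ^ n) := by ring
    rw [e, norm_mul, norm_mul]
    have h1 := norm_hermite_mul_pow_le hK h le_rfl (s := s) θ n
    have h2 := hF θ ⟨hθ.1.le, hθ.2.le⟩
    have h3 := abs_hermiteWeight_le hq θ
    rw [← Real.norm_eq_abs] at h3
    gcongr
  · have := ((summable_hermite hq θ hs).hasSum.mul_left (hermiteWeight q θ * f θ))
    rw [mul_assoc] at this
    refine this.congr_fun fun n => ?_
    ring

theorem integral_hermite_mul_hermiteGen (hq : |q| < 1) {s : ℝ} (hs : |s| < 1) (m : ℕ) :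
    ∫ θ, hermiteWeight q θ * (hermite q θ m * hermiteGen q θ s) ∂arc =
      2 * Real.pi / qPochInf q q * rho q m * s ^ m := by
  refine (hasSum_integral_hermiteGen hq hs (continuous_hermite q m)).unique ?_
  simp only [integral_hermite_mul_hermite hq]
  convert hasSum_ite_eq m (2 * Real.pi / qPochInf q q * rho q m * s ^ m) using 2 with n
  by_cases h : m = n
  · subst h; simp; ring
  · rw [if_neg h, if_neg (Ne.symm h), mul_zero]

/-- Expand both generating functions; orthogonality leaves the diagonal `∑ (ab)^n / (q;q)_n`. -/
theorem integral_hermiteGen_mul_hermiteGen (hq : |q| < 1) {a b : ℝ} (ha : |a| < 1) (hb : |b| < 1) :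
    ∫ θ, hermiteWeight q θ * (hermiteGen q θ b * hermiteGen q θ a) ∂arc =
      2 * Real.pi / qPochInf q q * eulerSeries q (a * b) := by
  have hab : |a * b| < 1 := abs_mul_lt_one hb ha.le
  refine (hasSum_integral_hermiteGen hq ha (continuous_hermiteGen hq hb)).unique ?_
  refine ((summable_rho hq hab).hasSum.mul_left _).congr_fun fun n => ?_
  have := integral_hermite_mul_hermiteGen hq hb n
  simp only [mul_comm (hermite q _ n)] at this
  rw [this, mul_pow]
  ring

theorem integral_ascWeight_of_lt (hq : |q| < 1) {a b : ℝ} (ha : |a| < 1) (hb : |b| < 1) :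
    ∫ θ, ascWeight q a b θ ∂arc = 2 * Real.pi / qPochInf q q * eulerSeries q (a * b) := by
  rw [← integral_hermiteGen_mul_hermiteGen hq ha hb]
  congr 1
  ext θ
  rw [ascWeight, inv_qProd_eq_of_lt hq θ ha, inv_qProd_eq_of_lt hq θ hb,
    mul_comm (hermiteGen q θ a)]

theorem tendsto_inv_qProd (hq : |q| < 1) {a : ℝ} (ha : |a| ≤ 1) {θ : ℝ}
    (hθ : θ ∈ Set.Ioo 0 Real.pi) :
    Tendsto (fun t => (qProd q (Real.cos θ) (t * a))⁻¹) (𝓝[<] 1)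
      (𝓝 (qProd q (Real.cos θ) a)⁻¹) := by
  have hev : ∀ᶠ t : ℝ in 𝓝[<] 1, |t * a| ≤ 1 ∧ |t * a * q| ≤ |q| := by
    filter_upwards [Ioo_mem_nhdsLT (show (0 : ℝ) < 1 by norm_num)] with t ht
    have : |t * a| ≤ 1 := by
      rw [abs_mul, abs_of_pos ht.1]
      exact mul_le_one₀ ht.2.le (abs_nonneg a) ha
    refine ⟨this, ?_⟩
    rw [abs_mul]
    exact mul_le_of_le_one_left (abs_nonneg q) this
  have hid : Tendsto (fun t : ℝ => t * a) (𝓝[<] 1) (𝓝 a) := by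
    have : Tendsto (fun t : ℝ => t * a) (𝓝 1) (𝓝 (1 * a)) := tendsto_id.mul_const a
    rw [one_mul] at this
    exact this.mono_left nhdsWithin_le_nhds
  rw [inv_qProd_eq hq θ ha]
  have haq : |a * q| ≤ |q| := by
    rw [abs_mul]; exact mul_le_of_le_one_left (abs_nonneg q) ha
  have h1 : Tendsto (fun t => hermiteGen q θ (t * a * q)) (𝓝[<] 1)
      (𝓝 (hermiteGen q θ (a * q))) :=
    (continuousOn_hermiteGen hq θ (abs_nonneg q) hq (a * q) haq).tendsto.comp
      (tendsto_nhdsWithin_iff.2 ⟨hid.mul_const q, hev.mono fun t ht => ht.2⟩)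
  have h2 : Tendsto (fun t => 1 - 2 * Real.cos θ * (t * a) + (t * a) ^ 2) (𝓝[<] 1)
      (𝓝 (1 - 2 * Real.cos θ * a + a ^ 2)) :=
    ((hid.const_mul (2 * Real.cos θ)).const_sub 1).add (hid.pow 2)
  refine (h1.div h2 (factor_pos hθ a).ne').congr' ?_
  filter_upwards [hev] with t ht
  exact (inv_qProd_eq hq θ ht.1).symm

/-- The boundary case `|a| = 1` is the limit `t → 1⁻` of the parameters `ta`, `tb`. -/
theorem integral_ascWeight_aux (hq : |q| < 1) {a b : ℝ} (ha : |a| ≤ 1) (hb : |b| < 1) :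
    ∫ θ, ascWeight q a b θ ∂arc = 2 * Real.pi / qPochInf q q * eulerSeries q (a * b) := by
  obtain ⟨K, hK⟩ := exists_ascWeight_bound hq hb
  have hlt : ∀ {t c : ℝ}, t ∈ Set.Ioo (0 : ℝ) 1 → |c| ≤ 1 → |t * c| < 1 ∧ |t * c| ≤ |c| := by
    intro t c ht hc
    rw [abs_mul, abs_of_pos ht.1]
    exact ⟨(mul_le_of_le_one_right ht.1.le hc).trans_lt ht.2,
      mul_le_of_le_one_left (abs_nonneg c) ht.2.le⟩
  have hIoo := Ioo_mem_nhdsLT (show (0 : ℝ) < 1 by norm_num)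
  have h1 : Tendsto (fun t => ∫ θ, ascWeight q (t * a) (t * b) θ ∂arc) (𝓝[<] 1)
      (𝓝 (∫ θ, ascWeight q a b θ ∂arc)) := by
    refine tendsto_integral_filter_of_dominated_convergence (fun _ => K) ?_ ?_
      (integrable_const K) (ae_arc fun θ hθ => ?_)
    · filter_upwards [hIoo] with t ht
      exact (measurable_ascWeight hq (hlt ht ha).1.le (hlt ht hb.le).1.le).aestronglyMeasurable
    · filter_upwards [hIoo] with t ht
      exact ae_arc fun θ hθ => hK _ _ θ (hlt ht ha).1.le (hlt ht hb.le).2 hθ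
    · exact ((tendsto_inv_qProd hq ha hθ).mul (tendsto_inv_qProd hq hb.le hθ)).const_mul _
  have hab : |a * b| < 1 := abs_mul_lt_one hb ha
  have h2 : Tendsto (fun t => 2 * Real.pi / qPochInf q q * eulerSeries q (t * a * (t * b))) (𝓝[<] 1)
      (𝓝 (2 * Real.pi / qPochInf q q * eulerSeries q (a * b))) := by
    refine Tendsto.const_mul _ ((continuousOn_eulerSeries hq (abs_nonneg _) hab (a * b)
      (show |a * b| ≤ |a * b| from le_rfl)).tendsto.comp (tendsto_nhdsWithin_iff.2 ⟨?_, ?_⟩))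
    · have : Tendsto (fun t : ℝ => t * a * (t * b)) (𝓝 1) (𝓝 (1 * a * (1 * b))) :=
        (tendsto_id.mul_const a).mul (tendsto_id.mul_const b)
      rw [one_mul, one_mul] at this
      exact this.mono_left nhdsWithin_le_nhds
    · filter_upwards [hIoo] with t ht
      rw [abs_mul, abs_mul a b]
      exact mul_le_mul (hlt ht ha).2 (hlt ht hb.le).2 (abs_nonneg _) (abs_nonneg _)
  refine tendsto_nhds_unique h1 (h2.congr' ?_)
  filter_upwards [hIoo] with t ht
  exact (integral_ascWeight_of_lt hq (hlt ht ha).1 (hlt ht hb.le).1).symm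

/-- The total mass of the weight of the Al-Salam–Chihara polynomials. -/
theorem integral_ascWeight (hq : |q| < 1) {a b : ℝ} (ha : |a| ≤ 1) (hb : |b| ≤ 1)
    (hab : |a| < 1 ∨ |b| < 1) :
    ∫ θ, ascWeight q a b θ ∂arc = 2 * Real.pi / qPochInf q q * eulerSeries q (a * b) := by
  rcases hab with h | h
  · simp only [ascWeight_comm q a b]
    rw [integral_ascWeight_aux hq hb h, mul_comm b]
  · exact integral_ascWeight_aux hq ha h

end AlSalamChihara

/-! ### Al-Salam–Chihara polynomials -/

section AlSalamChihara

/-- The Al-Salam–Chihara polynomials `Q_k(c; a, b | q)`. -/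
def ascPoly (q a b c : ℝ) : ℕ → ℝ
  | 0 => 1
  | 1 => 2 * c - (a + b)
  | k + 2 => (2 * c - (a + b) * q ^ (k + 1)) * ascPoly q a b c (k + 1) -
      (1 - q ^ (k + 1)) * (1 - a * b * q ^ k) * ascPoly q a b c k

theorem ascPoly_succ_succ (q a b c : ℝ) (k : ℕ) : ascPoly q a b c (k + 2) =
    (2 * c - (a + b) * q ^ (k + 1)) * ascPoly q a b c (k + 1) -
      (1 - q ^ (k + 1)) * (1 - a * b * q ^ k) * ascPoly q a b c k := by rw [ascPoly]

theorem ascPoly_comm (q a b c : ℝ) (k : ℕ) : ascPoly q a b c k = ascPoly q b a c k := by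
  induction k using Nat.twoStepInduction with
  | zero => rfl
  | one => rw [ascPoly, ascPoly, add_comm]
  | more k h0 h1 => rw [ascPoly_succ_succ, ascPoly_succ_succ, h0, h1, add_comm a, mul_comm a]

/-- A contiguous relation of Christoffel type: the quadratic in `a` on the left is the ratio of the
weights with parameters `aq` and `a`. -/
theorem factor_mul_ascPoly (q a b c : ℝ) (k : ℕ) :
    (1 - 2 * c * a + a ^ 2) * ascPoly q (a * q) b c k =
      -(a * ascPoly q a b c (k + 1)) + (1 - a * b * q ^ k) * ascPoly q a b c k := by
  induction k using Nat.twoStepInduction with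
  | zero => simp only [ascPoly]; ring
  | one => simp only [ascPoly]; ring
  | more k h0 h1 =>
    have e := ascPoly_succ_succ q (a * q) b c k
    have e1 := ascPoly_succ_succ q a b c k
    have e2 := ascPoly_succ_succ q a b c (k + 1)
    rw [e, e2]
    rw [e1] at h1 ⊢
    linear_combination (2 * c - (a * q + b) * q ^ (k + 1)) * h1 -
      (1 - q ^ (k + 1)) * (1 - a * q * b * q ^ k) * h0

theorem ascPoly_zero_zero {q : ℝ} (hq : |q| < 1) (θ : ℝ) (k : ℕ) :
    ascPoly q 0 0 (Real.cos θ) k = qFact q k * hermite q θ k := by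
  induction k using Nat.twoStepInduction with
  | zero => simp [ascPoly, hermite_zero]
  | one =>
    have := hermite_one hq θ
    rw [qFact_succ]
    simp only [ascPoly, qFact_zero, zero_add, pow_one, one_mul, this]
    ring
  | more k h0 h1 =>
    have f1 := qFact_succ q k
    have f2 : qFact q (k + 2) = _ := qFact_succ q (k + 1)
    have := hermite_succ_succ hq θ k
    rw [ascPoly_succ_succ, h0, h1, f2, f1]
    linear_combination -(qFact q k * (1 - q ^ (k + 1))) * this

theorem continuous_ascPoly (q a b : ℝ) (k : ℕ) :
    Continuous fun θ => ascPoly q a b (Real.cos θ) k := by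
  induction k using Nat.twoStepInduction with
  | zero => simp only [ascPoly]; fun_prop
  | one => simp only [ascPoly]; fun_prop
  | more k h0 h1 => simp only [ascPoly_succ_succ]; fun_prop

variable {q a b : ℝ}

theorem ascWeight_mul_right (hq : |q| < 1) (ha : |a| ≤ 1) {θ : ℝ} (hθ : θ ∈ Set.Ioo 0 Real.pi) :
    ascWeight q (a * q) b θ = (1 - 2 * Real.cos θ * a + a ^ 2) * ascWeight q a b θ := by
  have := (factor_pos hθ a).ne'
  rw [ascWeight, ascWeight, qProd_eq_mul hq (Real.abs_cos_le_one θ) ha, mul_inv]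
  generalize 1 - 2 * Real.cos θ * a + a ^ 2 = d at this
  field_simp

theorem integral_ascPoly_rec (hq : |q| < 1) (ha : |a| ≤ 1) (hb : |b| ≤ 1)
    (hab : |a| < 1 ∨ |b| < 1) (k : ℕ) :
    ∫ θ, ascWeight q (a * q) b θ * ascPoly q (a * q) b (Real.cos θ) k ∂arc =
      -(a * ∫ θ, ascWeight q a b θ * ascPoly q a b (Real.cos θ) (k + 1) ∂arc) +
        (1 - a * b * q ^ k) * ∫ θ, ascWeight q a b θ * ascPoly q a b (Real.cos θ) k ∂arc := by
  have hi := fun k => integrable_ascWeight_mul hq ha hb hab (continuous_ascPoly q a b k)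
  rw [← integral_const_mul, ← integral_const_mul, ← integral_neg,
    ← integral_add ((hi _).const_mul _).fun_neg ((hi _).const_mul _)]
  refine integral_congr_ae (ae_arc fun θ hθ => ?_)
  beta_reduce
  rw [ascWeight_mul_right hq ha hθ]
  linear_combination ascWeight q a b θ * factor_mul_ascPoly q a b (Real.cos θ) k

/-- The Al-Salam–Chihara polynomials of positive degree have integral zero. -/
theorem integral_ascPoly (hq : |q| < 1) (ha : |a| ≤ 1) (hb : |b| ≤ 1)
    (hab : |a| < 1 ∨ |b| < 1) (k : ℕ) :
    ∫ θ, ascWeight q a b θ * ascPoly q a b (Real.cos θ) (k + 1) ∂arc = 0 := by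
  induction k generalizing a b with
  | zero =>
    -- The masses for `a` and `aq` are related by `(1 - ab) E(ab) = E(abq)`, so the relation at `k =
    -- 0` reduces to `a * ∫ = 0`. If `a = 0`, exchange the parameters; if both vanish, this is the
    -- `q`-Hermite case.
    have main : ∀ {a b : ℝ}, |a| ≤ 1 → |b| ≤ 1 → (|a| < 1 ∨ |b| < 1) → a ≠ 0 →
        ∫ θ, ascWeight q a b θ * ascPoly q a b (Real.cos θ) (0 + 1) ∂arc = 0 := by
      intro a b ha hb hab h0
      have h1 := integral_ascPoly_rec hq ha hb hab 0
      have haq := abs_mul_lt_one hq ha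
      have hlt : |a * b| < 1 := by
        rcases hab with h | h
        · rw [mul_comm]; exact abs_mul_lt_one h hb
        · exact abs_mul_lt_one h ha
      simp only [ascPoly.eq_1, mul_one, pow_zero, integral_ascWeight hq ha hb hab,
        integral_ascWeight hq haq.le hb (Or.inl haq)] at h1
      have h2 := eulerSeries_mul hq hlt
      rw [show a * q * b = a * b * q by ring, ← h2] at h1
      refine (mul_eq_zero.1 (?_ : a * _ = 0)).resolve_left h0
      linear_combination h1
    by_cases h0 : a = 0
    · by_cases h0' : b = 0
      · subst h0 h0'
        have := integral_hermiteWeight_mul_hermite hq (show 0 + 1 ≠ 0 by omega)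
        simp only [ascPoly_zero_zero hq, ascWeight, qProd, zero_mul, mul_zero, sub_zero, ne_eq,
          OfNat.ofNat_ne_zero, not_false_eq_true, zero_pow, add_zero, tprod_one, inv_one, mul_one]
        simp only [mul_left_comm (hermiteWeight q _), integral_const_mul, this, mul_zero]
      · simp only [ascWeight_comm q a b, ascPoly_comm q a b]
        exact main hb ha hab.symm h0'
    · exact main ha hb hab h0
  | succ k ih =>
    -- The induction hypothesis applies to both `(a, b)` and `(aq, b)`, which again leaves `a * ∫ =
    -- 0`.
    have main : ∀ {a b : ℝ}, |a| ≤ 1 → |b| ≤ 1 → (|a| < 1 ∨ |b| < 1) → a ≠ 0 →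
        ∫ θ, ascWeight q a b θ * ascPoly q a b (Real.cos θ) (k + 1 + 1) ∂arc = 0 := by
      intro a b ha hb hab h0
      have h1 := integral_ascPoly_rec hq ha hb hab (k + 1)
      have haq := abs_mul_lt_one hq ha
      rw [ih ha hb hab, ih haq.le hb (Or.inl haq)] at h1
      refine (mul_eq_zero.1 (?_ : a * _ = 0)).resolve_left h0
      linear_combination h1
    by_cases h0 : a = 0
    · by_cases h0' : b = 0
      · subst h0 h0'
        have := integral_hermiteWeight_mul_hermite hq (show k + 1 + 1 ≠ 0 by omega)
        simp only [ascPoly_zero_zero hq, ascWeight, qProd, zero_mul, mul_zero, sub_zero, ne_eq,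
          OfNat.ofNat_ne_zero, not_false_eq_true, zero_pow, add_zero, tprod_one, inv_one, mul_one]
        simp only [mul_left_comm (hermiteWeight q _), integral_const_mul, this, mul_zero]
      · simp only [ascWeight_comm q a b, ascPoly_comm q a b]
        exact main hb ha hab.symm h0'
    · exact main ha hb hab h0

end AlSalamChihara

/-! ### The explicit moment functional -/

section Moment

variable {y q : ℝ}

/-- The parametrization of the support by an angle. -/
noncomputable def supportMap (y q θ : ℝ) : ℝ := (y + 1 - 2 * √y * Real.cos θ) / (1 - q)

theorem v₂_supportMap (hq : q < 1) (hy : 0 < y) (θ : ℝ) :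
    v₂ y q (supportMap y q θ) = Real.cos θ := by
  have h1 : 1 - q ≠ 0 := by linarith
  have h2 : √y ≠ 0 := (Real.sqrt_pos.2 hy).ne'
  rw [v₂, supportMap]
  field_simp
  ring

theorem u₂_supportMap (hq : q < 1) (hy : 0 < y) (θ : ℝ) :
    u₂ y q (supportMap y q θ) = Real.cos (2 * θ) := by
  have h1 : 1 - q ≠ 0 := by linarith
  have h3 := Real.sq_sqrt hy.le
  rw [u₂, supportMap, Real.cos_two_mul]
  field_simp
  linear_combination 4 * Real.cos θ ^ 2 * h3

theorem image_supportMap (hq : q < 1) (hy : 0 < y) :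
    Set.image (supportMap y q) (Set.Ioo 0 Real.pi) = Set.Ioo (Bminus y q) (Bplus y q) := by
  have h1 : 0 < 1 - q := by linarith
  have h2 := Real.sqrt_pos.2 hy
  have h3 := Real.sq_sqrt hy.le
  ext x
  simp only [Set.mem_image, Set.mem_Ioo, Bminus, Bplus, div_lt_iff₀ h1, lt_div_iff₀ h1]
  constructor
  · rintro ⟨θ, hθ, rfl⟩
    rw [supportMap, div_mul_cancel₀ _ h1.ne']
    have h4 : Real.cos θ < 1 := by
      rw [← Real.cos_zero]; exact Real.cos_lt_cos_of_nonneg_of_le_pi le_rfl hθ.2.le hθ.1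
    have h5 : -1 < Real.cos θ := by
      rw [← Real.cos_pi]; exact Real.cos_lt_cos_of_nonneg_of_le_pi hθ.1.le le_rfl hθ.2
    constructor <;> nlinarith
  · rintro ⟨h4, h5⟩
    have h6 : (y + 1 - (1 - q) * x) / (2 * √y) < 1 := by
      rw [div_lt_one (by positivity)]; nlinarith
    have h7 : -1 < (y + 1 - (1 - q) * x) / (2 * √y) := by
      rw [lt_div_iff₀ (by positivity)]; nlinarith
    refine ⟨Real.arccos ((y + 1 - (1 - q) * x) / (2 * √y)), ⟨Real.arccos_pos.2 h6, ?_⟩, ?_⟩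
    · refine lt_of_le_of_ne (Real.arccos_le_pi _) fun h => ?_
      rw [Real.arccos_eq_pi] at h
      linarith
    · rw [supportMap, Real.cos_arccos h7.le h6.le]
      field_simp
      ring

theorem injOn_supportMap (hq : q < 1) (hy : 0 < y) :
    Set.InjOn (supportMap y q) (Set.Ioo 0 Real.pi) := by
  intro θ hθ φ hφ h
  have := congrArg (v₂ y q) h
  rw [v₂_supportMap hq hy, v₂_supportMap hq hy] at this
  exact Real.injOn_cos ⟨hθ.1.le, hθ.2.le⟩ ⟨hφ.1.le, hφ.2.le⟩ this

theorem hasDerivAt_supportMap (y q θ : ℝ) :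
    HasDerivAt (supportMap y q) (2 * √y * Real.sin θ / (1 - q)) θ := by
  unfold supportMap
  have := (((Real.hasDerivAt_cos θ).const_mul (2 * √y)).const_sub (y + 1)).div_const (1 - q)
  exact this.congr_deriv (by ring)

theorem continuous_supportMap (y q : ℝ) : Continuous (supportMap y q) := by
  unfold supportMap; fun_prop

theorem qProd_ne_zero (hq : |q| < 1) {s θ : ℝ} (hs : |s| ≤ 1) (hθ : θ ∈ Set.Ioo 0 Real.pi) :
    qProd q (Real.cos θ) s ≠ 0 := by
  rw [qProd_eq_mul hq (Real.abs_cos_le_one θ) hs]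
  refine mul_ne_zero (factor_pos hθ s).ne' fun h => ?_
  have := qProd_mul_hermiteGen hq θ (abs_mul_lt_one hq hs)
  rw [h, zero_mul] at this
  exact zero_ne_one this

/-- The three kinds of factor are those of `qProd` at `s = 1`, `1/√y` and `q√y`. The remaining
`1/sin θ` is later cancelled by the derivative of `supportMap`. -/
theorem weight_supportMap (hq : |q| < 1) (hy : 0 < y) (ha : |(√y)⁻¹| ≤ 1) (hb : |q * √y| ≤ 1)
    {θ : ℝ} (hθ : θ ∈ Set.Ioo 0 Real.pi) :
    weight y q (supportMap y q θ) = ascWeight q (√y)⁻¹ (q * √y) θ / Real.sin θ := by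
  have hq1 : q < 1 := lt_of_abs_lt hq
  have hsin := Real.sin_pos_of_pos_of_lt_pi hθ.1 hθ.2
  rw [weight, v₂_supportMap hq1 hy, u₂_supportMap hq1 hy, ← Real.sin_sq, Real.sqrt_sq hsin.le]
  congr 1
  have hc := Real.abs_cos_le_one θ
  have h1 := hasProd_qProd hq (Real.abs_cos_le_one (2 * θ)) (show |(1 : ℝ)| ≤ 1 by simp)
  have h2 := hasProd_qProd hq hc ha
  have h3 := hasProd_qProd hq hc hb
  -- The infinite product of quotients is the quotient of the products because the denominator's
  -- limit is nonzero on the open arc.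
  have h4 := Tendsto.div h1 (h2.mul h3)
    (mul_ne_zero (qProd_ne_zero hq ha hθ) (qProd_ne_zero hq hb hθ))
  have h5 : HasProd (fun k : ℕ => (1 - 2 * Real.cos (2 * θ) * q ^ k + q ^ (2 * k)) /
      ((1 - 2 * Real.cos θ * q ^ k / √y + q ^ (2 * k) / y) *
        (1 - 2 * Real.cos θ * q ^ (k + 1) * √y + q ^ (2 * k + 2) * y)))
      (qProd q (Real.cos (2 * θ)) 1 /
        (qProd q (Real.cos θ) (√y)⁻¹ * qProd q (Real.cos θ) (q * √y))) := by
    refine Tendsto.congr (fun s => ?_) h4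
    simp only [Pi.div_apply]
    rw [← Finset.prod_div_distrib]
    refine Finset.prod_congr rfl fun k _ => ?_
    have e1 : ((√y)⁻¹ * q ^ k) ^ 2 = q ^ (2 * k) / y := by
      rw [mul_pow, inv_pow, Real.sq_sqrt hy.le]; ring
    have e2 : (q * √y * q ^ k) ^ 2 = q ^ (2 * k + 2) * y := by
      rw [mul_pow, mul_pow, Real.sq_sqrt hy.le]; ring
    rw [e1, e2]
    congr 1
    · ring
    · congr 1
      · ring
      · ring
  rw [h5.tprod_eq, ascWeight, hermiteWeight, div_eq_mul_inv, mul_inv]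

theorem abs_deriv_smul_weight (hq : |q| < 1) (hy : 0 < y) (ha : |(√y)⁻¹| ≤ 1)
    (hb : |q * √y| ≤ 1) (f : ℝ[X]) {θ : ℝ} (hθ : θ ∈ Set.Ioo 0 Real.pi) :
    |2 * √y * Real.sin θ / (1 - q)| •
      (weight y q (supportMap y q θ) * f.eval (supportMap y q θ)) =
    2 * √y / (1 - q) * (ascWeight q (√y)⁻¹ (q * √y) θ * f.eval (supportMap y q θ)) := by
  have hq1 : 0 < 1 - q := by have := lt_of_abs_lt hq; linarith
  have hsin := Real.sin_pos_of_pos_of_lt_pi hθ.1 hθ.2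
  have h2 := Real.sqrt_pos.2 hy
  rw [weight_supportMap hq hy ha hb hθ, abs_of_pos (by positivity), smul_eq_mul]
  field_simp

theorem Bminus_le_Bplus (hq : q < 1) (y : ℝ) : Bminus y q ≤ Bplus y q := by
  have h1 : 0 < 1 - q := by linarith
  have := Real.sqrt_nonneg y
  unfold Bminus Bplus
  exact div_le_div_of_nonneg_right (by nlinarith) h1.le

theorem intervalIntegrable_weight
    (hq : |q| < 1) (hy : 0 < y) (ha : |(√y)⁻¹| ≤ 1) (hb : |q * √y| ≤ 1)
    (hab : |(√y)⁻¹| < 1 ∨ |q * √y| < 1) (f : ℝ[X]) :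
    IntervalIntegrable (fun x => weight y q x * f.eval x) volume (Bminus y q) (Bplus y q) := by
  have hq1 : q < 1 := lt_of_abs_lt hq
  rw [intervalIntegrable_iff_integrableOn_Ioo_of_le (Bminus_le_Bplus hq1 y),
    ← image_supportMap hq1 hy, integrableOn_image_iff_integrableOn_abs_deriv_smul measurableSet_Ioo
      (fun θ _ => (hasDerivAt_supportMap y q θ).hasDerivWithinAt) (injOn_supportMap hq1 hy)]
  refine IntegrableOn.congr_fun ?_
    (fun θ hθ => (abs_deriv_smul_weight hq hy ha hb f hθ).symm) measurableSet_Ioo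
  exact (integrable_ascWeight_mul hq ha hb hab
    (f.continuous.comp (continuous_supportMap y q))).const_mul _

theorem momentFunctional_eq (hq : |q| < 1) (hy : 0 < y) (ha : |(√y)⁻¹| ≤ 1)
    (hb : |q * √y| ≤ 1) (f : ℝ[X]) :
    momentFunctional y q f = qPochInf q q * qPochInf q q / (2 * Real.pi) *
      ∫ θ, ascWeight q (√y)⁻¹ (q * √y) θ * f.eval (supportMap y q θ) ∂arc := by
  have hq1 : q < 1 := lt_of_abs_lt hq
  have h1 : 1 - q ≠ 0 := by linarith
  have h2 := (Real.sqrt_pos.2 hy).ne'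
  rw [momentFunctional, intervalIntegral.integral_of_le (Bminus_le_Bplus hq1 y),
    integral_Ioc_eq_integral_Ioo, ← image_supportMap hq1 hy,
    integral_image_eq_integral_abs_deriv_smul measurableSet_Ioo
      (fun θ _ => (hasDerivAt_supportMap y q θ).hasDerivWithinAt) (injOn_supportMap hq1 hy),
    setIntegral_congr_fun measurableSet_Ioo
      (fun θ hθ => abs_deriv_smul_weight hq hy ha hb f hθ), integral_const_mul, ← arc]
  generalize ∫ θ, ascWeight q (√y)⁻¹ (q * √y) θ * f.eval (supportMap y q θ) ∂arc = I
  field_simp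

/-- The recurrences agree after rescaling by `-√y/(1-q)`: `ab = q` makes `(1 - q^(k+1))(1 - ab q^k)`
the square coming from `[k+1]^2`, and `√y (a + b) q^(k+1) = q^(k+1) + y q^(k+2)` matches the middle
coefficient. -/
theorem eval_qLaguerre_supportMap (hq : q < 1) (hy : 0 < y) (θ : ℝ) (k : ℕ) :
    (qLaguerre y q k).eval (supportMap y q θ) =
      (-√y / (1 - q)) ^ k * ascPoly q (√y)⁻¹ (q * √y) (Real.cos θ) k := by
  have h1 : 1 - q ≠ 0 := by linarith
  have h2 := (Real.sqrt_pos.2 hy).ne'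
  have h3 := Real.sq_sqrt hy.le
  have hint : ∀ n, qInt q n = (1 - q ^ n) / (1 - q) := fun n => by
    rw [qInt, geom_sum_eq (by linarith), ← neg_div_neg_eq]
    congr 1 <;> ring
  have hab : (√y)⁻¹ * (q * √y) = q := by field_simp
  induction k using Nat.twoStepInduction with
  | zero => simp [qLaguerre_zero, ascPoly]
  | one =>
    rw [qLaguerre_one, eval_sub, eval_X, eval_C, supportMap, ascPoly]
    field_simp
    linear_combination (-q) * h3
  | more k h0 h1' =>
    rw [qLaguerre.eq_3, eval_sub, eval_mul, eval_mul, h0, h1', ascPoly_succ_succ, hab, hint, hint,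
      eval_sub, eval_X, eval_C, eval_C, supportMap]
    have e1 : (-√y / (1 - q)) ^ (k + 2) = (-√y / (1 - q)) ^ k * (y / (1 - q) ^ 2) := by
      rw [pow_add]; congr 1; rw [div_pow, neg_sq, h3]
    have e2 : (-√y / (1 - q)) ^ (k + 1) = (-√y / (1 - q)) ^ k * (-√y / (1 - q)) := pow_succ _ _
    rw [e1, e2]
    generalize (-√y / (1 - q)) ^ k = P
    generalize ascPoly q (√y)⁻¹ (q * √y) (Real.cos θ) (k + 1) = A1
    generalize ascPoly q (√y)⁻¹ (q * √y) (Real.cos θ) k = A0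
    generalize √y = s at h2 h3
    subst h3
    field_simp
    ring

/-- The explicit moment functional as a linear map. -/
theorem exists_linearMap_momentFunctional
    (hq : |q| < 1) (hy : 0 < y) (ha : |(√y)⁻¹| ≤ 1) (hb : |q * √y| ≤ 1)
    (hab : |(√y)⁻¹| < 1 ∨ |q * √y| < 1) :
    ∃ Λ : ℝ[X] →ₗ[ℝ] ℝ, ∀ f, Λ f = momentFunctional y q f := by
  have hi := intervalIntegrable_weight hq hy ha hb hab
  refine ⟨⟨⟨momentFunctional y q, fun f g => ?_⟩, fun c f => ?_⟩, fun f => rfl⟩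
  · simp only [momentFunctional]
    rw [← mul_add, ← intervalIntegral.integral_add (hi f) (hi g)]
    simp only [eval_add, mul_add]
  · simp only [momentFunctional, eval_smul, smul_eq_mul, RingHom.id_apply, mul_left_comm _ c]
    rw [intervalIntegral.integral_const_mul]
    ring

theorem momentFunctional_one
    (hq : |q| < 1) (hy : 0 < y) (ha : |(√y)⁻¹| ≤ 1) (hb : |q * √y| ≤ 1)
    (hab : |(√y)⁻¹| < 1 ∨ |q * √y| < 1) : momentFunctional y q 1 = 1 := by
  have h0 := qPochInf_ne_zero hq
  have hpi := Real.pi_pos.ne'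
  have h2 := (Real.sqrt_pos.2 hy).ne'
  have e : (√y)⁻¹ * (q * √y) = q := by field_simp
  rw [momentFunctional_eq hq hy ha hb]
  simp only [eval_one, mul_one]
  rw [integral_ascWeight hq ha hb hab, e, eulerSeries_self hq]
  field_simp

theorem momentFunctional_qLaguerre
    (hq : |q| < 1) (hy : 0 < y) (ha : |(√y)⁻¹| ≤ 1) (hb : |q * √y| ≤ 1)
    (hab : |(√y)⁻¹| < 1 ∨ |q * √y| < 1) {k : ℕ} (hk : k ≠ 0) :
    momentFunctional y q (qLaguerre y q k) = 0 := by
  obtain ⟨k, rfl⟩ := Nat.exists_eq_succ_of_ne_zero hk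
  rw [momentFunctional_eq hq hy ha hb]
  simp only [eval_qLaguerre_supportMap (lt_of_abs_lt hq) hy, mul_left_comm (ascWeight q _ _ _)]
  rw [integral_const_mul, integral_ascPoly hq ha hb hab, mul_zero, mul_zero]

end Moment

end QLaguerre

/-! ### Assembly of the two statements. -/

theorem mainTheorem4 {m : ℕ} (n : Fin m → ℕ) :
    (∀ y q : ℝ, -1 < q → q < 1 → 1 ≤ y → y * q ^ 2 ≤ 1 →
      IntervalIntegrable
          (fun x => QLaguerre.weight y q x * (∏ j, QLaguerre.qLaguerre y q (n j)).eval x)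
          MeasureTheory.volume (QLaguerre.Bminus y q) (QLaguerre.Bplus y q) ∧
        QLaguerre.derangementSum y q n =
          QLaguerre.momentFunctional y q (∏ j, QLaguerre.qLaguerre y q (n j))) ∧
    (∀ (R : Type*) [CommRing R] (y q : R) (Λ : Polynomial R →ₗ[R] R),
      QLaguerre.IsOrthogonalityFunctional y q Λ →
        QLaguerre.derangementSum y q n = Λ (∏ j, QLaguerre.qLaguerre y q (n j))) := by
  refine ⟨fun y q h1 h2 hy hyq => ?_, fun R _ y q Λ hΛ =>
    QLaguerre.derangementSum_eq_of_isOrthogonalityFunctional y q Λ hΛ n⟩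
  have hq : |q| < 1 := abs_lt.2 ⟨h1, h2⟩
  have hy0 : 0 < y := by linarith
  have hs : 1 ≤ √y := Real.one_le_sqrt.2 hy
  have ha : |(√y)⁻¹| ≤ 1 := by
    rw [abs_of_pos (by positivity)]; exact inv_le_one_of_one_le₀ hs
  have hb : |q * √y| ≤ 1 := by
    rw [← sq_le_one_iff_abs_le_one, mul_pow, Real.sq_sqrt hy0.le]; linarith
  -- At most one parameter has absolute value 1: if `√y = 1`, the second parameter is `q`.
  have hab : |(√y)⁻¹| < 1 ∨ |q * √y| < 1 := by
    rcases hs.eq_or_lt with h | h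
    · right; rw [← h, mul_one]; exact hq
    · left; rw [abs_of_pos (by positivity)]; exact inv_lt_one_of_one_lt₀ h
  refine ⟨QLaguerre.intervalIntegrable_weight hq hy0 ha hb hab _, ?_⟩
  obtain ⟨Λ, hΛ⟩ := QLaguerre.exists_linearMap_momentFunctional hq hy0 ha hb hab
  rw [← hΛ]
  refine QLaguerre.derangementSum_eq_of_vanishing y q Λ ?_ (fun k hk => ?_) n
  · rw [hΛ, QLaguerre.momentFunctional_one hq hy0 ha hb hab]
  · rw [hΛ, QLaguerre.momentFunctional_qLaguerre hq hy0 ha hb hab hk]
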